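/- Let $\hbar>0$. For $\boldsymbol{w}\in\mathbb{C}^{n}$ and $\boldsymbol{y}\in\mathbb{C}^{n+1}$ put $$\varpi(\boldsymbol{w}\mid\boldsymbol{y})=\prod_{a=1}^{n}\prod_{b=1}^{n+1}\Big\{\hbar^{\frac{i}{\hbar}(w_a-y_b)}\,\Gamma\Big(\frac{y_b-w_a}{i\hbar}\Big)\Big\}\cdot\prod_{\substack{a,b=1\\ a\neq b}}^{n}\Gamma^{-1}\Big(\frac{w_b-w_a}{i\hbar}\Big).$$ Let $0<\alpha_1<\alpha_2<\cdots$. The Whittaker functions in Mellin--Barnes form are defined by $\varphi_y(x)=e^{\frac{i}{\hbar}xy}$ for $N=1$ and, for $N\ge 1$, $\boldsymbol{x}_{N+1}=(x_1,\dots,x_{N+1})\in\mathbb{R}^{N+1}$ and $\boldsymbol{x}_N=(x_1,\dots,x_N)$, by $$\varphi_{\boldsymbol{y}_{N+1}}(\boldsymbol{x}_{N+1})=\int_{(\mathbb{R}-i\alpha_1)^N} e^{\frac{i}{\hbar}\left(\sum_{b=1}^{N+1}y_b-\sum_{a=1}^{N}w_a\right)x_{N+1}}\,\varphi_{\boldsymbol{w}_N}(\boldsymbol{x}_N)\,\varpi(\boldsymbol{w}_N\mid\boldsymbol{y}_{N+1})\,\frac{\mathrm{d}^Nw}{N!\,(2\pi\hbar)^N},$$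 where the contours used in $\varphi_{\boldsymbol{w}_N}$ are at heights $-\alpha_2,-\alpha_3,\dots$, and so on recursively; for $N=0$ put $\varphi=1$. For $\lambda\in\mathbb{R}$ let $V_{\lambda;\pm}(x)=\exp\{-\frac1\hbar e^{\pm x}+\frac{i\lambda x}{2\hbar}\}$ and, for $\boldsymbol{x}\in\mathbb{R}^N$, $\boldsymbol{\tau}\in\mathbb{R}^{N-1}$, $$\Lambda^{(N)}_\lambda(\boldsymbol{x}\mid\boldsymbol{\tau})=e^{\frac{i\lambda}{2\hbar}(x_1+x_N)}\prod_{n=1}^{N-1}V_{\lambda;-}(x_n-\tau_n)\prod_{n=2}^{N}V_{\lambda;+}(x_n-\tau_{n-1}),$$ and denote by $\Lambda^{(N)}_\lambda$ also the integral operator with this kernel, mapping functions on $\mathbb{R}^{N-1}$ to functions on $\mathbb{R}^N$. Then for every $N\ge1$, all $\boldsymbol{y}_N=(y_1,\dots,y_N)\in\mathbb{R}^N$ and $\boldsymbol{x}_N\in\mathbb{R}^N$, and every choice of the heights $\alpha_s$: each of the integrals in the iterated Mellin--Barnes integral for $\varphi_{\boldsymbol{y}_N}(\boldsymbol{x}_N)$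 converges absolutely, and, with $\boldsymbol{y}_{N-1}=(y_1,\dots,y_{N-1})$, $$\varphi_{\boldsymbol{y}_N}(\boldsymbol{x}_N)=\int_{\mathbb{R}^{N-1}}\Lambda^{(N)}_{y_N}(\boldsymbol{x}_N\mid\boldsymbol{\tau}_{N-1})\,\varphi_{\boldsymbol{y}_{N-1}}(\boldsymbol{\tau}_{N-1})\,\mathrm{d}^{N-1}\tau ,$$ where the integral converges absolutely and the contour heights used for $\varphi_{\boldsymbol{y}_{N-1}}$ on the right may be chosen independently of those on the left. Moreover $$\varphi_{\boldsymbol{y}_N}(\boldsymbol{x}_N)=\big(\Lambda^{(N)}_{y_1}\Lambda^{(N-1)}_{y_2}\cdots\Lambda^{(1)}_{y_N}\big)(\boldsymbol{x}_N),$$ the right-hand side being an iterated integral (innermost integration first, all integrals absolutely convergent). -/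

import Mathlib

open MeasureTheory

noncomputable section

namespace Toda

/-- `ϖ(w | y) = ∏_{a, b} ħ^{(i/ħ)(w_a - y_b)} Γ((y_b - w_a)/(iħ)) · ∏_{a ≠ b} Γ((w_b - w_a)/(iħ))⁻¹`
for `w ∈ ℂ^N`, `y ∈ ℂ^{N+1}`.  (Mathlib has `Gamma 0 = 0`, so `(Gamma 0)⁻¹ = 0` is the value at `0`
of the entire function `1/Γ`.) -/
def varpi (ħ : ℝ) {N : ℕ} (w : Fin N → ℂ) (y : Fin (N + 1) → ℂ) : ℂ :=
  (∏ a : Fin N, ∏ b : Fin (N + 1),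
      (ħ : ℂ) ^ (Complex.I / ħ * (w a - y b)) * Complex.Gamma ((y b - w a) / (Complex.I * ħ))) *
    ∏ a : Fin N, ∏ b ∈ Finset.univ.filter (fun b => b ≠ a),
      (Complex.Gamma ((w b - w a) / (Complex.I * ħ)))⁻¹

/-- The integrand of the Mellin–Barnes induction step from `N` to `N + 1`, as a function of
`w ∈ ℂ^N`, where `F w x` stands for the function of `N` variables already constructed. -/
def mellinBarnesIntegrand (ħ : ℝ) {N : ℕ} (F : (Fin N → ℂ) → (Fin N → ℝ) → ℂ)
    (y : Fin (N + 1) → ℂ) (x : Fin (N + 1) → ℝ) (w : Fin N → ℂ) : ℂ :=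
  Complex.exp (Complex.I / ħ * ((∑ b, y b - ∑ a, w a) * x (Fin.last N))) *
    F w (Fin.init x) * varpi ħ w y / ((N.factorial : ℂ) * (2 * Real.pi * ħ : ℂ) ^ N)

/-- The point of the contour `(ℝ - iα)^N` with real part `u`. -/
def contour {N : ℕ} (α : ℝ) (u : Fin N → ℝ) : Fin N → ℂ :=
  fun a => (u a : ℂ) - Complex.I * α

/-- The Whittaker function `φ_y(x)`, `y ∈ ℂ^N`, `x ∈ ℝ^N`, in its Mellin–Barnes representation.
The `s`-th integration (`s = 0, 1, …`) runs over `(ℝ - i α_s)^{N - 1 - s}`. For `N = 0` the value is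
`1`, the empty product. -/
def whittaker (ħ : ℝ) : (N : ℕ) → (ℕ → ℝ) → (Fin N → ℂ) → (Fin N → ℝ) → ℂ
  | 0, _, _, _ => 1
  | 1, _, y, x => Complex.exp (Complex.I / ħ * (x 0 * y 0))
  | N + 2, α, y, x =>
      ∫ u : Fin (N + 1) → ℝ,
        mellinBarnesIntegrand ħ (whittaker ħ (N + 1) (fun s => α (s + 1))) y x (contour (α 0) u)

/-- Absolute convergence of every integral of the iterated integral `whittaker ħ N α y x`. -/
def WhittakerConverges (ħ : ℝ) : (N : ℕ) → (ℕ → ℝ) → (Fin N → ℂ) → (Fin N → ℝ) → Prop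
  | 0, _, _, _ => True
  | 1, _, _, _ => True
  | N + 2, α, y, x =>
      Integrable (fun u : Fin (N + 1) → ℝ =>
        mellinBarnesIntegrand ħ (whittaker ħ (N + 1) (fun s => α (s + 1))) y x
          (contour (α 0) u)) ∧
      ∀ u : Fin (N + 1) → ℝ,
        WhittakerConverges ħ (N + 1) (fun s => α (s + 1)) (contour (α 0) u) (Fin.init x)

/-- `V_{λ;+}(x) = exp(-e^{x}/ħ + iλx/(2ħ))`. -/
def Vplus (ħ lam x : ℝ) : ℂ :=
  Complex.exp (-(1 / ħ) * Real.exp x + Complex.I * (lam * x / (2 * ħ)))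

/-- `V_{λ;-}(x) = exp(-e^{-x}/ħ + iλx/(2ħ))`. -/
def Vminus (ħ lam x : ℝ) : ℂ :=
  Complex.exp (-(1 / ħ) * Real.exp (-x) + Complex.I * (lam * x / (2 * ħ)))

/-- The kernel `Λ^{(N+1)}_λ(x | τ)`, `x ∈ ℝ^{N+1}`, `τ ∈ ℝ^N`. -/
def Lambda (ħ lam : ℝ) {N : ℕ} (x : Fin (N + 1) → ℝ) (τ : Fin N → ℝ) : ℂ :=
  Complex.exp (Complex.I * lam / (2 * ħ) * (x 0 + x (Fin.last N))) *
    (∏ n : Fin N, Vminus ħ lam (x n.castSucc - τ n)) *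
    ∏ n : Fin N, Vplus ħ lam (x n.succ - τ n)

/-- The integral operator `Λ^{(N+1)}_λ` from functions on `ℝ^N` to functions on `ℝ^{N+1}`. -/
def LambdaOp (ħ lam : ℝ) {N : ℕ} (f : (Fin N → ℝ) → ℂ) (x : Fin (N + 1) → ℝ) : ℂ :=
  ∫ τ : Fin N → ℝ, Lambda ħ lam x τ * f τ

/-- The Gauss–Givental pyramid `Λ^{(N)}_{y_1} Λ^{(N-1)}_{y_2} ⋯ Λ^{(1)}_{y_N}`, an iterated integral
whose innermost integrations are performed first (applied to the constant `1` on `ℝ^0`). -/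
def pyramid (ħ : ℝ) : (N : ℕ) → (Fin N → ℝ) → (Fin N → ℝ) → ℂ
  | 0, _ => fun _ => 1
  | N + 1, y => LambdaOp ħ (y 0) (pyramid ħ N (Fin.tail y))

/-- Absolute convergence of every integral of the iterated integral `pyramid ħ N y x`. -/
def PyramidConverges (ħ : ℝ) : (N : ℕ) → (Fin N → ℝ) → (Fin N → ℝ) → Prop
  | 0, _, _ => True
  | N + 1, y, x =>
      Integrable (fun τ : Fin N → ℝ => Lambda ħ (y 0) x τ * pyramid ħ N (Fin.tail y) τ) ∧
      ∀ τ : Fin N → ℝ, PyramidConverges ħ N (Fin.tail y) τ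

end Toda

end

noncomputable section

namespace Toda

open Complex Filter Topology

/-- A parametric integral of holomorphic functions, locally dominated, is holomorphic. -/
theorem differentiableOn_integral_of_dominated {X : Type*} [MeasurableSpace X] {m : Measure X}
    {U : Set ℂ} (hU : IsOpen U) {g : ℂ → X → ℂ}
    (hmeas : ∀ ζ ∈ U, AEStronglyMeasurable (g ζ) m)
    (hdiff : ∀ x, DifferentiableOn ℂ (fun ζ => g ζ x) U)
    (hdom : ∀ ζ₀ ∈ U, ∃ ε > 0, ∃ B : X → ℝ, Integrable B m ∧
      ∀ ζ ∈ Metric.closedBall ζ₀ ε, ζ ∈ U ∧ ∀ x, ‖g ζ x‖ ≤ B x) :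
    DifferentiableOn ℂ (fun ζ => ∫ x, g ζ x ∂m) U := by
  intro ζ₀ hζ₀
  obtain ⟨ε, hε, B, hB, hb⟩ := hdom ζ₀ hζ₀
  have hd : ∀ x, ∀ ζ ∈ Metric.closedBall ζ₀ ε, HasDerivAt (fun ζ => g ζ x)
      (deriv (fun ζ => g ζ x) ζ) ζ := fun x ζ hζ =>
    ((hdiff x).differentiableAt (hU.mem_nhds (hb ζ hζ).1)).hasDerivAt
  have key := hasDerivAt_integral_of_dominated_loc_of_deriv_le (𝕜 := ℂ) (μ := m) (F := g)
    (x₀ := ζ₀) (s := Metric.ball ζ₀ (ε / 2)) (bound := fun x => B x / (ε / 2))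
    (F' := fun ζ x => deriv (fun ζ => g ζ x) ζ)
    (Metric.ball_mem_nhds _ (by positivity))
    (by
      filter_upwards [hU.mem_nhds hζ₀] with ζ hζ using hmeas ζ hζ)
    (hB.mono' (hmeas _ hζ₀) (Eventually.of_forall fun x =>
      (hb ζ₀ (Metric.mem_closedBall_self hε.le)).2 x))
    (by
      set s : ℕ → ℂ := fun k => ((ε / ((k : ℝ) + 1) : ℝ) : ℂ) with hs
      have hk : ∀ k : ℕ, 0 < ε / ((k : ℝ) + 1) := fun k => by positivity
      have hsb : ∀ k, ζ₀ + s k ∈ Metric.closedBall ζ₀ ε := by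
        intro k
        simp only [hs, Metric.mem_closedBall, dist_self_add_left, norm_real, Real.norm_eq_abs]
        rw [abs_of_pos (hk k)]
        exact div_le_self hε.le (by linarith [(Nat.cast_nonneg k : (0:ℝ) ≤ k)])
      have ht : Tendsto s atTop (𝓝[≠] 0) := by
        refine tendsto_nhdsWithin_iff.2 ⟨?_, Eventually.of_forall fun k => ?_⟩
        · rw [← ofReal_zero]
          refine (continuous_ofReal.tendsto _).comp ?_
          have := (tendsto_one_div_add_atTop_nhds_zero_nat (𝕜 := ℝ)).const_mul ε
          simpa [div_eq_mul_inv] using this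
        · simp only [hs, Set.mem_compl_iff, Set.mem_singleton_iff, ofReal_eq_zero]
          exact (hk k).ne'
      refine aestronglyMeasurable_of_tendsto_ae atTop
        (f := fun k x => (s k)⁻¹ • (g (ζ₀ + s k) x - g ζ₀ x)) (fun k => ?_)
        (Eventually.of_forall fun x => ?_)
      · exact ((hmeas _ (hb _ (hsb k)).1).sub (hmeas _ hζ₀)).const_smul ((s k)⁻¹)
      · exact ((hasDerivAt_iff_tendsto_slope_zero.1
          (hd x ζ₀ (Metric.mem_closedBall_self hε.le))).comp ht))
    (Eventually.of_forall fun x ζ hζ => by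
      refine norm_deriv_le_of_forall_mem_sphere_norm_le (by positivity) ?_ ?_
      · refine DifferentiableOn.diffContOnCl_ball (U := U) (hdiff x) ?_
        intro z hz
        refine (hb z ?_).1
        rw [Metric.mem_closedBall] at hz ⊢
        rw [Metric.mem_ball] at hζ
        linarith [dist_triangle z ζ ζ₀]
      · intro z hz
        refine (hb z ?_).2 x
        rw [Metric.mem_sphere] at hz
        rw [Metric.mem_closedBall]
        rw [Metric.mem_ball] at hζ
        linarith [dist_triangle z ζ ζ₀])
    (hB.div_const _)
    (Eventually.of_forall fun x ζ hζ => hd x ζ (by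
      rw [Metric.mem_ball] at hζ
      rw [Metric.mem_closedBall]; linarith))
  exact key.2.differentiableAt.differentiableWithinAt

/-- A holomorphic parametric integral that is invariant under translation of the parameter in one
real direction is constant. -/
theorem integral_eq_of_translation_invariant {X : Type*} [MeasurableSpace X] {m : Measure X}
    {U : Set ℂ} (hU : IsOpen U) (hUc : IsPreconnected U) {g : ℂ → X → ℂ}
    (hmeas : ∀ ζ ∈ U, AEStronglyMeasurable (g ζ) m)
    (hdiff : ∀ x, DifferentiableOn ℂ (fun ζ => g ζ x) U)
    (hdom : ∀ ζ₀ ∈ U, ∃ ε > 0, ∃ B : X → ℝ, Integrable B m ∧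
      ∀ ζ ∈ Metric.closedBall ζ₀ ε, ζ ∈ U ∧ ∀ x, ‖g ζ x‖ ≤ B x)
    {d : ℂ} (hd : d ≠ 0)
    (hinv : ∀ ζ ∈ U, ∀ r : ℝ, ζ + r * d ∈ U → ∫ x, g (ζ + r * d) x ∂m = ∫ x, g ζ x ∂m)
    {ζ₁ ζ₂ : ℂ} (h₁ : ζ₁ ∈ U) (h₂ : ζ₂ ∈ U) : ∫ x, g ζ₁ x ∂m = ∫ x, g ζ₂ x ∂m := by
  have hF := differentiableOn_integral_of_dominated hU hmeas hdiff hdom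
  refine hU.is_const_of_deriv_eq_zero hUc hF (fun ζ hζ => ?_) h₁ h₂
  have hda := (hF.differentiableAt (hU.mem_nhds hζ)).hasDerivAt
  have hc : HasDerivAt (fun r : ℝ => ζ + r * d) d 0 := by
    simpa using ((ofRealCLM.hasDerivAt (x := (0 : ℝ))).mul_const d).const_add ζ
  have hda' : HasDerivAt (fun ζ => ∫ x, g ζ x ∂m) (deriv (fun ζ => ∫ x, g ζ x ∂m) ζ)
      (ζ + ((0 : ℝ) : ℂ) * d) := by simpa only [ofReal_zero, zero_mul, add_zero] using hda
  have h := HasDerivAt.scomp (𝕜 := ℝ) (𝕜' := ℂ) (0 : ℝ) hda' hc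
  have hev : (fun r : ℝ => ∫ x, g (ζ + r * d) x ∂m) =ᶠ[𝓝 0] fun _ => ∫ x, g ζ x ∂m := by
    have : ∀ᶠ r : ℝ in 𝓝 0, ζ + r * d ∈ U := hc.continuousAt.eventually_mem
      (hU.mem_nhds (by simpa using hζ))
    filter_upwards [this] with r hr using hinv ζ hζ r hr
  have h2 := (h.congr_of_eventuallyEq hev.symm).unique (hasDerivAt_const _ _)
  simpa [hd] using h2

theorem integrable_exp_neg_mul_abs_real {δ : ℝ} (hδ : 0 < δ) :
    Integrable (fun u : ℝ => Real.exp (-δ * |u|)) := by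
  have h1 : IntegrableOn (fun u : ℝ => Real.exp (-δ * |u|)) (Set.Ioi 0) :=
    (integrableOn_exp_mul_Ioi (neg_neg_of_pos hδ) 0).congr_fun (fun u hu => by
      simp only [abs_of_pos (Set.mem_Ioi.1 hu)]) measurableSet_Ioi
  have h2 : IntegrableOn (fun u : ℝ => Real.exp (-δ * |u|)) (Set.Iic 0) :=
    (integrableOn_exp_mul_Iic hδ 0).congr_fun (fun u hu => by
      simp only [abs_of_nonpos (Set.mem_Iic.1 hu), neg_mul_neg]) measurableSet_Iic
  rw [← integrableOn_univ, ← Set.Iic_union_Ioi (a := (0:ℝ))]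
  exact h2.union h1

/-- Shift of a vertical contour of integration. -/
theorem integral_vertical_eq {a b : ℝ} {H : ℂ → ℂ}
    (hH : DifferentiableOn ℂ H {z | a < z.re ∧ z.re < b})
    (hdec : ∀ a' b', a < a' → b' < b → ∃ C : ℝ, ∃ δ > 0,
      ∀ z : ℂ, a' ≤ z.re → z.re ≤ b' → ‖H z‖ ≤ C * Real.exp (-δ * |z.im|))
    {c₁ c₂ : ℝ} (h₁ : a < c₁) (h₁' : c₁ < b) (h₂ : a < c₂) (h₂' : c₂ < b) :
    ∫ u : ℝ, H (c₁ + I * u) = ∫ u : ℝ, H (c₂ + I * u) := by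
  set U : Set ℂ := {z | (a < z.re ∧ z.re < b) ∧ (-1 < z.im ∧ z.im < 1)} with hUdef
  have hUo : IsOpen U := by
    refine IsOpen.and (IsOpen.and ?_ ?_) (IsOpen.and ?_ ?_) <;>
    first
      | exact isOpen_lt continuous_const continuous_re
      | exact isOpen_lt continuous_re continuous_const
      | exact isOpen_lt continuous_const continuous_im
      | exact isOpen_lt continuous_im continuous_const
  have hUc : Convex ℝ U :=
    ((convex_halfSpace_re_gt a).inter (convex_halfSpace_re_lt b)).inter
      ((convex_halfSpace_im_gt (-1)).inter (convex_halfSpace_im_lt 1))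
  have hsub : ∀ ζ ∈ U, ∀ u : ℝ, ζ + I * u ∈ {z : ℂ | a < z.re ∧ z.re < b} := by
    intro ζ hζ u; simpa using hζ.1
  have hopen : IsOpen {z : ℂ | a < z.re ∧ z.re < b} :=
    IsOpen.and (isOpen_lt continuous_const continuous_re)
      (isOpen_lt continuous_re continuous_const)
  refine integral_eq_of_translation_invariant (g := fun ζ (u : ℝ) => H (ζ + I * u)) hUo
    hUc.isPreconnected (ζ₁ := c₁) (ζ₂ := c₂) ?_ ?_ ?_ (d := I) I_ne_zero ?_ (by simp [U, h₁, h₁']) (by simp [U, h₂, h₂'])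
  · intro ζ hζ
    refine Continuous.aestronglyMeasurable ?_
    exact hH.continuousOn.comp_continuous (by fun_prop) (hsub ζ hζ)
  · intro u ζ hζ
    have := (hH.differentiableAt (hopen.mem_nhds (hsub ζ hζ u)))
    exact (this.comp ζ (by fun_prop : DifferentiableAt ℂ (fun ζ => ζ + I * u) ζ)).differentiableWithinAt
  · intro ζ₀ hζ₀
    obtain ⟨ε, hε, hb⟩ := Metric.isOpen_iff.1 hUo ζ₀ hζ₀
    have hcb : Metric.closedBall ζ₀ (ε / 2) ⊆ U :=
      (Metric.closedBall_subset_ball (by linarith)).trans hb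
    have hre : ∀ ζ ∈ Metric.closedBall ζ₀ (ε / 2), |ζ.re - ζ₀.re| ≤ ε / 2 := by
      intro ζ hζ
      rw [Metric.mem_closedBall, dist_eq_norm] at hζ
      exact (by simpa using abs_re_le_norm (ζ - ζ₀) : |ζ.re - ζ₀.re| ≤ ‖ζ - ζ₀‖).trans hζ
    have hmem : ∀ r : ℝ, |r| ≤ ε / 2 → ζ₀ + r ∈ U := by
      intro r hr
      exact hcb (by simpa [Metric.mem_closedBall] using hr)
    have hl := (hmem (-(ε / 2)) (by rw [abs_neg, abs_of_pos (by positivity)])).1.1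
    have hr := (hmem (ε / 2) (by rw [abs_of_pos (by positivity)])).1.2
    simp only [add_re, ofReal_re] at hl hr
    obtain ⟨C, δ, hδ, hBb⟩ := hdec (ζ₀.re + -(ε / 2)) (ζ₀.re + ε / 2) hl hr
    refine ⟨ε / 2, by positivity, fun u => |C| * (Real.exp δ * Real.exp (-δ * |u|)),
      ((integrable_exp_neg_mul_abs_real hδ).const_mul _).const_mul _, fun ζ hζ => ⟨hcb hζ, fun u => ?_⟩⟩
    have h1 := abs_le.1 (hre ζ hζ)
    have h2 := (hcb hζ).2
    refine (hBb (ζ + I * u) (by simp; linarith [h1.1]) (by simp; linarith [h1.2])).trans ?_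
    refine mul_le_mul (le_abs_self C) ?_ (Real.exp_nonneg _) (abs_nonneg C)
    rw [← Real.exp_add]
    refine Real.exp_le_exp.2 ?_
    have h3 : |u| ≤ |(ζ + I * u).im| + 1 := by
      have : u = (ζ + I * u).im - ζ.im := by simp
      calc |u| = |(ζ + I * u).im - ζ.im| := by rw [← this]
        _ ≤ |(ζ + I * u).im| + |ζ.im| := abs_sub _ _
        _ ≤ _ := by gcongr; exact abs_le.2 ⟨h2.1.le, h2.2.le⟩
    nlinarith
  · intro ζ _ r _
    have := integral_add_left_eq_self (μ := (volume : Measure ℝ)) (fun u : ℝ => H (ζ + I * u)) r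
    rw [← this]
    congr 1; ext u; congr 1; push_cast; ring

theorem integrable_cexp_mul_exp_neg_exp {s : ℂ} (hs : 0 < s.re) :
    Integrable (fun p : ℝ => cexp (p * s) * cexp (-Real.exp p)) := by
  have h := Complex.GammaIntegral_convergent hs
  rw [← Real.range_exp, ← Set.image_univ, integrableOn_image_iff_integrableOn_abs_deriv_smul
    MeasurableSet.univ (fun x _ => (Real.hasDerivAt_exp x).hasDerivWithinAt)
    Real.exp_injective.injOn, integrableOn_univ] at h
  refine h.congr (Eventually.of_forall fun p => ?_)
  simp only [abs_of_pos (Real.exp_pos p), real_smul]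
  rw [Complex.cpow_def_of_ne_zero (by exact_mod_cast (Real.exp_pos p).ne'), ← ofReal_log (Real.exp_pos p).le,
    Real.log_exp, ofReal_exp, ofReal_exp, ← Complex.exp_add,← Complex.exp_add,← Complex.exp_add]
  congr 1; push_cast; ring

/-- Euler's integral after the substitution `t = e^p`. -/
theorem Gamma_eq_integral_exp {s : ℂ} (hs : 0 < s.re) :
    Gamma s = ∫ p : ℝ, cexp (p * s) * cexp (-Real.exp p) := by
  rw [Complex.Gamma_eq_integral hs, Complex.GammaIntegral, ← Real.range_exp, ← Set.image_univ,
    integral_image_eq_integral_abs_deriv_smul MeasurableSet.univ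
      (fun x _ => (Real.hasDerivAt_exp x).hasDerivWithinAt) Real.exp_injective.injOn,
    setIntegral_univ]
  congr 1; ext p
  simp only [abs_of_pos (Real.exp_pos p), real_smul]
  rw [Complex.cpow_def_of_ne_zero (by exact_mod_cast (Real.exp_pos p).ne'), ← ofReal_log (Real.exp_pos p).le,
    Real.log_exp, ofReal_exp, ofReal_exp, ← Complex.exp_add,← Complex.exp_add,← Complex.exp_add]
  congr 1; push_cast; ring

/-- Rotation of the ray of integration in Euler's integral. -/
theorem Gamma_eq_integral_rotated {s : ℂ} (hs : 0 < s.re) {θ : ℝ} (h1 : -(Real.pi / 2) < θ)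
    (h2 : θ < Real.pi / 2) :
    Gamma s = ∫ p : ℝ, cexp ((p + I * θ) * s - cexp (p + I * θ)) := by
  set U : Set ℂ := {z | -(Real.pi / 2) < z.im ∧ z.im < Real.pi / 2} with hU
  have hUo : IsOpen U := IsOpen.and (isOpen_lt continuous_const continuous_im)
    (isOpen_lt continuous_im continuous_const)
  have hUc : Convex ℝ U := (convex_halfSpace_im_gt _).inter (convex_halfSpace_im_lt _)
  have h0 : (0 : ℂ) ∈ U := by simp [U, Real.pi_pos]
  have hθ : I * θ ∈ U := by simp [U, h1, h2]
  have hinteg : ∀ k : ℝ, 0 < k → Integrable (fun p : ℝ => Real.exp (p * s.re - k * Real.exp p)) := by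
    intro k hk
    have := (integrable_cexp_mul_exp_neg_exp (s := (s.re : ℂ)) (by simpa using hs)).norm
    have := (this.comp_add_right (Real.log k)).const_mul (Real.exp (- Real.log k * s.re))
    refine this.congr (Eventually.of_forall fun p => ?_)
    simp only [norm_mul, Complex.norm_exp]
    rw [← Real.exp_add, ← Real.exp_add]
    congr 1
    simp [Real.exp_add, Real.exp_log hk, Complex.exp_ofReal_re]
    ring
  have key := integral_eq_of_translation_invariant (m := (volume : Measure ℝ))
    (g := fun ζ (p : ℝ) => cexp ((p + ζ) * s - cexp (p + ζ))) hUo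
    hUc.isPreconnected (ζ₁ := 0) (ζ₂ := I * θ) ?_ ?_ ?_ (d := 1) one_ne_zero ?_ h0 hθ
  · rw [← key, Gamma_eq_integral_exp hs]
    congr 1; ext p; rw [← Complex.exp_add]; congr 1; push_cast; ring_nf
  · intro ζ _
    exact Continuous.aestronglyMeasurable (by fun_prop)
  · intro p
    exact (by fun_prop : Differentiable ℂ _).differentiableOn
  · intro ζ₀ hζ₀
    obtain ⟨ε, hε, hb⟩ := Metric.isOpen_iff.1 hUo ζ₀ hζ₀
    have hcb : Metric.closedBall ζ₀ (ε / 2) ⊆ U :=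
      (Metric.closedBall_subset_ball (by linarith)).trans hb
    obtain ⟨z₀, hz₀, hmin⟩ := (isCompact_closedBall ζ₀ (ε / 2)).exists_isMinOn
      ⟨ζ₀, Metric.mem_closedBall_self (by positivity)⟩
      (by fun_prop : ContinuousOn (fun z : ℂ => Real.exp z.re * Real.cos z.im) _)
    obtain ⟨z₁, hz₁, hmax⟩ := (isCompact_closedBall ζ₀ (ε / 2)).exists_isMaxOn
      ⟨ζ₀, Metric.mem_closedBall_self (by positivity)⟩
      (by fun_prop : ContinuousOn (fun z : ℂ => (z * s).re) _)
    have hpos : 0 < Real.exp z₀.re * Real.cos z₀.im :=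
      mul_pos (Real.exp_pos _) (Real.cos_pos_of_mem_Ioo (hcb hz₀))
    refine ⟨ε / 2, by positivity, fun p => Real.exp ((z₁ * s).re) *
      Real.exp (p * s.re - (Real.exp z₀.re * Real.cos z₀.im) * Real.exp p),
      (hinteg _ hpos).const_mul _, fun ζ hζ => ⟨hcb hζ, fun p => ?_⟩⟩
    beta_reduce
    rw [Complex.norm_exp, ← Real.exp_add]
    refine Real.exp_le_exp.2 ?_
    have e1 := hmin hζ
    have e2 := hmax hζ
    simp only [Set.mem_ofPred_eq] at e1 e2
    have : ((p + ζ) * s - cexp (p + ζ)).re = p * s.re + (ζ * s).re -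
        Real.exp p * (Real.exp ζ.re * Real.cos ζ.im) := by
      simp [Complex.exp_re, Real.exp_add]; ring
    rw [this]
    have := mul_le_mul_of_nonneg_left e1 (Real.exp_pos p).le
    linarith
  · intro ζ _ r _
    have := integral_add_right_eq_self (μ := (volume : Measure ℝ))
      (fun p : ℝ => cexp ((p + ζ) * s - cexp (p + ζ))) r
    rw [← this]
    congr 1; ext u; push_cast; ring_nf

theorem integrable_exp_mul_sub_exp {σ : ℝ} (hσ : 0 < σ) :
    Integrable (fun p : ℝ => Real.exp (p * σ - Real.exp p)) := by
  refine (integrable_cexp_mul_exp_neg_exp (s := (σ : ℂ)) (by simpa using hσ)).norm.congr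
    (Eventually.of_forall fun p => ?_)
  simp only [norm_mul, Complex.norm_exp]
  rw [← Real.exp_add]
  simp [Complex.exp_ofReal_re, sub_eq_add_neg]

theorem norm_Gamma_le_rotated {s : ℂ} (hs : 0 < s.re) {θ : ℝ} (h1 : -(Real.pi / 2) < θ)
    (h2 : θ < Real.pi / 2) :
    ‖Gamma s‖ ≤ Real.exp (-(θ * s.im)) * Real.exp (-(s.re * Real.log (Real.cos θ))) *
      ∫ p : ℝ, Real.exp (p * s.re - Real.exp p) := by
  have hk : 0 < Real.cos θ := Real.cos_pos_of_mem_Ioo ⟨h1, h2⟩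
  rw [Gamma_eq_integral_rotated hs h1 h2]
  refine (norm_integral_le_integral_norm _).trans (le_of_eq ?_)
  rw [← integral_add_right_eq_self (μ := (volume : Measure ℝ))
    (fun p : ℝ => Real.exp (p * s.re - Real.exp p)) (Real.log (Real.cos θ)), ← integral_const_mul]
  congr 1; ext p
  rw [Complex.norm_exp, ← Real.exp_add, ← Real.exp_add]
  congr 1
  simp [Complex.exp_re, Real.exp_add, Real.exp_log hk]
  ring

/-- Exponential decay of the Gamma function in vertical strips. -/
theorem exists_norm_Gamma_le {a : ℝ} (ha : 0 < a) (A : ℕ) :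
    ∃ C > 0, ∀ s : ℂ, a ≤ s.re → s.re ≤ A →
      ‖Gamma s‖ ≤ C * (1 + |s.im|) ^ A * Real.exp (-(Real.pi / 2 * |s.im|)) := by
  set G : ℝ → ℝ := fun σ => ∫ p : ℝ, Real.exp (p * σ - Real.exp p) with hG
  have hG0 : ∀ σ, 0 ≤ G σ := fun σ => integral_nonneg fun _ => (Real.exp_pos _).le
  refine ⟨(G a + G A + 1) * (2 ^ A * Real.exp 1),
    by have := hG0 a; have := hG0 A; positivity, fun s h1 h2 => ?_⟩
  have hs : 0 < s.re := ha.trans_le h1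
  set τ := |s.im| with hτ
  have hτ0 : 0 ≤ τ := abs_nonneg _
  set ε : ℝ := 1 / (1 + τ) with hε
  have hε0 : 0 < ε := by positivity
  have hε1 : ε ≤ 1 := by rw [hε, div_le_one (by positivity)]; linarith
  have hετ : ε * τ ≤ 1 := by
    rw [hε, div_mul_eq_mul_div, div_le_one (by positivity)]; linarith
  have hπ := Real.pi_gt_three
  have hGle : G s.re ≤ G a + G A := by
    simp only [hG]
    rw [← integral_add (integrable_exp_mul_sub_exp ha) (integrable_exp_mul_sub_exp (hs.trans_le h2))]
    refine integral_mono (integrable_exp_mul_sub_exp hs) ((integrable_exp_mul_sub_exp ha).add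
      (integrable_exp_mul_sub_exp (hs.trans_le h2))) fun p => ?_
    rcases le_total 0 p with hp | hp
    · have : Real.exp (p * s.re - Real.exp p) ≤ Real.exp (p * A - Real.exp p) :=
        Real.exp_le_exp.2 (by nlinarith)
      have := Real.exp_pos (p * a - Real.exp p)
      simp only; linarith
    · have : Real.exp (p * s.re - Real.exp p) ≤ Real.exp (p * a - Real.exp p) :=
        Real.exp_le_exp.2 (by nlinarith)
      have := Real.exp_pos (p * A - Real.exp p)
      simp only; linarith
  have hsin : ε / 2 ≤ Real.sin ε := by
    have := Real.mul_le_sin hε0.le (by linarith)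
    refine le_trans ?_ this
    have : (1 : ℝ) / 2 ≤ 2 / Real.pi := by
      rw [div_le_div_iff₀ (by norm_num) Real.pi_pos]; linarith [Real.pi_le_four]
    nlinarith
  have hlog : Real.exp (-(s.re * Real.log (Real.sin ε))) ≤ (2 * (1 + τ)) ^ A := by
    have h3 : -Real.log (Real.sin ε) ≤ Real.log (2 * (1 + τ)) := by
      rw [← Real.log_inv]
      refine Real.log_le_log (inv_pos.2 ((by positivity : 0 < ε / 2).trans_le hsin)) ?_
      rw [inv_le_comm₀ ((by positivity : 0 < ε / 2).trans_le hsin) (by positivity)]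
      refine le_trans (le_of_eq ?_) hsin
      rw [hε]; field_simp
    have h4 : 0 ≤ Real.log (2 * (1 + τ)) := Real.log_nonneg (by linarith)
    rw [← Real.exp_log (show 0 < (2 * (1 + τ)) ^ A by positivity), Real.log_pow]
    refine Real.exp_le_exp.2 ?_
    nlinarith
  have main : ∃ θ : ℝ, -(Real.pi / 2) < θ ∧ θ < Real.pi / 2 ∧ θ * s.im = (Real.pi / 2 - ε) * τ ∧
      Real.cos θ = Real.sin ε := by
    rcases le_total 0 s.im with h | h
    · refine ⟨Real.pi / 2 - ε, by linarith, by linarith, by rw [hτ, abs_of_nonneg h], ?_⟩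
      exact Real.cos_pi_div_two_sub ε
    · refine ⟨-(Real.pi / 2 - ε), by linarith, by linarith, by rw [hτ, abs_of_nonpos h]; ring, ?_⟩
      rw [Real.cos_neg]; exact Real.cos_pi_div_two_sub ε
  obtain ⟨θ, hθ1, hθ2, hθ3, hθ4⟩ := main
  refine (norm_Gamma_le_rotated hs hθ1 hθ2).trans ?_
  rw [hθ3, hθ4]
  have h5 : Real.exp (-((Real.pi / 2 - ε) * τ)) ≤ Real.exp 1 * Real.exp (-(Real.pi / 2 * τ)) := by
    rw [← Real.exp_add]; exact Real.exp_le_exp.2 (by linarith)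
  calc _ ≤ (Real.exp 1 * Real.exp (-(Real.pi / 2 * τ))) * (2 * (1 + τ)) ^ A * (G a + G A + 1) := by
        refine mul_le_mul (mul_le_mul h5 hlog (Real.exp_nonneg _) (by positivity))
          (hGle.trans (by linarith)) (hG0 _) (by positivity)
    _ = _ := by rw [mul_pow]; ring

theorem norm_Gamma_I_mul_inv_le (v : ℝ) :
    ‖(Gamma (I * v))⁻¹‖ ≤ (1 + |v|) * Real.exp (Real.pi / 2 * |v|) := by
  rcases eq_or_ne v 0 with rfl | hv
  · simp [Complex.Gamma_zero]
  have h1 := Complex.Gamma_mul_Gamma_one_sub (I * v)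
  have h2 : Gamma (1 - I * v) = -(I * v) * Gamma (-(I * v)) := by
    rw [← Complex.Gamma_add_one _ (by simp [hv])]; congr 1; ring
  have h3 : ‖Gamma (-(I * v))‖ = ‖Gamma (I * v)‖ := by
    have : -(I * v) = (starRingEnd ℂ) (I * v) := by simp
    rw [this, Complex.Gamma_conj, RCLike.norm_conj]
  have h4 : Complex.sin (Real.pi * (I * v)) = Complex.sinh (Real.pi * v) * I := by
    rw [← Complex.sin_mul_I]; congr 1; ring
  have h5 := congrArg norm h1
  rw [h2, h4, ← ofReal_mul, ← ofReal_sinh] at h5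
  simp only [norm_mul, norm_neg, norm_I, h3, norm_div, norm_real, one_mul, mul_one,
    Real.norm_eq_abs, abs_of_pos Real.pi_pos] at h5
  set g := ‖Gamma (I * v)‖
  have hsh : 0 < |Real.sinh (Real.pi * v)| := by
    rw [abs_pos, Ne, Real.sinh_eq_zero]
    exact mul_ne_zero Real.pi_ne_zero hv
  have hv' : 0 < |v| := abs_pos.2 hv
  have hg : 0 < g := by
    refine lt_of_le_of_ne (norm_nonneg _) fun h => ?_
    rw [← h] at h5
    have : 0 < Real.pi / |Real.sinh (Real.pi * v)| := by positivity
    linarith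
  rw [norm_inv]
  have h6 : (g⁻¹) ^ 2 = |v| * |Real.sinh (Real.pi * v)| / Real.pi := by
    field_simp at h5 ⊢
    linarith
  have h7 : |Real.sinh (Real.pi * v)| ≤ Real.exp (Real.pi * |v|) := by
    rw [Real.abs_sinh, abs_mul, abs_of_pos Real.pi_pos, Real.sinh_eq]
    have := Real.exp_pos (Real.pi * |v|)
    have := Real.exp_pos (-(Real.pi * |v|))
    linarith
  refine le_of_sq_le_sq ?_ (by positivity)
  rw [h6, mul_pow, ← Real.exp_nat_mul, div_le_iff₀ Real.pi_pos]
  have e : ((2 : ℕ) : ℝ) * (Real.pi / 2 * |v|) = Real.pi * |v| := by push_cast; ring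
  rw [e]
  have hE := Real.exp_pos (Real.pi * |v|)
  calc |v| * |Real.sinh (Real.pi * v)| ≤ |v| * Real.exp (Real.pi * |v|) := by gcongr
    _ ≤ (1 + |v|) ^ 2 * Real.exp (Real.pi * |v|) * 1 := by
        rw [mul_one]; gcongr; nlinarith
    _ ≤ _ := by gcongr; linarith [Real.pi_gt_three]

theorem integral_gaussian_div_vertical {d : ℝ} (hd : 0 < d) :
    ∫ u : ℝ, cexp ((d + I * u) ^ 2) / (d + I * u) = Real.pi := by
  have hne : ∀ u : ℝ, (d + I * u : ℂ) ≠ 0 := fun u h => by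
    have := congrArg re h; simp at this; exact hd.ne' this
  have h1 : ∀ u : ℝ, cexp ((d + I * u) ^ 2) / (d + I * u) =
      ∫ p in Set.Ioi (0 : ℝ), cexp ((d + I * u) ^ 2 - (d + I * u) * p) := by
    intro u
    have := integral_exp_mul_complex_Ioi (a := -(d + I * u)) (by simpa using hd) 0
    simp only [sub_eq_add_neg, Complex.exp_add]
    rw [integral_const_mul]
    simp only [← neg_mul]
    rw [this, neg_div_neg_eq, ofReal_zero, mul_zero, Complex.exp_zero, mul_one_div]
  simp_rw [h1]
  rw [integral_integral_swap]
  · have h2 : ∀ p : ℝ, ∫ u : ℝ, cexp ((d + I * u) ^ 2 - (d + I * u) * p) =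
        ((Real.sqrt Real.pi * Real.exp (-(1/4) * p ^ 2) : ℝ) : ℂ) := by
      intro p
      have := fourierIntegral_gaussian (b := 1) (by simp) (2 * d - p)
      have e : ∀ u : ℝ, cexp ((d + I * u) ^ 2 - (d + I * u) * p) = cexp (d ^ 2 - d * p) *
          (cexp (I * (2 * d - p) * u) * cexp (-1 * u ^ 2)) := by
        intro u
        rw [← Complex.exp_add, ← Complex.exp_add]; congr 1
        ring_nf; rw [I_sq]; ring
      simp_rw [e]
      rw [integral_const_mul, this]
      push_cast
      rw [mul_left_comm, ← Complex.exp_add, Real.sqrt_eq_rpow, ofReal_cpow Real.pi_pos.le]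
      congr 1
      · simp
      · congr 1; ring
    simp_rw [h2]
    rw [integral_complex_ofReal, integral_const_mul, integral_gaussian_Ioi]
    congr 1
    rw [show Real.pi / (1 / 4) = Real.pi * 2 ^ 2 by ring, Real.sqrt_mul Real.pi_pos.le,
      Real.sqrt_sq (by norm_num)]
    have := Real.mul_self_sqrt Real.pi_pos.le
    linarith
  · have : Integrable (fun z : ℝ × ℝ => (Real.exp (d ^ 2) * Real.exp (-1 * z.1 ^ 2)) *
        Real.exp (-d * z.2)) (volume.prod (volume.restrict (Set.Ioi 0))) :=
      ((integrable_exp_neg_mul_sq one_pos).const_mul _).mul_prod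
        (integrableOn_exp_mul_Ioi (neg_neg_of_pos hd) 0)
    refine this.mono' (Continuous.aestronglyMeasurable (by fun_prop)) (Eventually.of_forall ?_)
    rintro ⟨u, p⟩
    simp only [Function.uncurry_apply_pair]
    rw [Complex.norm_exp, ← Real.exp_add, ← Real.exp_add]
    refine Real.exp_le_exp.2 (le_of_eq ?_)
    simp [pow_two]
    ring

theorem integral_gaussian_div_vertical_neg {d : ℝ} (hd : d < 0) :
    ∫ u : ℝ, cexp ((d + I * u) ^ 2) / (d + I * u) = -Real.pi := by
  rw [← integral_neg_eq_self, ← integral_gaussian_div_vertical (neg_pos.2 hd), ← integral_neg]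
  congr 1; ext u
  have e : (((-d : ℝ) : ℂ) + I * u) = -(d + I * ((-u : ℝ) : ℂ)) := by push_cast; ring
  rw [e, neg_sq, div_neg, neg_neg]

theorem integral_gaussian_div_vertical_shift (c : ℝ) (w : ℂ) :
    ∫ u : ℝ, cexp ((c + I * u - w) ^ 2) / (c + I * u - w) =
      ∫ u : ℝ, cexp (((c - w.re : ℝ) + I * u) ^ 2) / ((c - w.re : ℝ) + I * u) := by
  rw [← integral_add_right_eq_self (μ := (volume : Measure ℝ)) _ w.im]
  congr 1; ext u
  have e : (c + I * ((u + w.im : ℝ) : ℂ) - w) = ((c - w.re : ℝ) : ℂ) + I * u := by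
    apply Complex.ext <;> simp
  rw [e]

/-- Cauchy's integral formula for a vertical strip. -/
theorem cauchy_strip {a b : ℝ} {H : ℂ → ℂ}
    (hH : DifferentiableOn ℂ H {z | a < z.re ∧ z.re < b})
    (hdec : ∀ a' b', a < a' → b' < b → ∃ C : ℝ, ∃ δ > 0,
      ∀ z : ℂ, a' ≤ z.re → z.re ≤ b' → ‖H z‖ ≤ C * Real.exp (-δ * |z.im|))
    {c₁ c₂ : ℝ} {w : ℂ} (h₁ : a < c₁) (h₁' : c₁ < w.re) (h₂ : w.re < c₂) (h₂' : c₂ < b) :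
    (∫ u : ℝ, H (c₂ + I * u) / (c₂ + I * u - w)) =
      (∫ u : ℝ, H (c₁ + I * u) / (c₁ + I * u - w)) + 2 * Real.pi * H w := by
  have hopen : IsOpen {z : ℂ | a < z.re ∧ z.re < b} :=
    IsOpen.and (isOpen_lt continuous_const continuous_re)
      (isOpen_lt continuous_re continuous_const)
  have hw : w ∈ {z : ℂ | a < z.re ∧ z.re < b} := ⟨h₁.trans h₁', h₂.trans h₂'⟩
  set f : ℂ → ℂ := fun z => H z - H w * cexp ((z - w) ^ 2) with hf
  have hfd : DifferentiableOn ℂ f {z | a < z.re ∧ z.re < b} :=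
    hH.sub (by fun_prop : Differentiable ℂ fun z => H w * cexp ((z - w) ^ 2)).differentiableOn
  have hQ : DifferentiableOn ℂ (dslope f w) {z | a < z.re ∧ z.re < b} :=
    (Complex.differentiableOn_dslope (hopen.mem_nhds hw)).2 hfd
  have hfw : f w = 0 := by simp [hf]
  have hgauss : ∀ a' b' δ : ℝ, 0 < δ → ∃ C ≥ 0, ∀ z : ℂ, a' ≤ z.re → z.re ≤ b' →
      ‖cexp ((z - w) ^ 2)‖ ≤ C * Real.exp (-δ * |z.im|) := by
    intro a' b' δ hδ
    set R := max |a' - w.re| |b' - w.re|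
    refine ⟨Real.exp (R ^ 2 + δ ^ 2 + δ * |w.im|), (Real.exp_pos _).le, fun z hz1 hz2 => ?_⟩
    rw [Complex.norm_exp, ← Real.exp_add]
    refine Real.exp_le_exp.2 ?_
    have e : ((z - w) ^ 2).re = (z.re - w.re) ^ 2 - (z.im - w.im) ^ 2 := by
      simp [pow_two]
    have h3 : (z.re - w.re) ^ 2 ≤ R ^ 2 := by
      refine sq_le_sq' ?_ ?_
      · have : |a' - w.re| ≤ R := le_max_left _ _
        linarith [neg_abs_le (a' - w.re)]
      · have : |b' - w.re| ≤ R := le_max_right _ _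
        linarith [le_abs_self (b' - w.re)]
    have h4 : |z.im| ≤ |z.im - w.im| + |w.im| := by
      have := abs_add_le (z.im - w.im) w.im; simpa using this
    have h5 : |z.im - w.im| ^ 2 = (z.im - w.im) ^ 2 := sq_abs _
    rw [e]
    nlinarith [sq_nonneg (|z.im - w.im| - δ), sq_nonneg δ, abs_nonneg (z.im - w.im), sq_nonneg (|z.im - w.im|)]
  have hfdec : ∀ a' b', a < a' → b' < b → ∃ C : ℝ, ∃ δ > 0,
      ∀ z : ℂ, a' ≤ z.re → z.re ≤ b' → ‖f z‖ ≤ C * Real.exp (-δ * |z.im|) := by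
    intro a' b' ha' hb'
    obtain ⟨C, δ, hδ, hC⟩ := hdec a' b' ha' hb'
    obtain ⟨C', hC'0, hC'⟩ := hgauss a' b' δ hδ
    refine ⟨C + ‖H w‖ * C', δ, hδ, fun z hz1 hz2 => ?_⟩
    refine (norm_sub_le _ _).trans ?_
    rw [norm_mul, add_mul, mul_assoc]
    exact add_le_add (hC z hz1 hz2) (mul_le_mul_of_nonneg_left (hC' z hz1 hz2) (norm_nonneg _))
  have hQdec : ∀ a' b', a < a' → b' < b → ∃ C : ℝ, ∃ δ > 0,
      ∀ z : ℂ, a' ≤ z.re → z.re ≤ b' → ‖dslope f w z‖ ≤ C * Real.exp (-δ * |z.im|) := by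
    intro a' b' ha' hb'
    obtain ⟨C, δ, hδ, hC⟩ := hfdec a' b' ha' hb'
    have hK : IsCompact (Set.Icc a' b' ×ℂ Set.Icc (w.im - 1) (w.im + 1)) :=
      isCompact_Icc.reProdIm isCompact_Icc
    obtain ⟨M, hM⟩ := hK.exists_bound_of_continuousOn (f := dslope f w) (hQ.continuousOn.mono (by
      intro z hz
      exact ⟨ha'.trans_le hz.1.1, hz.1.2.trans_lt hb'⟩))
    refine ⟨|C| + |M| * Real.exp (δ * (|w.im| + 1)), δ, hδ, fun z hz1 hz2 => ?_⟩
    rw [add_mul]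
    by_cases hz : |z.im - w.im| ≤ 1
    · have h5 := abs_le.1 hz
      have h6 := hM z ⟨⟨hz1, hz2⟩, ⟨by linarith [h5.1], by linarith [h5.2]⟩⟩
      have h7 : |z.im| ≤ |z.im - w.im| + |w.im| := by
        have := abs_add_le (z.im - w.im) w.im; simpa using this
      have h8 : 1 ≤ Real.exp (δ * (|w.im| + 1)) * Real.exp (-δ * |z.im|) := by
        rw [← Real.exp_add]; exact Real.one_le_exp (by nlinarith)
      have h9 : 0 ≤ |C| * Real.exp (-δ * |z.im|) := by positivity
      rw [mul_assoc]
      nlinarith [le_abs_self M, abs_nonneg M]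
    · push Not at hz
      have hzw : 1 ≤ ‖z - w‖ := by
        refine hz.le.trans ?_
        simpa using Complex.abs_im_le_norm (z - w)
      have hne : z ≠ w := by rintro rfl; simp at hzw; linarith
      rw [dslope_of_ne _ hne, slope_def_field, hfw, sub_zero, norm_div]
      have := hC z hz1 hz2
      have h9 : 0 ≤ |M| * Real.exp (δ * (|w.im| + 1)) * Real.exp (-δ * |z.im|) := by positivity
      have h10 : ‖f z‖ / ‖z - w‖ ≤ ‖f z‖ := div_le_self (norm_nonneg _) hzw
      have h11 : C * Real.exp (-δ * |z.im|) ≤ |C| * Real.exp (-δ * |z.im|) := by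
        gcongr; exact le_abs_self C
      linarith
  have key := integral_vertical_eq hQ hQdec h₁ (h₁'.trans (h₂.trans h₂'))
    (h₁.trans (h₁'.trans h₂)) h₂'
  have hintg : ∀ c : ℝ, a < c → c < b → c ≠ w.re →
      Integrable (fun u : ℝ => dslope f w (c + I * u)) ∧
      Integrable (fun u : ℝ => cexp ((c + I * u - w) ^ 2) / (c + I * u - w)) := by
    intro c hc1 hc2 hcw
    have hne : ∀ u : ℝ, (c + I * u - w : ℂ) ≠ 0 := fun u h => hcw (by
      have := congrArg re h; simp at this; linarith)
    constructor
    · obtain ⟨C, δ, hδ, hC⟩ := hQdec c c hc1 hc2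
      refine ((integrable_exp_neg_mul_abs_real hδ).const_mul C).mono' ?_ ?_
      · refine (hQ.continuousOn.comp_continuous (by fun_prop) fun u => ?_).aestronglyMeasurable
        simp [hc1, hc2]
      · exact Eventually.of_forall fun u => by
          have := hC (c + I * u) (by simp) (by simp)
          simpa using this
    · obtain ⟨C, hC0, hC⟩ := hgauss c c 1 one_pos
      refine ((integrable_exp_neg_mul_abs_real one_pos).const_mul (C / |c - w.re|)).mono' ?_ ?_
      · exact (Continuous.div (by fun_prop) (by fun_prop) hne).aestronglyMeasurable
      · refine Eventually.of_forall fun u => ?_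
        have h3 := hC (c + I * u) (by simp) (by simp)
        have h4 : |c - w.re| ≤ ‖(c + I * u - w : ℂ)‖ := by
          simpa using Complex.abs_re_le_norm (c + I * u - w)
        have h5 : 0 < |c - w.re| := abs_pos.2 (sub_ne_zero.2 hcw)
        rw [norm_div, div_mul_eq_mul_div]
        refine div_le_div₀ (by positivity) ?_ h5 h4
        simpa using h3
  have hval : ∀ c : ℝ, a < c → c < b → c ≠ w.re →
      ∫ u : ℝ, H (c + I * u) / (c + I * u - w) = (∫ u : ℝ, dslope f w (c + I * u)) +
        H w * ∫ u : ℝ, cexp ((c + I * u - w) ^ 2) / (c + I * u - w) := by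
    intro c hc1 hc2 hcw
    rw [← integral_const_mul, ← integral_add (hintg c hc1 hc2 hcw).1
      ((hintg c hc1 hc2 hcw).2.const_mul _)]
    congr 1; ext u
    have hne : (c + I * u : ℂ) ≠ w := fun h => hcw (by
      have := congrArg re h; simpa using this)
    rw [dslope_of_ne _ hne, slope_def_field, hfw, sub_zero, mul_div_assoc', ← add_div]
    congr 1
    simp [hf]
  rw [hval c₂ (h₁.trans (h₁'.trans h₂)) h₂' h₂.ne', hval c₁ h₁ (h₁'.trans (h₂.trans h₂')) h₁'.ne,
    integral_gaussian_div_vertical_shift, integral_gaussian_div_vertical_shift,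
    integral_gaussian_div_vertical (sub_pos.2 h₂),
    integral_gaussian_div_vertical_neg (sub_neg.2 h₁'), key]
  ring

/-- The sum of all mutual distances of two finite families of reals. -/
def pairDist {ι κ : Type*} [Fintype ι] [Fintype κ] (u : ι → ℝ) (v : κ → ℝ) : ℝ :=
  ∑ a, ∑ b, |u a - v b|

theorem energy_eq_integral {J : Type*} [Fintype J] (c z : J → ℝ) {R : ℝ} (hz : ∀ j, |z j| ≤ R) :
    -(1 / 2) * ∑ i, ∑ j, c i * c j * |z i - z j| =
      ∫ t in Set.Ico (-R) R, (∑ j, c j * (Set.Ici (z j)).indicator (fun _ => (1 : ℝ)) t) *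
        ((∑ j, c j * (Set.Ici (z j)).indicator (fun _ => (1 : ℝ)) t) - ∑ j, c j) := by
  have hintg : ∀ p : ℝ, Integrable ((Set.Ici p).indicator (fun _ => (1 : ℝ)))
      (volume.restrict (Set.Ico (-R) R)) := fun p =>
    (integrable_const (1 : ℝ)).indicator measurableSet_Ici
  have hintg' : ∀ k p q : ℝ, Integrable (fun t => k * ((Set.Ici p).indicator (fun _ => (1 : ℝ)) t -
      (Set.Ici q).indicator (fun _ => (1 : ℝ)) t)) (volume.restrict (Set.Ico (-R) R)) :=
    fun k p q => ((hintg p).sub (hintg q)).const_mul k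
  have hval : ∀ p : ℝ, |p| ≤ R →
      ∫ t in Set.Ico (-R) R, (Set.Ici p).indicator (fun _ => (1 : ℝ)) t = R - p := by
    intro p hp
    change ∫ t in Set.Ico (-R) R, (Set.Ici p).indicator (1 : ℝ → ℝ) t = R - p
    rw [integral_indicator_one measurableSet_Ici]
    have h := abs_le.1 hp
    have : Set.Ici p ∩ Set.Ico (-R) R = Set.Ico p R := by
      ext t; simp only [Set.mem_inter_iff, Set.mem_Ici, Set.mem_Ico]
      constructor
      · rintro ⟨h1, h2, h3⟩; exact ⟨h1, h3⟩
      · rintro ⟨h1, h2⟩; exact ⟨h1, by linarith, h2⟩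
    rw [measureReal_restrict_apply measurableSet_Ici, this, Real.volume_real_Ico_of_le h.2]
  have hmul : ∀ p q t : ℝ, (Set.Ici p).indicator (fun _ => (1 : ℝ)) t *
      (Set.Ici q).indicator (fun _ => (1 : ℝ)) t =
      (Set.Ici (max p q)).indicator (fun _ => (1 : ℝ)) t := by
    intro p q t
    by_cases h1 : p ≤ t <;> by_cases h2 : q ≤ t <;> simp [Set.indicator, h1, h2]
  have hexp : ∀ t : ℝ, (∑ j, c j * (Set.Ici (z j)).indicator (fun _ => (1 : ℝ)) t) *
        ((∑ j, c j * (Set.Ici (z j)).indicator (fun _ => (1 : ℝ)) t) - ∑ j, c j) =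
      (∑ i, ∑ j, c i * c j * ((Set.Ici (max (z i) (z j))).indicator (fun _ => (1 : ℝ)) t -
        (Set.Ici (z i)).indicator (fun _ => (1 : ℝ)) t)) := by
    intro t
    rw [← Finset.sum_sub_distrib, Finset.sum_mul_sum]
    refine Finset.sum_congr rfl fun i _ => Finset.sum_congr rfl fun j _ => ?_
    rw [← hmul]; ring
  simp_rw [hexp]
  rw [integral_finsetSum _ fun i _ => integrable_finsetSum _ fun j _ =>
    hintg' _ _ _]
  have : ∀ i, ∫ t in Set.Ico (-R) R, ∑ j, c i * c j *
      ((Set.Ici (max (z i) (z j))).indicator (fun _ => (1 : ℝ)) t -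
        (Set.Ici (z i)).indicator (fun _ => (1 : ℝ)) t) =
      ∑ j, c i * c j * (z i - max (z i) (z j)) := by
    intro i
    rw [integral_finsetSum _ fun j _ => hintg' _ _ _]
    refine Finset.sum_congr rfl fun j _ => ?_
    rw [integral_const_mul, integral_sub (hintg _) (hintg _), hval _ (hz i), hval]
    · ring
    · rcases max_choice (z i) (z j) with h | h <;> rw [h] <;> exact hz _
  simp_rw [this]
  have h1 : ∀ i j, c i * c j * (z i - max (z i) (z j)) =
      -(1 / 2) * (c i * c j * |z i - z j|) + (1 / 2) * (c i * c j * (z i - z j)) := by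
    intro i j
    rcases le_total (z i) (z j) with h | h
    · rw [max_eq_right h, abs_of_nonpos (by linarith)]; ring
    · rw [max_eq_left h, abs_of_nonneg (by linarith)]; ring
  have h2 : ∑ i, ∑ j, c i * c j * (z i - z j) = 0 := by
    have h3 : ∑ i, ∑ j, c i * c j * (z i - z j) = ∑ i, ∑ j, -(c i * c j * (z i - z j)) := by
      rw [Finset.sum_comm]
      exact Finset.sum_congr rfl fun i _ => Finset.sum_congr rfl fun j _ => by ring
    simp only [Finset.sum_neg_distrib] at h3
    linarith
  simp_rw [h1, Finset.sum_add_distrib, ← Finset.mul_sum]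
  rw [h2]; ring

/-- The electrostatic inequality for `n` points against `n` or `n + 1` points. -/
theorem pairDist_energy {n k d : ℕ} (hd : d ≤ 1) (hk : k = n + d) (w : Fin n → ℝ)
    (y : Fin k → ℝ) :
    pairDist w w / 2 + pairDist y y / 2 + max (‖w‖ - ‖y‖) 0 ≤ pairDist w y := by
  set c : Fin k ⊕ Fin n → ℝ := Sum.elim (fun _ => 1) (fun _ => -1) with hc
  set z : Fin k ⊕ Fin n → ℝ := Sum.elim y w with hz
  set R := max ‖w‖ ‖y‖ with hR
  have hzR : ∀ j, |z j| ≤ R := by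
    rintro (j | j)
    · exact (norm_le_pi_norm y j).trans (le_max_right _ _)
    · exact (norm_le_pi_norm w j).trans (le_max_left _ _)
  have hE := energy_eq_integral c z hzR
  have hlhs : -(1 / 2) * ∑ i, ∑ j, c i * c j * |z i - z j| =
      pairDist w y - pairDist w w / 2 - pairDist y y / 2 := by
    have h1 : pairDist y w = pairDist w y := by
      unfold pairDist
      rw [Finset.sum_comm]
      simp_rw [abs_sub_comm]
    simp only [Fintype.sum_sum_type, hc, hz, Sum.elim_inl, Sum.elim_inr]
    simp only [one_mul, mul_one, neg_mul, mul_neg, neg_neg, Finset.sum_neg_distrib,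
      Finset.sum_add_distrib]
    change -(1 / 2 * (pairDist y y + -pairDist y w + (-pairDist w y + pairDist w w))) = _
    rw [h1]; ring
  have hcd : ∑ j, c j = d := by
    simp [hc, hk]
  -- the counting function takes integer values
  have hf : ∀ t : ℝ, ∃ p q : ℕ, ((∑ j, c j * (Set.Ici (z j)).indicator (fun _ => (1 : ℝ)) t) =
      (p : ℝ) - q) ∧ p ≤ k ∧ q ≤ n ∧ ((∀ b, y b ≤ t) → p = k) ∧ ((∀ b, t < y b) → p = 0) ∧
      (∀ a, t < w a → q + 1 ≤ n) ∧ (∀ a, w a ≤ t → 1 ≤ q) := by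
    intro t
    refine ⟨(Finset.univ.filter fun b => y b ≤ t).card, (Finset.univ.filter fun a => w a ≤ t).card,
      ?_, ?_, ?_, ?_, ?_, ?_, ?_⟩
    · simp only [Fintype.sum_sum_type, hc, hz, Sum.elim_inl, Sum.elim_inr, one_mul, neg_mul,
        Finset.sum_neg_distrib]
      simp only [Set.indicator, Set.mem_Ici, Finset.sum_boole, sub_eq_add_neg]
    · simpa using Finset.card_le_univ (Finset.univ.filter fun b => y b ≤ t)
    · simpa using Finset.card_le_univ (Finset.univ.filter fun a => w a ≤ t)
    · intro h
      rw [Finset.filter_true_of_mem fun b _ => h b]; simp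
    · intro h
      rw [Finset.filter_false_of_mem fun b _ => not_le.2 (h b)]; simp
    · intro a ha
      have : (Finset.univ.filter fun a => w a ≤ t).card < (Finset.univ : Finset (Fin n)).card :=
        Finset.card_lt_card (Finset.filter_ssubset.2 ⟨a, Finset.mem_univ _, not_le.2 ha⟩)
      simpa using this
    · intro a ha
      exact Finset.card_pos.2 ⟨a, by simpa using ha⟩
  rw [hlhs, hcd] at hE
  set F : ℝ → ℝ := fun t => (∑ j, c j * (Set.Ici (z j)).indicator (fun _ => (1 : ℝ)) t) *
        ((∑ j, c j * (Set.Ici (z j)).indicator (fun _ => (1 : ℝ)) t) - d) with hF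
  have hnn : ∀ t, 0 ≤ F t := by
    intro t
    obtain ⟨p, q, h1, -⟩ := hf t
    simp only [hF, h1]
    have : (0 : ℤ) ≤ ((p : ℤ) - q) * ((p : ℤ) - q - d) := by
      rcases le_or_gt ((p : ℤ) - q) 0 with h | h
      · exact mul_nonneg_of_nonpos_of_nonpos h (by omega)
      · exact mul_nonneg h.le (by omega)
    exact_mod_cast this
  have hFint : IntegrableOn F (Set.Ico (-R) R) := by
    have hm : Measurable fun t => ∑ j, c j * (Set.Ici (z j)).indicator (fun _ => (1 : ℝ)) t :=
      Finset.measurable_sum _ fun j _ =>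
        (measurable_const.indicator measurableSet_Ici).const_mul _
    have hFm : Measurable F := hm.mul (hm.sub measurable_const)
    refine Integrable.mono' (g := fun _ => (((k : ℝ) + n) * ((k : ℝ) + n + d))) (integrable_const _)
      hFm.aestronglyMeasurable (Eventually.of_forall fun t => ?_)
    rw [Real.norm_of_nonneg (hnn t)]
    obtain ⟨p, q, h1, h2, h3, -⟩ := hf t
    simp only [hF, h1]
    have hp : (p : ℝ) ≤ k := by exact_mod_cast h2
    have hq : (q : ℝ) ≤ n := by exact_mod_cast h3
    have hp0 : (0 : ℝ) ≤ p := p.cast_nonneg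
    have hq0 : (0 : ℝ) ≤ q := q.cast_nonneg
    have hd0 : (0 : ℝ) ≤ d := d.cast_nonneg
    rw [← abs_of_nonneg (by simpa only [hF, h1] using hnn t : 0 ≤ ((p : ℝ) - q) * (p - q - d)), abs_mul]
    refine mul_le_mul ?_ ?_ (abs_nonneg _) (by positivity)
    · exact abs_le.2 ⟨by linarith, by linarith⟩
    · exact abs_le.2 ⟨by linarith, by linarith⟩
  have hone : ∀ t, ((∀ b, y b ≤ t) ∧ (∃ a, t < w a)) ∨ ((∀ b, t < y b) ∧ ∃ a, w a ≤ t) →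
      1 ≤ F t := by
    intro t ht
    obtain ⟨p, q, h1, h2, h3, h4, h5, h6, h7⟩ := hf t
    simp only [hF, h1]
    have : (1 : ℤ) ≤ ((p : ℤ) - q) * ((p : ℤ) - q - d) := by
      rcases ht with ⟨hy, a, ha⟩ | ⟨hy, a, ha⟩
      · have := h4 hy; have := h6 a ha
        have e1 : (1 : ℤ) ≤ (p : ℤ) - q := by omega
        have e2 : (1 : ℤ) ≤ (p : ℤ) - q - d := by omega
        nlinarith
      · have := h5 hy; have := h7 a ha
        have e1 : (p : ℤ) - q ≤ -1 := by omega
        have e2 : (p : ℤ) - q - d ≤ -1 := by omega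
        nlinarith
    exact_mod_cast this
  have hlow : max (‖w‖ - ‖y‖) 0 ≤ ∫ t in Set.Ico (-R) R, F t := by
    refine max_le ?_ (integral_nonneg hnn)
    by_cases hwy : ‖w‖ ≤ ‖y‖
    · exact (sub_nonpos.2 hwy).trans (integral_nonneg hnn)
    push Not at hwy
    have hy0 : 0 ≤ ‖y‖ := norm_nonneg y
    have hRw : R = ‖w‖ := max_eq_left hwy.le
    have hyb : ∀ b, |y b| ≤ ‖y‖ := norm_le_pi_norm y
    obtain ⟨a, ha⟩ : ∃ a, ‖w‖ = |w a| := by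
      have hne : Nonempty (Fin n) := by
        by_contra h
        rw [not_nonempty_iff] at h
        have : w = 0 := Subsingleton.elim _ _
        rw [this, norm_zero] at hwy
        linarith
      obtain ⟨a, -, ha⟩ := Finset.exists_max_image Finset.univ (fun a => |w a|)
        Finset.univ_nonempty
      refine ⟨a, le_antisymm ?_ (norm_le_pi_norm w a)⟩
      exact (pi_norm_le_iff_of_nonneg (abs_nonneg _)).2 fun i => ha i (Finset.mem_univ _)
    have hset : ∀ l r : ℝ, -R ≤ l → r ≤ R → l ≤ r → (∀ t ∈ Set.Ico l r, 1 ≤ F t) →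
        r - l ≤ ∫ t in Set.Ico (-R) R, F t := by
      intro l r hl hr hlr h
      calc r - l = ∫ t in Set.Ico l r, (1 : ℝ) := by simp [Real.volume_real_Ico_of_le hlr]
        _ ≤ ∫ t in Set.Ico l r, F t := by
            refine setIntegral_mono_on (integrableOn_const (by simp)) (hFint.mono_set
              (Set.Ico_subset_Ico hl hr)) measurableSet_Ico h
        _ ≤ _ := setIntegral_mono_set hFint (Eventually.of_forall hnn)
            (Set.Ico_subset_Ico hl hr).eventuallyLE
    rcases le_total 0 (w a) with h | h
    · rw [abs_of_nonneg h] at ha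
      refine (le_of_eq ?_).trans (hset ‖y‖ (w a) (by linarith) (by linarith) (by linarith) ?_)
      · rw [ha]
      · intro t ht
        exact hone t (Or.inl ⟨fun b => (le_abs_self _).trans ((hyb b).trans ht.1), a, ht.2⟩)
    · rw [abs_of_nonpos h] at ha
      refine (le_of_eq ?_).trans (hset (w a) (-‖y‖) (by linarith) (by linarith) (by linarith) ?_)
      · rw [ha]; ring
      · intro t ht
        refine hone t (Or.inr ⟨fun b => ?_, a, ht.1⟩)
        have := neg_abs_le (y b)
        linarith [hyb b, ht.2]
  linarith

/-- The open vertical strip `a < Re z < b`. -/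
def vstrip (a b : ℝ) : Set ℂ := {z | a < z.re ∧ z.re < b}

/-- `f` is `O(e^{-q |Im z|})`, up to powers of `Im z`, in the closed substrips of `a < Re z < b`. -/
def StripDecay (a b q : ℝ) (f : ℂ → ℂ) : Prop :=
  ∀ a' b', a < a' → b' < b → ∃ C : ℝ, ∃ p : ℕ, 0 ≤ C ∧ ∀ z : ℂ, a' ≤ z.re → z.re ≤ b' →
    ‖f z‖ ≤ C * (1 + |z.im|) ^ p * Real.exp (-(q * |z.im|))

theorem StripDecay.mul {a b q r : ℝ} {f g : ℂ → ℂ} (hf : StripDecay a b q f)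
    (hg : StripDecay a b r g) : StripDecay a b (q + r) (fun z => f z * g z) := by
  intro a' b' ha hb
  obtain ⟨C, p, hC, h1⟩ := hf a' b' ha hb
  obtain ⟨D, k, hD, h2⟩ := hg a' b' ha hb
  refine ⟨C * D, p + k, mul_nonneg hC hD, fun z hz1 hz2 => ?_⟩
  rw [norm_mul]
  refine (mul_le_mul (h1 z hz1 hz2) (h2 z hz1 hz2) (norm_nonneg _) (by positivity)).trans
    (le_of_eq ?_)
  rw [add_mul, neg_add, Real.exp_add, pow_add]; ring

theorem StripDecay.const (a b : ℝ) (c : ℂ) : StripDecay a b 0 (fun _ => c) := by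
  intro a' b' _ _
  exact ⟨‖c‖, 0, norm_nonneg _, fun z _ _ => by simp⟩

theorem StripDecay.prod {a b q : ℝ} {ι : Type*} (s : Finset ι) {f : ι → ℂ → ℂ}
    (hf : ∀ i ∈ s, StripDecay a b q (f i)) :
    StripDecay a b (s.card * q) (fun z => ∏ i ∈ s, f i z) := by
  classical
  induction s using Finset.induction_on with
  | empty => simpa using StripDecay.const a b 1
  | insert i s hi ih =>
    have := (hf i (Finset.mem_insert_self _ _)).mul
      (ih fun j hj => hf j (Finset.mem_insert_of_mem hj))
    simp only [Finset.prod_insert hi, Finset.card_insert_of_notMem hi]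
    convert this using 1
    push_cast; ring

theorem StripDecay.pow_id (a b : ℝ) (j : ℕ) : StripDecay a b 0 (fun z => z ^ j) := by
  intro a' b' _ _
  refine ⟨(1 + |a'| + |b'|) ^ j, j, by positivity, fun z h1 h2 => ?_⟩
  rw [norm_pow, zero_mul, neg_zero, Real.exp_zero, mul_one, ← mul_pow]
  refine pow_le_pow_left₀ (norm_nonneg _) ?_ j
  have h3 : |z.re| ≤ |a'| + |b'| := by
    refine abs_le.2 ⟨?_, ?_⟩
    · linarith [neg_abs_le a', abs_nonneg b']
    · linarith [le_abs_self b', abs_nonneg a']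
  have h4 := Complex.norm_le_abs_re_add_abs_im z
  nlinarith [abs_nonneg z.im, abs_nonneg a', abs_nonneg b']

theorem StripDecay.exp_real_mul (a b z₀ : ℝ) : StripDecay a b 0 (fun z => cexp (-(z₀ * z))) := by
  intro a' b' _ _
  refine ⟨Real.exp (|z₀| * (|a'| + |b'|)), 0, (Real.exp_pos _).le, fun z h1 h2 => ?_⟩
  rw [Complex.norm_exp, pow_zero, mul_one, zero_mul, neg_zero, Real.exp_zero, mul_one]
  refine Real.exp_le_exp.2 ?_
  have h3 : |z.re| ≤ |a'| + |b'| := by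
    refine abs_le.2 ⟨?_, ?_⟩
    · linarith [neg_abs_le a', abs_nonneg b']
    · linarith [le_abs_self b', abs_nonneg a']
  have : (-(z₀ * z)).re = -(z₀ * z.re) := by simp
  rw [this]
  calc -(z₀ * z.re) ≤ |z₀ * z.re| := neg_le_abs _
    _ = |z₀| * |z.re| := abs_mul _ _
    _ ≤ _ := by gcongr

/-- The exponentials `e^{iπ(m-1-2k)s}` whose Vandermonde-like determinant is
`∏ 2i sin π(s_a - s_b)`. -/
def trigMode (m k : ℕ) (s : ℂ) : ℂ := cexp (I * Real.pi * ((m : ℂ) - 1 - 2 * k) * s)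

theorem StripDecay.trigMode (a b : ℝ) {m k : ℕ} (hk : k < m) :
    StripDecay a b (-(Real.pi * ((m : ℝ) - 1))) (trigMode m k) := by
  intro a' b' _ _
  refine ⟨1, 0, zero_le_one, fun z _ _ => ?_⟩
  rw [Toda.trigMode, Complex.norm_exp, pow_zero, mul_one, one_mul]
  refine Real.exp_le_exp.2 ?_
  have e : (I * Real.pi * ((m : ℂ) - 1 - 2 * k) * z).re =
      -(Real.pi * (((m : ℝ) - 1 - 2 * k) * z.im)) := by
    simp; ring
  rw [e, neg_mul, neg_neg, mul_assoc, neg_le]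
  have hk' : (k : ℝ) + 1 ≤ m := by exact_mod_cast hk
  have hk0 : (0 : ℝ) ≤ k := k.cast_nonneg
  have h1 : |((m : ℝ) - 1 - 2 * k) * z.im| ≤ ((m : ℝ) - 1) * |z.im| := by
    rw [abs_mul]
    gcongr
    exact abs_le.2 ⟨by linarith, by linarith⟩
  have h2 := neg_abs_le (((m : ℝ) - 1 - 2 * k) * z.im)
  have := Real.pi_pos
  nlinarith

theorem StripDecay.gamma_sub {a b : ℝ} {α : ℂ} (h : b ≤ α.re) :
    StripDecay a b (Real.pi / 2) (fun s => Gamma (α - s)) := by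
  intro a' b' _ hb
  obtain ⟨A, hA⟩ := exists_nat_ge (α.re - a')
  obtain ⟨C, hC, hCb⟩ := exists_norm_Gamma_le (a := α.re - b') (by linarith) A
  refine ⟨C * (1 + |α.im|) ^ A * Real.exp (Real.pi / 2 * |α.im|), A, by positivity,
    fun z h1 h2 => ?_⟩
  refine (hCb (α - z) (by simp; linarith) (by simp; linarith)).trans ?_
  have h3 : |(α - z).im| ≤ |α.im| + |z.im| := by
    rw [sub_im, sub_eq_add_neg, ← abs_neg z.im]; exact abs_add_le _ _
  have h4 : |z.im| ≤ |(α - z).im| + |α.im| := by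
    have : z.im = α.im - (α - z).im := by simp
    calc |z.im| = |α.im - (α - z).im| := by rw [← this]
      _ ≤ _ := by
        rw [sub_eq_add_neg, add_comm |(α - z).im|, ← abs_neg (α - z).im]; exact abs_add_le _ _
  have h5 : (1 + |(α - z).im|) ≤ (1 + |α.im|) * (1 + |z.im|) := by
    nlinarith [abs_nonneg α.im, abs_nonneg z.im]
  calc C * (1 + |(α - z).im|) ^ A * Real.exp (-(Real.pi / 2 * |(α - z).im|))
      ≤ C * ((1 + |α.im|) * (1 + |z.im|)) ^ A *
        (Real.exp (Real.pi / 2 * |α.im|) * Real.exp (-(Real.pi / 2 * |z.im|))) := by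
        rw [← Real.exp_add]
        gcongr
        nlinarith [Real.pi_pos]
    _ = _ := by rw [mul_pow]; ring

theorem StripDecay.gamma_add {a b : ℝ} {β : ℂ} (h : -β.re ≤ a) :
    StripDecay a b (Real.pi / 2) (fun s => Gamma (β + s)) := by
  intro a' b' ha hb
  obtain ⟨C, p, hC, hCb⟩ := StripDecay.gamma_sub (a := -b) (b := -a) (α := β) (by linarith) (-b')
    (-a') (by linarith) (by linarith)
  refine ⟨C, p, hC, fun z h1 h2 => ?_⟩
  simpa using hCb (-z) (by simpa using h2) (by simpa using h1)

theorem differentiableOn_gamma_sub {a b : ℝ} {α : ℂ} (h : b ≤ α.re) :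
    DifferentiableOn ℂ (fun s => Gamma (α - s)) (vstrip a b) := by
  intro s hs
  have : DifferentiableAt ℂ Gamma (α - s) := by
    refine differentiableAt_Gamma _ fun n hn => ?_
    have := congrArg re hn
    simp at this
    linarith [hs.2, (Nat.cast_nonneg n : (0 : ℝ) ≤ n)]
  exact (this.comp s (by fun_prop : DifferentiableAt ℂ (fun s => α - s) s)).differentiableWithinAt

theorem differentiableOn_gamma_add {a b : ℝ} {β : ℂ} (h : -β.re ≤ a) :
    DifferentiableOn ℂ (fun s => Gamma (β + s)) (vstrip a b) := by
  intro s hs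
  have : DifferentiableAt ℂ Gamma (β + s) := by
    refine differentiableAt_Gamma _ fun n hn => ?_
    have := congrArg re hn
    simp at this
    linarith [hs.1, (Nat.cast_nonneg n : (0 : ℝ) ≤ n)]
  exact (this.comp s (by fun_prop : DifferentiableAt ℂ (fun s => β + s) s)).differentiableWithinAt

/-- A polynomial factor is absorbed by an exponential. -/
theorem exists_one_add_pow_mul_exp_le (p : ℕ) {δ : ℝ} (hδ : 0 < δ) :
    ∃ C > 0, ∀ t : ℝ, 0 ≤ t → (1 + t) ^ p * Real.exp (-(δ * t)) ≤ C := by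
  refine ⟨(p.factorial : ℝ) * Real.exp δ / δ ^ p, by positivity, fun t ht => ?_⟩
  have h := Real.pow_div_factorial_le_exp (x := δ * (1 + t)) (by positivity) p
  rw [div_le_iff₀ (by positivity), mul_pow] at h
  rw [le_div_iff₀ (by positivity)]
  have e : Real.exp (δ * (1 + t)) = Real.exp δ * Real.exp (δ * t) := by
    rw [← Real.exp_add]; ring_nf
  rw [e] at h
  calc (1 + t) ^ p * Real.exp (-(δ * t)) * δ ^ p
      = (δ ^ p * (1 + t) ^ p) * Real.exp (-(δ * t)) := by ring
    _ ≤ (Real.exp δ * Real.exp (δ * t) * p.factorial) * Real.exp (-(δ * t)) := by gcongr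
    _ = p.factorial * Real.exp δ * (Real.exp (δ * t) * Real.exp (-(δ * t))) := by ring
    _ = _ := by rw [← Real.exp_add]; simp

theorem StripDecay.exp_bound {a b q : ℝ} (hq : 0 < q) {f : ℂ → ℂ} (hf : StripDecay a b q f) :
    ∀ a' b', a < a' → b' < b → ∃ C : ℝ, ∃ δ > 0,
      ∀ z : ℂ, a' ≤ z.re → z.re ≤ b' → ‖f z‖ ≤ C * Real.exp (-δ * |z.im|) := by
  intro a' b' ha hb
  obtain ⟨C, p, hC, h⟩ := hf a' b' ha hb
  obtain ⟨K, hK, hKb⟩ := exists_one_add_pow_mul_exp_le p (half_pos hq)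
  refine ⟨C * K, q / 2, half_pos hq, fun z h1 h2 => (h z h1 h2).trans ?_⟩
  have e : Real.exp (-(q * |z.im|)) = Real.exp (-(q / 2 * |z.im|)) * Real.exp (-(q / 2) * |z.im|) := by
    rw [← Real.exp_add]; ring_nf
  rw [e]
  calc C * (1 + |z.im|) ^ p * (Real.exp (-(q / 2 * |z.im|)) * Real.exp (-(q / 2) * |z.im|))
      = C * ((1 + |z.im|) ^ p * Real.exp (-(q / 2 * |z.im|))) * Real.exp (-(q / 2) * |z.im|) := by ring
    _ ≤ _ := by gcongr; exact hKb _ (abs_nonneg _)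

theorem StripDecay.integrable {a b q : ℝ} (hq : 0 < q) {f : ℂ → ℂ} (hf : StripDecay a b q f)
    (hd : DifferentiableOn ℂ f (vstrip a b)) {c : ℝ} (h1 : a < c) (h2 : c < b) :
    Integrable (fun u : ℝ => f (c + I * u)) := by
  obtain ⟨C, δ, hδ, hC⟩ := hf.exp_bound hq c c h1 h2
  refine ((integrable_exp_neg_mul_abs_real hδ).const_mul C).mono' ?_ ?_
  · refine (hd.continuousOn.comp_continuous (by fun_prop) fun u => ?_).aestronglyMeasurable
    exact ⟨by simpa using h1, by simpa using h2⟩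
  · exact Eventually.of_forall fun u => by simpa using hC (c + I * u) (by simp) (by simp)

/-! ### Determinants -/

theorem prod_offDiag_eq {m : ℕ} {M : Type*} [CommMonoid M] (g : Fin m → Fin m → M) :
    ∏ a, ∏ b ∈ Finset.univ.filter (fun b => b ≠ a), g a b =
      ∏ a, ∏ b ∈ Finset.Ioi a, (g a b * g b a) := by
  have h1 : ∀ a : Fin m, Finset.univ.filter (fun b => b ≠ a) = Finset.Ioi a ∪ Finset.Iio a := by
    intro a; ext b
    simp only [Finset.mem_filter, Finset.mem_univ, true_and, Finset.mem_union, Finset.mem_Ioi,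
      Finset.mem_Iio]
    exact ne_iff_lt_or_gt.trans or_comm
  have h2 : ∀ a : Fin m, Disjoint (Finset.Ioi a) (Finset.Iio a) := by
    intro a
    rw [Finset.disjoint_left]
    intro b hb hb'
    exact lt_asymm (Finset.mem_Ioi.1 hb) (Finset.mem_Iio.1 hb')
  simp_rw [h1, Finset.prod_union (h2 _), Finset.prod_mul_distrib]
  congr 1
  refine Finset.prod_comm' ?_
  intro a b
  simp

/-- The Sklyanin weight `∏_{a ≠ b} Γ(s_a - s_b)⁻¹`. -/
def sklyanin {m : ℕ} (s : Fin m → ℂ) : ℂ :=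
  ∏ a, ∏ b ∈ Finset.univ.filter (fun b => b ≠ a), (Gamma (s a - s b))⁻¹

theorem Gamma_inv_mul_Gamma_neg_inv (z : ℂ) :
    (Gamma z)⁻¹ * (Gamma (-z))⁻¹ = -z * Complex.sin (Real.pi * z) / Real.pi := by
  rcases eq_or_ne z 0 with rfl | hz
  · simp [Complex.Gamma_zero]
  have h1 := Complex.Gamma_mul_Gamma_one_sub z
  have h2 : Gamma (1 - z) = -z * Gamma (-z) := by
    rw [← Complex.Gamma_add_one _ (neg_ne_zero.2 hz)]; congr 1; ring
  rw [h2] at h1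
  have h3 := congrArg Inv.inv h1
  rw [mul_inv, mul_inv, inv_div] at h3
  have hz' : (-z) ≠ 0 := neg_ne_zero.2 hz
  calc (Gamma z)⁻¹ * (Gamma (-z))⁻¹
      = -z * ((Gamma z)⁻¹ * ((-z)⁻¹ * (Gamma (-z))⁻¹)) := by field_simp
    _ = _ := by rw [h3]; ring

/-- The normalising constant `(2πi)^{m(m-1)/2}`. -/
def pairConst (m : ℕ) : ℂ := ∏ a : Fin m, ∏ _b ∈ Finset.Ioi a, (2 * Real.pi * I)

theorem pairConst_ne_zero (m : ℕ) : pairConst m ≠ 0 :=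
  Finset.prod_ne_zero_iff.2 fun _ _ => Finset.prod_ne_zero_iff.2 fun _ _ => by
    simp [Real.pi_ne_zero]

theorem pairConst_mul_sklyanin {m : ℕ} (s : Fin m → ℂ) :
    pairConst m * sklyanin s = (Matrix.of fun j a : Fin m => s a ^ (j : ℕ)).det *
      (Matrix.of fun k a : Fin m => trigMode m k (s a)).det := by
  have h1 : (Matrix.of fun j a : Fin m => s a ^ (j : ℕ)).det =
      ∏ i, ∏ j ∈ Finset.Ioi i, (s j - s i) := by
    rw [← Matrix.det_vandermonde, ← Matrix.det_transpose]; rfl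
  have h2 : (Matrix.of fun k a : Fin m => trigMode m k (s a)).det =
      (∏ a, cexp (I * Real.pi * s a) ^ (m - 1)) *
        ∏ i, ∏ j ∈ Finset.Ioi i, (cexp (-2 * Real.pi * I * s j) - cexp (-2 * Real.pi * I * s i)) := by
    rw [← Matrix.det_vandermonde, ← Matrix.det_mul_column, ← Matrix.det_transpose]
    congr 1; ext a k
    simp only [Matrix.transpose_apply, Matrix.of_apply, Matrix.vandermonde_apply, trigMode]
    rw [← Complex.exp_nat_mul, ← Complex.exp_nat_mul, ← Complex.exp_add]
    congr 1
    have : ((m - 1 : ℕ) : ℂ) = (m : ℂ) - 1 := by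
      rw [Nat.cast_sub (by have := a.2; omega)]; simp
    rw [this]; ring
  have h3 : ∏ a, cexp (I * Real.pi * s a) ^ (m - 1) =
      ∏ a, ∏ b ∈ Finset.Ioi a, (cexp (I * Real.pi * s a) * cexp (I * Real.pi * s b)) := by
    rw [← prod_offDiag_eq (fun a _ => cexp (I * Real.pi * s a))]
    refine Finset.prod_congr rfl fun a _ => ?_
    rw [Finset.prod_const]
    congr 1
    rw [Finset.filter_ne', Finset.card_erase_of_mem (Finset.mem_univ _)]; simp
  rw [h1, h2, h3, sklyanin, prod_offDiag_eq, pairConst]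
  simp_rw [← Finset.prod_mul_distrib]
  refine Finset.prod_congr rfl fun a _ => Finset.prod_congr rfl fun b _ => ?_
  have h4 := Gamma_inv_mul_Gamma_neg_inv (s a - s b)
  rw [neg_sub] at h4
  rw [h4]
  have h5 : cexp (I * Real.pi * s a) * cexp (I * Real.pi * s b) *
      (cexp (-2 * Real.pi * I * s b) - cexp (-2 * Real.pi * I * s a)) =
      2 * I * Complex.sin (Real.pi * (s a - s b)) := by
    rw [Complex.sin, mul_sub, ← Complex.exp_add, ← Complex.exp_add, ← Complex.exp_add]
    have e1 : I * Real.pi * s a + I * Real.pi * s b + -2 * Real.pi * I * s b =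
      Real.pi * (s a - s b) * I := by ring
    have e2 : I * Real.pi * s a + I * Real.pi * s b + -2 * Real.pi * I * s a =
      -(Real.pi * (s a - s b)) * I := by ring
    rw [e1, e2]
    ring_nf
    rw [I_sq]; ring
  rw [h5]
  have : (Real.pi : ℂ) ≠ 0 := by simp [Real.pi_ne_zero]
  field_simp

/-- Andréief's identity. -/
theorem integral_det_mul_det {m : ℕ} (f g : Fin m → ℝ → ℂ)
    (hfg : ∀ j k, Integrable fun u => f j u * g k u) :
    ∫ u : Fin m → ℝ, (Matrix.of fun j a : Fin m => f j (u a)).det *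
        (Matrix.of fun k a : Fin m => g k (u a)).det =
      m.factorial * (Matrix.of fun j k : Fin m => ∫ u, f j u * g k u).det := by
  have h1 : ∀ u : Fin m → ℝ, (Matrix.of fun j a : Fin m => f j (u a)).det *
      (Matrix.of fun k a : Fin m => g k (u a)).det =
      ∑ τ : Equiv.Perm (Fin m), ∑ σ : Equiv.Perm (Fin m),
        ((Equiv.Perm.sign τ : ℤ) : ℂ) * ((Equiv.Perm.sign σ : ℤ) : ℂ) *
          ∏ a, (f (σ a) (u a) * g (τ a) (u a)) := by
    intro u
    rw [Matrix.det_apply', Matrix.det_apply', Finset.sum_mul_sum, Finset.sum_comm]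
    refine Finset.sum_congr rfl fun τ _ => Finset.sum_congr rfl fun σ _ => ?_
    rw [Finset.prod_mul_distrib]
    simp only [Matrix.of_apply]
    ring
  have hintg : ∀ σ τ : Equiv.Perm (Fin m), Integrable fun u : Fin m → ℝ =>
      ((Equiv.Perm.sign τ : ℤ) : ℂ) * ((Equiv.Perm.sign σ : ℤ) : ℂ) *
          ∏ a, (f (σ a) (u a) * g (τ a) (u a)) := fun σ τ =>
    (Integrable.fintype_prod fun a => hfg (σ a) (τ a)).const_mul _
  simp_rw [h1]
  rw [integral_finsetSum _ fun τ _ => integrable_finsetSum _ fun σ _ => hintg σ τ]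
  have h2 : ∀ τ : Equiv.Perm (Fin m), ∫ u : Fin m → ℝ, ∑ σ : Equiv.Perm (Fin m),
        ((Equiv.Perm.sign τ : ℤ) : ℂ) * ((Equiv.Perm.sign σ : ℤ) : ℂ) *
          ∏ a, (f (σ a) (u a) * g (τ a) (u a)) =
      (Matrix.of fun j k : Fin m => ∫ u, f j u * g k u).det := by
    intro τ
    rw [integral_finsetSum _ fun σ _ => hintg σ τ]
    have h3 := Matrix.det_permute' τ (Matrix.of fun j k : Fin m => ∫ u, f j u * g k u)
    rw [Matrix.det_apply'] at h3
    have h4 : (((Equiv.Perm.sign τ : ℤ) : ℂ)) * (((Equiv.Perm.sign τ : ℤ) : ℂ)) = 1 := by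
      rw [← Int.cast_mul, ← Units.val_mul, Int.units_mul_self]; simp
    rw [← one_mul (Matrix.det _), ← h4, mul_assoc, ← h3, Finset.mul_sum]
    refine Finset.sum_congr rfl fun σ _ => ?_
    rw [integral_const_mul, mul_assoc]
    congr 2
    exact integral_fintype_prod_volume_eq_prod (fun a (x : ℝ) => f (σ a) x * g (τ a) x)
  simp_rw [h2]
  simp [Fintype.card_perm]

/-- The Gustafson-type integral of a weight. -/
def gustafson (m : ℕ) (ω : ℂ → ℂ) : ℂ :=
  ∫ u : Fin m → ℝ, (∏ a, ω (I * u a)) * sklyanin (fun a => I * (u a : ℂ))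

/-- The moments of a weight on the imaginary axis against `s^j e^{iπ(m-1-2k)s}`. -/
def moment (m : ℕ) (ω : ℂ → ℂ) (j k : ℕ) : ℂ :=
  ∫ u : ℝ, (I * u) ^ j * (trigMode m k (I * u) * ω (I * u))

theorem pairConst_mul_gustafson {m : ℕ} {ω : ℂ → ℂ}
    (hω : ∀ j k : Fin m, Integrable fun u : ℝ =>
      (I * u : ℂ) ^ (j : ℕ) * (trigMode m k (I * u) * ω (I * u))) :
    pairConst m * gustafson m ω = m.factorial *
      (Matrix.of fun j k : Fin m => moment m ω j k).det := by
  rw [gustafson, ← integral_const_mul]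
  have := integral_det_mul_det (fun j u => (I * u : ℂ) ^ (j : ℕ))
    (fun k u => trigMode m k (I * u) * ω (I * u)) hω
  simp only [moment]
  rw [← this]
  congr 1; ext u
  rw [mul_left_comm, pairConst_mul_sklyanin]
  have h : (Matrix.of fun k a : Fin m => trigMode m k (I * u a) * ω (I * u a)).det =
      (∏ a, ω (I * u a)) * (Matrix.of fun k a : Fin m => trigMode m k (I * u a)).det := by
    rw [← Matrix.det_mul_row]
    congr 1; ext k a; simp [mul_comm]
  rw [h]; ring

theorem exists_pos_le_forall {m : ℕ} {f : Fin m → ℝ} (hf : ∀ l, 0 < f l) :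
    ∃ ε > 0, ∀ l, ε ≤ f l := by
  rcases isEmpty_or_nonempty (Fin m) with h | h
  · exact ⟨1, one_pos, fun l => h.elim l⟩
  · obtain ⟨i, hi⟩ := Finite.exists_min f
    exact ⟨f i, hf i, hi⟩

theorem integrable_moment {m : ℕ} {a b q : ℝ} (ha : a < 0) (hb : 0 < b) {ω : ℂ → ℂ}
    (hω : StripDecay a b q ω) (hd : DifferentiableOn ℂ ω (vstrip a b))
    (hq : 0 < q - Real.pi * ((m : ℝ) - 1)) (j : ℕ) (k : Fin m) :
    Integrable fun u : ℝ => (I * u : ℂ) ^ j * (trigMode m k (I * u) * ω (I * u)) := by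
  have hdec := (StripDecay.pow_id a b j).mul ((StripDecay.trigMode a b k.2).mul hω)
  have hdd : DifferentiableOn ℂ (fun s : ℂ => s ^ j * (trigMode m k s * ω s)) (vstrip a b) := by
    unfold trigMode
    exact DifferentiableOn.mul (by fun_prop) (DifferentiableOn.mul (by fun_prop) hd)
  have := hdec.integrable (by linarith) hdd (c := 0) ha hb
  simpa using this

theorem prod_inv_sub_eq {m : ℕ} (hm : 0 < m) {α : Fin m → ℂ} (hα : Function.Injective α) {s : ℂ}
    (hs : ∀ l, s ≠ α l) :
    ∏ l, (s - α l)⁻¹ = ∑ l, Lagrange.nodalWeight Finset.univ α l * (s - α l)⁻¹ := by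
  have : Nonempty (Fin m) := ⟨⟨0, hm⟩⟩
  have h1 := Lagrange.eval_interpolate_not_at_node (s := Finset.univ) (v := α) (x := s)
    (fun _ => (1 : ℂ)) (fun i _ => hs i)
  have h2 : Lagrange.interpolate Finset.univ α (fun _ => (1 : ℂ)) = 1 :=
    Lagrange.interpolate_one hα.injOn Finset.univ_nonempty
  rw [h2, Polynomial.eval_one, Lagrange.eval_nodal] at h1
  simp only [mul_one] at h1
  rw [Finset.prod_inv_distrib]
  exact inv_eq_of_mul_eq_one_right h1.symm

theorem prod_Gamma_sub_eq {m : ℕ} (hm : 0 < m) {α : Fin m → ℂ} (hα : Function.Injective α) {s : ℂ}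
    (hs : ∀ l, s ≠ α l) :
    ∏ l, Gamma (α l - s) = (-1) ^ m * ((∏ l, Gamma (α l + 1 - s)) *
      ∑ l, Lagrange.nodalWeight Finset.univ α l * (s - α l)⁻¹) := by
  rw [← prod_inv_sub_eq hm hα hs, ← Finset.prod_mul_distrib]
  have : ((-1 : ℂ)) ^ m = ∏ _l : Fin m, (-1 : ℂ) := by simp
  rw [this, ← Finset.prod_mul_distrib]
  refine Finset.prod_congr rfl fun l _ => ?_
  have h0 : α l - s ≠ 0 := sub_ne_zero.2 (hs l).symm
  have h0' : s - α l ≠ 0 := sub_ne_zero.2 (hs l)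
  rw [show α l + 1 - s = (α l - s) + 1 by ring, Complex.Gamma_add_one _ h0]
  field_simp
  ring

theorem nodalWeight_mul_prod_Gamma {m : ℕ} {α : Fin m → ℂ} (hα : Function.Injective α)
    (l : Fin m) :
    (-1) ^ m * (Lagrange.nodalWeight Finset.univ α l * ∏ i, Gamma (α i + 1 - α l)) =
      -∏ i ∈ Finset.univ.erase l, Gamma (α i - α l) := by
  rw [← Finset.mul_prod_erase Finset.univ _ (Finset.mem_univ l), Lagrange.nodalWeight]
  rw [add_sub_cancel_left, Complex.Gamma_one, one_mul, ← Finset.prod_mul_distrib]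
  have h1 : ((-1 : ℂ)) ^ m = -∏ _i ∈ Finset.univ.erase l, (-1 : ℂ) := by
    rw [Finset.prod_const, Finset.card_erase_of_mem (Finset.mem_univ l)]
    have := l.pos
    obtain ⟨k, rfl⟩ : ∃ k, m = k + 1 := ⟨m - 1, by omega⟩
    simp [pow_succ]
  rw [h1, neg_mul, ← Finset.prod_mul_distrib]
  congr 1
  refine Finset.prod_congr rfl fun i hi => ?_
  have h0 : α i - α l ≠ 0 := sub_ne_zero.2 fun h => (Finset.mem_erase.1 hi).1 (hα h)
  have h0' : α l - α i ≠ 0 := sub_ne_zero.2 fun h => (Finset.mem_erase.1 hi).1 (hα h).symm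
  rw [show α i + 1 - α l = (α i - α l) + 1 by ring, Complex.Gamma_add_one _ h0]
  field_simp
  ring

/-- The regular part of the integrand of `moment`. -/
def momentKernel {m : ℕ} (α : Fin m → ℂ) (j k : ℕ) (s : ℂ) : ℂ :=
  s ^ j * (trigMode m k s * ∏ l, Gamma (α l + 1 - s))

theorem momentKernel_decay {m : ℕ} {α : Fin m → ℂ} {a b : ℝ} (hb : ∀ l, b ≤ (α l).re + 1)
    (j k : Fin m) : StripDecay a b (m * (Real.pi / 2) - Real.pi * ((m : ℝ) - 1))
      (momentKernel α j k) := by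
  have h := (StripDecay.pow_id a b j).mul ((StripDecay.trigMode a b k.2).mul
    (StripDecay.prod (a := a) (b := b) (q := Real.pi / 2) Finset.univ
      (f := fun l s => Gamma (α l + 1 - s))
      fun l _ => StripDecay.gamma_sub (by simpa using hb l)))
  have e : (m * (Real.pi / 2) - Real.pi * ((m : ℝ) - 1)) = 0 + (-(Real.pi * ((m : ℝ) - 1)) +
      ((Finset.univ : Finset (Fin m)).card : ℝ) * (Real.pi / 2)) := by simp; ring
  rw [e]; exact h

theorem momentKernel_diff {m : ℕ} {α : Fin m → ℂ} {a b : ℝ} (hb : ∀ l, b ≤ (α l).re + 1)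
    (j k : ℕ) : DifferentiableOn ℂ (momentKernel α j k) (vstrip a b) := by
  unfold momentKernel trigMode
  refine DifferentiableOn.mul (by fun_prop) (DifferentiableOn.mul (by fun_prop) ?_)
  exact DifferentiableOn.fun_finsetProd fun l _ => differentiableOn_gamma_sub (by simpa using hb l)

theorem moment_eq_residues {m : ℕ} {α : Fin m → ℂ} (hα : Function.Injective α) {a b c q : ℝ}
    (ha : a < 0) (hc : c < b) (hα0 : ∀ l, 0 < (α l).re) (hαc : ∀ l, (α l).re < c)
    (hb : ∀ l, b ≤ (α l).re + 1) {G : ℂ → ℂ} (hG : DifferentiableOn ℂ G (vstrip a b))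
    (hGd : StripDecay a b q G) (hq : 0 < q + (m * (Real.pi / 2) - Real.pi * ((m : ℝ) - 1)))
    (j k : Fin m) :
    moment m (fun s => G s * ∏ l, Gamma (α l - s)) j k =
      (∑ l, α l ^ (j : ℕ) * (2 * Real.pi * G (α l) *
        ((∏ i ∈ Finset.univ.erase l, Gamma (α i - α l)) * trigMode m k (α l)))) +
      (-1) ^ m * ∑ l, Lagrange.nodalWeight Finset.univ α l *
        ∫ u : ℝ, G (c + I * u) * momentKernel α j k (c + I * u) / (c + I * u - α l) := by
  have hd := hG.mul (momentKernel_diff (a := a) hb j k)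
  have hdec := (hGd.mul (momentKernel_decay (a := a) hb j k)).exp_bound hq
  have hm : 0 < m := j.pos
  have hne : ∀ (u : ℝ) l, (I * u : ℂ) ≠ α l := fun u l h => by
    have := congrArg re h; simp at this; linarith [hα0 l]
  have h0b : (0 : ℝ) < b := (hα0 j).trans ((hαc j).trans hc)
  have hintg : ∀ l, Integrable fun u : ℝ => G (I * u) * momentKernel α j k (I * u) / (I * u - α l) := by
    intro l
    have h1 := (hGd.mul (momentKernel_decay (a := a) hb j k)).integrable hq hd (c := 0) ha h0b
    simp only [ofReal_zero, zero_add] at h1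
    refine (h1.norm.div_const (α l).re).mono' ?_ (Eventually.of_forall fun u => ?_)
    · exact h1.aestronglyMeasurable.mul (Continuous.aestronglyMeasurable
        (Continuous.inv₀ (by fun_prop) fun u => sub_ne_zero.2 (hne u l)))
    · rw [norm_div]
      refine div_le_div_of_nonneg_left (norm_nonneg _) (hα0 l) ?_
      have := Complex.abs_re_le_norm (I * u - α l)
      simp at this
      exact (le_abs_self _).trans this
  have hpt : ∀ u : ℝ, (I * u : ℂ) ^ (j : ℕ) * (trigMode m k (I * u) *
      (G (I * u) * ∏ l, Gamma (α l - I * u))) = (-1) ^ m * ∑ l,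
        Lagrange.nodalWeight Finset.univ α l *
          (G (I * u) * momentKernel α j k (I * u) / (I * u - α l)) := by
    intro u
    rw [prod_Gamma_sub_eq hm hα (hne u)]
    simp only [momentKernel, Finset.mul_sum]
    refine Finset.sum_congr rfl fun l _ => ?_
    rw [div_eq_mul_inv]; ring
  rw [moment]
  simp_rw [hpt]
  rw [integral_const_mul, integral_finsetSum _ fun l _ => (hintg l).const_mul _]
  have hcauchy : ∀ l, ∫ u : ℝ, G (I * u) * momentKernel α j k (I * u) / (I * u - α l) =
      (∫ u : ℝ, G (c + I * u) * momentKernel α j k (c + I * u) / (c + I * u - α l)) -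
        2 * Real.pi * (G (α l) * momentKernel α j k (α l)) := by
    intro l
    have := cauchy_strip (H := fun s => G s * momentKernel α j k s) hd hdec (c₁ := 0) (c₂ := c)
      (w := α l) ha (hα0 l) (hαc l) hc
    simp only [ofReal_zero, zero_add] at this
    rw [this]; ring
  simp_rw [integral_const_mul, hcauchy, mul_sub, Finset.sum_sub_distrib]
  rw [mul_sub, sub_eq_add_neg, add_comm]
  congr 1
  rw [Finset.mul_sum, ← Finset.sum_neg_distrib]
  refine Finset.sum_congr rfl fun l _ => ?_
  have h := nodalWeight_mul_prod_Gamma hα l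
  have h' : ∏ i ∈ Finset.univ.erase l, Gamma (α i - α l) =
    -((-1) ^ m * (Lagrange.nodalWeight Finset.univ α l * ∏ i, Gamma (α i + 1 - α l))) := by
    rw [h, neg_neg]
  rw [h', momentKernel]
  ring

theorem sklyanin_mul_prod_Gamma {m : ℕ} {α : Fin m → ℂ} (hα : Function.Injective α)
    (hre : ∀ i l, (α i).re < (α l).re + 1) :
    sklyanin α * ∏ l, ∏ i ∈ Finset.univ.erase l, Gamma (α i - α l) = 1 := by
  have h : ∏ l, ∏ i ∈ Finset.univ.erase l, Gamma (α i - α l) =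
      ∏ l, ∏ i ∈ Finset.univ.filter (fun b => b ≠ l), Gamma (α l - α i) := by
    simp_rw [← Finset.filter_ne']
    rw [prod_offDiag_eq, prod_offDiag_eq]
    exact Finset.prod_congr rfl fun a _ => Finset.prod_congr rfl fun b _ => mul_comm _ _
  rw [h, sklyanin, ← Finset.prod_mul_distrib]
  refine Finset.prod_eq_one fun a _ => ?_
  rw [← Finset.prod_mul_distrib]
  refine Finset.prod_eq_one fun b hb => inv_mul_cancel₀ ?_
  refine Complex.Gamma_ne_zero fun n hn => ?_
  have h1 := congrArg re hn
  simp at h1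
  rcases Nat.eq_zero_or_pos n with rfl | hpos
  · simp at hn
    exact (Finset.mem_filter.1 hb).2 (hα (sub_eq_zero.1 hn)).symm
  · have : (1 : ℝ) ≤ n := by exact_mod_cast hpos
    linarith [hre b a]

/-- Asymptotics of a Gustafson-type integral dominated by the poles at `α`. -/
theorem tendsto_gustafson {m : ℕ} {α : Fin m → ℂ} (hα : Function.Injective α) {a b c q : ℝ}
    (ha : a < 0) (h0c : 0 < c) (hc : c < b) (hα0 : ∀ l, 0 < (α l).re) (hαc : ∀ l, (α l).re < c)
    (hb : ∀ l, b ≤ (α l).re + 1)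
    (hq : 0 < q + (m * (Real.pi / 2) - Real.pi * ((m : ℝ) - 1)))
    {ι : Type*} {L : Filter ι} {G : ι → ℂ → ℂ} (hG : ∀ p, DifferentiableOn ℂ (G p) (vstrip a b))
    (hGd : ∀ p, StripDecay a b q (G p)) (hG0 : ∀ p l, G p (α l) ≠ 0)
    {g : ι → ℝ} (hg0 : ∀ p, 0 ≤ g p) {G₀ : ℂ → ℂ} (hG₀ : StripDecay a b q G₀)
    (hG₀d : DifferentiableOn ℂ G₀ (vstrip a b))
    (hgb : ∀ p (u : ℝ), ‖G p (c + I * u)‖ ≤ g p * ‖G₀ (c + I * u)‖)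
    (hlim : ∀ l, Tendsto (fun p => g p / ‖G p (α l)‖) L (𝓝 0)) :
    Tendsto (fun p => gustafson m (fun s => G p s * ∏ l, Gamma (α l - s)) /
      (m.factorial * ∏ l, (2 * Real.pi * G p (α l)))) L (𝓝 1) := by
  have hκ := pairConst_ne_zero m
  have hfac : (m.factorial : ℂ) ≠ 0 := by exact_mod_cast m.factorial_ne_zero
  have hre : ∀ i l, (α i).re < (α l).re + 1 := fun i l =>
    ((hαc i).trans hc).trans_le (hb l)
  set V : Matrix (Fin m) (Fin m) ℂ := Matrix.of fun j l : Fin m => α l ^ (j : ℕ) with hV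
  have hVdet : V.det ≠ 0 := by
    have : V = (Matrix.vandermonde α).transpose := rfl
    rw [this, Matrix.det_transpose]
    exact Matrix.det_vandermonde_ne_zero_iff.2 hα
  set Ee : Matrix (Fin m) (Fin m) ℂ := Matrix.of fun l k : Fin m =>
    (∏ i ∈ Finset.univ.erase l, Gamma (α i - α l)) * trigMode m k (α l) with hEe
  have hEdet : V.det * Ee.det = pairConst m := by
    have h1 : Ee.det = (∏ l, ∏ i ∈ Finset.univ.erase l, Gamma (α i - α l)) *
        (Matrix.of fun k l : Fin m => trigMode m k (α l)).det := by
      rw [← Matrix.det_mul_row, ← Matrix.det_transpose]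
      rfl
    rw [h1, mul_left_comm, ← pairConst_mul_sklyanin, mul_left_comm, mul_comm (∏ l, _),
      sklyanin_mul_prod_Gamma hα hre, mul_one]
  set R : ι → Matrix (Fin m) (Fin m) ℂ := fun p => Matrix.of fun j k : Fin m =>
    (-1) ^ m * ∑ l, Lagrange.nodalWeight Finset.univ α l *
      ∫ u : ℝ, G p (c + I * u) * momentKernel α j k (c + I * u) / (c + I * u - α l) with hR
  set X : ι → Matrix (Fin m) (Fin m) ℂ := fun p => Matrix.of fun l k : Fin m =>
    (2 * Real.pi * G p (α l))⁻¹ * (V⁻¹ * R p) l k with hX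
  have h2π : ∀ p l, (2 * Real.pi * G p (α l) : ℂ) ≠ 0 := fun p l => by
    simp [Real.pi_ne_zero, hG0 p l]
  have hmom : ∀ p, (Matrix.of fun j k : Fin m =>
      moment m (fun s => G p s * ∏ l, Gamma (α l - s)) j k) =
      V * (Matrix.diagonal (fun l => (2 * Real.pi * G p (α l) : ℂ)) * (Ee + X p)) := by
    intro p
    have h1 : Matrix.diagonal (fun l => (2 * Real.pi * G p (α l) : ℂ)) * X p = V⁻¹ * R p := by
      ext l k
      rw [Matrix.diagonal_mul]
      simp only [hX, Matrix.of_apply]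
      rw [mul_inv_cancel_left₀ (h2π p l)]
    rw [mul_add, h1, mul_add, Matrix.mul_nonsing_inv_cancel_left _ _ (Ne.isUnit hVdet)]
    ext j k
    rw [Matrix.of_apply, moment_eq_residues hα ha hc hα0 hαc hb (hG p) (hGd p) hq,
      Matrix.add_apply]
    congr 1
    rw [Matrix.mul_apply]
    simp only [Matrix.diagonal_mul, hV, hEe, Matrix.of_apply]
  have hintg : ∀ p, ∀ j k : Fin m, Integrable fun u : ℝ => (I * u : ℂ) ^ (j : ℕ) *
      (trigMode m k (I * u) * (G p (I * u) * ∏ l, Gamma (α l - I * u))) := by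
    intro p j k
    obtain ⟨ε, hε, hεl⟩ := exists_pos_le_forall hα0
    have hsub : StripDecay a (min b ε) q (G p) := fun x y hx hy =>
      hGd p x y hx (hy.trans_le (min_le_left _ _))
    have hdec := hsub.mul (StripDecay.prod (a := a) (b := min b ε) (q := Real.pi / 2) Finset.univ
      (f := fun l s => Gamma (α l - s)) fun l _ =>
        StripDecay.gamma_sub ((min_le_right _ _).trans (hεl l)))
    refine integrable_moment ha (lt_min (h0c.trans hc) hε) hdec
      (DifferentiableOn.mul ?_ ?_) (by simp; linarith) j k
    · exact (hG p).mono fun z hz => ⟨hz.1, hz.2.trans_le (min_le_left _ _)⟩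
    · exact DifferentiableOn.fun_finsetProd fun l _ =>
        differentiableOn_gamma_sub ((min_le_right _ _).trans (hεl l))
  have hgus : ∀ p, gustafson m (fun s => G p s * ∏ l, Gamma (α l - s)) /
      (m.factorial * ∏ l, (2 * Real.pi * G p (α l))) =
      (pairConst m)⁻¹ * (V.det * (Ee + X p).det) := by
    intro p
    have h1 := pairConst_mul_gustafson (ω := fun s => G p s * ∏ l, Gamma (α l - s)) (hintg p)
    rw [hmom, Matrix.det_mul, Matrix.det_mul, Matrix.det_diagonal] at h1
    have h2 : (∏ l, (2 * Real.pi * G p (α l)) : ℂ) ≠ 0 :=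
      Finset.prod_ne_zero_iff.2 fun l _ => h2π p l
    rw [div_eq_iff (mul_ne_zero hfac h2)]
    refine mul_left_cancel₀ hκ (h1.trans ?_)
    generalize (Ee + X p).det = A
    generalize (∏ l, (2 * Real.pi * G p (α l)) : ℂ) = B
    generalize V.det = D
    field_simp
  -- the remainder tends to zero
  have hRb : ∀ j k : Fin m, ∃ B : ℝ, ∀ p, ‖R p j k‖ ≤ g p * B := by
    intro j k
    have hprod := hG₀.mul (momentKernel_decay (a := a) hb j k)
    have hacb : a < c := ha.trans h0c
    have hIG := (hprod.integrable hq (hG₀d.mul (momentKernel_diff (a := a) hb j k)) hacb hc).norm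
    refine ⟨∑ l, ‖Lagrange.nodalWeight Finset.univ α l‖ * ((∫ u : ℝ, ‖G₀ (c + I * u) *
      momentKernel α j k (c + I * u)‖) / (c - (α l).re)), fun p => ?_⟩
    simp only [hR, Matrix.of_apply, norm_mul, norm_pow, norm_neg, norm_one, one_pow, one_mul]
    refine (norm_sum_le _ _).trans ?_
    rw [Finset.mul_sum]
    refine Finset.sum_le_sum fun l _ => ?_
    rw [norm_mul, mul_left_comm]
    refine mul_le_mul_of_nonneg_left ?_ (norm_nonneg _)
    rw [mul_div_assoc', ← integral_const_mul, ← integral_div]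
    refine norm_integral_le_of_norm_le
      (by simpa only [norm_mul] using (hIG.const_mul (g p)).div_const (c - (α l).re))
      (Eventually.of_forall fun u => ?_)
    have h1 : c - (α l).re ≤ ‖(c + I * u - α l : ℂ)‖ := by
      have := Complex.abs_re_le_norm (c + I * u - α l)
      simp at this
      exact (le_abs_self _).trans this
    rw [norm_div]
    refine div_le_div₀ (mul_nonneg (hg0 p) (by positivity)) ?_ (sub_pos.2 (hαc l)) h1
    rw [norm_mul, ← mul_assoc]
    exact mul_le_mul_of_nonneg_right (hgb p u) (norm_nonneg _)
  have hX0 : Tendsto X L (𝓝 0) := by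
    refine tendsto_pi_nhds.2 fun l => tendsto_pi_nhds.2 fun k => ?_
    simp only [hX, Matrix.of_apply, Matrix.mul_apply, Finset.mul_sum]
    rw [show (0 : Matrix (Fin m) (Fin m) ℂ) l k = ∑ j : Fin m, (0 : ℂ) by simp]
    refine tendsto_finsetSum _ fun j _ => ?_
    obtain ⟨B, hB⟩ := hRb j k
    have h1 := ((hlim l).mul_const ((2 * Real.pi)⁻¹ * ‖V⁻¹ l j‖ * B))
    rw [zero_mul] at h1
    refine squeeze_zero_norm (fun p => ?_) h1
    rw [norm_mul, norm_mul, norm_inv, norm_mul]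
    have h2 : ‖(2 * Real.pi : ℂ)‖ = 2 * Real.pi := by
      simp [abs_of_pos Real.pi_pos]
    rw [h2, mul_inv]
    calc (2 * Real.pi)⁻¹ * ‖G p (α l)‖⁻¹ * (‖V⁻¹ l j‖ * ‖R p j k‖)
        ≤ (2 * Real.pi)⁻¹ * ‖G p (α l)‖⁻¹ * (‖V⁻¹ l j‖ * (g p * B)) := by
          have := Real.pi_pos
          gcongr
          exact hB p
      _ = _ := by rw [div_eq_mul_inv]; ring
  simp_rw [hgus]
  have hcont : Continuous fun Y : Matrix (Fin m) (Fin m) ℂ =>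
      (pairConst m)⁻¹ * (V.det * (Ee + Y).det) :=
    continuous_const.mul (continuous_const.mul (continuous_const.add continuous_id).matrix_det)
  have := (hcont.tendsto 0).comp hX0
  simp only [add_zero, hEdet, inv_mul_cancel₀ hκ] at this
  exact this

theorem det_succ_of_linear_relation {m : ℕ} (r : Fin (m + 1) → Fin m → ℂ) (t : Fin (m + 1) → ℂ)
    (h : ∀ k, ∑ j, t j * r j k = 0) :
    t (Fin.last m) * (Matrix.of fun j k : Fin m => r j.succ k).det =
      (-1) ^ m * t 0 * (Matrix.of fun j k : Fin m => r j.castSucc k).det := by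
  set B : Matrix (Fin (m + 1)) (Fin (m + 1)) ℂ :=
    Matrix.of fun j => Fin.cons (if j = 0 then 1 else 0) (r j) with hB
  have h1 : B.det = (Matrix.of fun j k : Fin m => r j.succ k).det := by
    rw [Matrix.det_succ_column_zero, Finset.sum_eq_single 0]
    · simp only [hB, Matrix.of_apply, Fin.cons_zero, if_true, Fin.val_zero, pow_zero, one_mul]
      congr 1
    · intro b _ hb
      simp [hB, hb]
    · simp
  have h2 := Matrix.det_updateRow_sum B (Fin.last m) t
  have h3 : ∑ k, t k • B k = Fin.cons (t 0) 0 := by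
    ext k
    rw [Finset.sum_apply]
    refine Fin.cases ?_ (fun k => ?_) k
    · simp [hB]
    · simpa [hB] using h k
  rw [h3, smul_eq_mul, h1] at h2
  rw [← h2, Matrix.det_succ_row _ (Fin.last m), Finset.sum_eq_single 0]
  · simp only [Matrix.updateRow_self, Fin.cons_zero, Fin.val_last, Fin.val_zero, add_zero]
    congr 2
    ext j k
    simp only [Matrix.submatrix_apply, Fin.succAbove_last, Matrix.of_apply, Fin.succAbove_zero]
    rw [Matrix.updateRow_ne (Fin.castSucc_lt_last j).ne]
    simp [hB]
  · intro b _ hb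
    obtain ⟨k, rfl⟩ := Fin.exists_succ_eq.2 hb
    simp
  · simp

/-- The moments about a point `x`. -/
def momentAt (m : ℕ) (ω : ℂ → ℂ) (x : ℂ) (j k : ℕ) : ℂ :=
  ∫ u : ℝ, (I * u - x) ^ j * (trigMode m k (I * u) * ω (I * u))

theorem integrable_momentAt {m : ℕ} {ω : ℂ → ℂ} {k : ℕ}
    (hω : ∀ j : ℕ, Integrable fun u : ℝ => (I * u : ℂ) ^ j * (trigMode m k (I * u) * ω (I * u)))
    (x : ℂ) (j : ℕ) :
    Integrable fun u : ℝ => (I * u - x : ℂ) ^ j * (trigMode m k (I * u) * ω (I * u)) := by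
  have h : ∀ u : ℝ, (I * u - x : ℂ) ^ j * (trigMode m k (I * u) * ω (I * u)) =
      ∑ i ∈ Finset.range (j + 1), ((-x) ^ (j - i) * (j.choose i : ℂ)) *
        ((I * u : ℂ) ^ i * (trigMode m k (I * u) * ω (I * u))) := by
    intro u
    rw [sub_eq_add_neg, add_pow, Finset.sum_mul]
    exact Finset.sum_congr rfl fun i _ => by ring
  simp_rw [h]
  exact integrable_finsetSum _ fun i _ => (hω i).const_mul _

theorem pairConst_mul_gustafson_momentAt {m : ℕ} {ω : ℂ → ℂ}
    (hω : ∀ (j : ℕ) (k : Fin m), Integrable fun u : ℝ =>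
      (I * u : ℂ) ^ j * (trigMode m k (I * u) * ω (I * u))) (x : ℂ) :
    pairConst m * gustafson m ω = m.factorial *
      (Matrix.of fun j k : Fin m => momentAt m ω x j k).det := by
  rw [gustafson, ← integral_const_mul]
  have := integral_det_mul_det (fun j u => (I * u - x : ℂ) ^ (j : ℕ))
    (fun k u => trigMode m k (I * u) * ω (I * u))
    (fun j k => integrable_momentAt (fun j => hω j k) x j)
  simp only [momentAt]
  rw [← this]
  congr 1; ext u
  rw [mul_left_comm, pairConst_mul_sklyanin]
  have h : (Matrix.of fun k a : Fin m => trigMode m k (I * u a) * ω (I * u a)).det =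
      (∏ a, ω (I * u a)) * (Matrix.of fun k a : Fin m => trigMode m k (I * u a)).det := by
    rw [← Matrix.det_mul_row]
    congr 1; ext k a; simp [mul_comm]
  have h' : (Matrix.of fun j a : Fin m => (I * u a - x : ℂ) ^ (j : ℕ)).det =
      (Matrix.of fun j a : Fin m => (I * u a : ℂ) ^ (j : ℕ)).det := by
    have e1 : (Matrix.of fun j a : Fin m => (I * u a - x : ℂ) ^ (j : ℕ)) =
      (Matrix.vandermonde fun a => (I * u a - x : ℂ)).transpose := rfl
    have e2 : (Matrix.of fun j a : Fin m => (I * u a : ℂ) ^ (j : ℕ)) =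
      (Matrix.vandermonde fun a => (I * u a : ℂ)).transpose := rfl
    rw [e1, e2, Matrix.det_transpose, Matrix.det_transpose, Matrix.det_vandermonde,
      Matrix.det_vandermonde]
    simp
  rw [h, h']; ring

/-- If a polynomial `P` of degree `m` annihilates a weight, then multiplying the weight by `x - s`
multiplies its Gustafson-type integral by `P(x) / p_m`. -/
theorem gustafson_mul_linear {m : ℕ} {ω : ℂ → ℂ}
    (hω : ∀ (j : ℕ) (k : Fin m), Integrable fun u : ℝ =>
      (I * u : ℂ) ^ j * (trigMode m k (I * u) * ω (I * u)))
    (P : Polynomial ℂ) (hP : P.natDegree ≤ m)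
    (hrel : ∀ k : Fin m, ∫ u : ℝ, P.eval (I * u) * (trigMode m k (I * u) * ω (I * u)) = 0)
    (x : ℂ) :
    P.coeff m * gustafson m (fun s => (x - s) * ω s) = P.eval x * gustafson m ω := by
  have hω' : ∀ (j : ℕ) (k : Fin m), Integrable fun u : ℝ =>
      (I * u : ℂ) ^ j * (trigMode m k (I * u) * ((x - I * u) * ω (I * u))) := by
    intro j k
    refine (((hω j k).const_mul x).sub (hω (j + 1) k)).congr (Eventually.of_forall fun u => ?_)
    simp only [Pi.sub_apply]; ring
  have h1 := pairConst_mul_gustafson_momentAt hω x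
  have h2 := pairConst_mul_gustafson_momentAt (ω := fun s => (x - s) * ω s) hω' x
  set t : Fin (m + 1) → ℂ := fun j => (Polynomial.taylor x P).coeff j with ht
  have hexp : ∀ s : ℂ, P.eval s = ∑ j : Fin (m + 1), t j * (s - x) ^ (j : ℕ) := by
    intro s
    have e : P.eval s = (Polynomial.taylor x P).eval (s - x) := by
      rw [Polynomial.taylor_eval]; congr 1; ring
    rw [e, Polynomial.eval_eq_sum_range' (n := m + 1)
      (by rw [Polynomial.natDegree_taylor]; omega), Finset.sum_range]
  have hlin := det_succ_of_linear_relation (fun j k => momentAt m ω x j k) t (fun k => by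
    have := hrel k
    simp_rw [hexp, Finset.sum_mul, mul_assoc] at this
    have hintg : ∀ j : Fin (m + 1), Integrable fun u : ℝ =>
        t j * ((I * u - x : ℂ) ^ (j : ℕ) * (trigMode m k (I * u) * ω (I * u))) := fun j =>
      (integrable_momentAt (fun i => hω i k) x (j : ℕ)).const_mul (t j)
    rw [integral_finsetSum _ fun j _ => hintg j] at this
    simp_rw [integral_const_mul] at this
    exact this)
  have hm : t (Fin.last m) = P.coeff m := by
    simp only [ht, Fin.val_last]
    rw [Polynomial.taylor_coeff]
    have hdeg : (Polynomial.hasseDeriv m P).natDegree = 0 := by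
      have := Polynomial.natDegree_hasseDeriv_le P m
      omega
    rw [Polynomial.eq_C_of_natDegree_eq_zero hdeg, Polynomial.eval_C, Polynomial.hasseDeriv_coeff]
    simp
  have h0 : t 0 = P.eval x := by simp [ht]
  have hneg : (Matrix.of fun j k : Fin m => momentAt m (fun s => (x - s) * ω s) x j k).det =
      (-1) ^ m * (Matrix.of fun j k : Fin m => momentAt m ω x j.succ k).det := by
    have e : (Matrix.of fun j k : Fin m => momentAt m (fun s => (x - s) * ω s) x j k) =
        -(Matrix.of fun j k : Fin m => momentAt m ω x j.succ k) := by
      ext j k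
      simp only [Matrix.of_apply, Matrix.neg_apply, momentAt, ← integral_neg]
      congr 1; ext u
      rw [Fin.val_succ, pow_succ]; ring
    rw [e, Matrix.det_neg, Fintype.card_fin]
  rw [hneg] at h2
  rw [hm, h0] at hlin
  refine mul_left_cancel₀ (pairConst_ne_zero m) ?_
  rw [mul_left_comm, h2, mul_left_comm (pairConst m), h1]
  have hsq : ((-1 : ℂ)) ^ m * (-1) ^ m = 1 := by rw [← mul_pow]; simp
  simp only [Fin.val_castSucc] at hlin
  calc P.coeff m * (m.factorial * ((-1) ^ m * (Matrix.of fun j k : Fin m =>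
        momentAt m ω x j.succ k).det))
      = m.factorial * (-1) ^ m * (P.coeff m * (Matrix.of fun j k : Fin m =>
        momentAt m ω x j.succ k).det) := by ring
    _ = m.factorial * ((-1) ^ m * (-1) ^ m) * P.eval x *
        (Matrix.of fun j k : Fin m => momentAt m ω x j k).det := by rw [hlin]; ring
    _ = _ := by rw [hsq]; ring

theorem trigMode_one_add (m k : ℕ) (s : ℂ) :
    trigMode m k (1 + s) = (-1) ^ (m + 1) * trigMode m k s := by
  have h : (-1 : ℂ) ^ (m + 1) = cexp (I * Real.pi * ((m : ℂ) - 1 - 2 * k)) := by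
    have e : I * Real.pi * ((m : ℂ) - 1 - 2 * k) =
        ((m + 1 : ℕ) : ℂ) * (Real.pi * I) + ((-(k + 1 : ℤ) : ℤ) : ℂ) * (2 * Real.pi * I) := by
      push_cast; ring
    rw [e, Complex.exp_add, Complex.exp_nat_mul, Complex.exp_pi_mul_I,
      Complex.exp_int_mul_two_pi_mul_I, mul_one]
  rw [h, trigMode, trigMode, ← Complex.exp_add]
  congr 1; ring

/-- Moving the contour by one unit. -/
theorem integral_trigMode_shift {m : ℕ} {a b q : ℝ} (ha : a < 0) (hb : 1 < b) {Ω : ℂ → ℂ}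
    (hΩ : StripDecay a b q Ω) (hd : DifferentiableOn ℂ Ω (vstrip a b))
    (hq : 0 < q - Real.pi * ((m : ℝ) - 1)) (k : Fin m) :
    ∫ u : ℝ, trigMode m k (I * u) * Ω (I * u) =
      ∫ u : ℝ, (-1) ^ (m + 1) * (trigMode m k (I * u) * Ω (1 + I * u)) := by
  have hdec := (StripDecay.trigMode a b k.2).mul hΩ
  have hdd : DifferentiableOn ℂ (fun s : ℂ => trigMode m k s * Ω s) (vstrip a b) := by
    unfold trigMode
    exact DifferentiableOn.mul (by fun_prop) hd
  have := integral_vertical_eq hdd (hdec.exp_bound (by linarith)) (c₁ := 0) (c₂ := 1) ha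
    (by linarith) (by linarith) hb
  simp only [ofReal_zero, zero_add, ofReal_one] at this
  rw [this]
  congr 1; ext u
  rw [trigMode_one_add]; ring

theorem integral_trigMode_annihilated {m : ℕ} {a b q : ℝ} (ha : a < 0) (hb : 1 < b)
    {ω Ω : ℂ → ℂ} (hΩ : StripDecay a b q Ω) (hd : DifferentiableOn ℂ Ω (vstrip a b))
    (hq : 0 < q - Real.pi * ((m : ℝ) - 1)) (P Q : Polynomial ℂ)
    (hP : ∀ u : ℝ, Ω (I * u) = P.eval (I * u) * ω (I * u))
    (hQ : ∀ u : ℝ, Ω (1 + I * u) = Q.eval (I * u) * ω (I * u))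
    (hω : ∀ (j : ℕ) (k : Fin m), Integrable fun u : ℝ =>
      (I * u : ℂ) ^ j * (trigMode m k (I * u) * ω (I * u))) (k : Fin m) :
    ∫ u : ℝ, (P - Polynomial.C ((-1) ^ (m + 1)) * Q).eval (I * u) *
      (trigMode m k (I * u) * ω (I * u)) = 0 := by
  have hintg : ∀ R : Polynomial ℂ, Integrable fun u : ℝ => R.eval (I * u) *
      (trigMode m k (I * u) * ω (I * u)) := by
    intro R
    simp_rw [Polynomial.eval_eq_sum_range, Finset.sum_mul, mul_assoc]
    exact integrable_finsetSum _ fun i _ => (hω i k).const_mul _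
  have h := integral_trigMode_shift ha hb hΩ hd hq k
  simp_rw [hP, hQ] at h
  have e : ∀ u : ℝ, (P - Polynomial.C ((-1) ^ (m + 1)) * Q).eval (I * u) *
      (trigMode m k (I * u) * ω (I * u)) =
      P.eval (I * u) * (trigMode m k (I * u) * ω (I * u)) -
        (-1) ^ (m + 1) * (Q.eval (I * u) * (trigMode m k (I * u) * ω (I * u))) := by
    intro u; simp only [Polynomial.eval_sub, Polynomial.eval_mul, Polynomial.eval_C]; ring
  simp_rw [e]
  rw [integral_sub (hintg P) ((hintg Q).const_mul _), sub_eq_zero]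
  refine Eq.trans (by congr 1; ext u; ring) (h.trans (by congr 1; ext u; ring))

theorem gustafson_congr {m : ℕ} {ω ω' : ℂ → ℂ} (h : ∀ u : ℝ, ω (I * u) = ω' (I * u)) :
    gustafson m ω = gustafson m ω' := by
  simp only [gustafson, h]

theorem StripDecay.mono {a b q r : ℝ} {f : ℂ → ℂ} (hf : StripDecay a b q f) (h : r ≤ q) :
    StripDecay a b r f := by
  intro a' b' ha hb
  obtain ⟨C, p, hC, hb⟩ := hf a' b' ha hb
  refine ⟨C, p, hC, fun z h1 h2 => (hb z h1 h2).trans ?_⟩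
  gcongr

theorem StripDecay.prod_gamma_sub {m : ℕ} {a b : ℝ} {α : Fin m → ℂ} (h : ∀ l, b ≤ (α l).re) :
    StripDecay a b (m * (Real.pi / 2)) (fun s => ∏ l, Gamma (α l - s)) := by
  simpa using StripDecay.prod Finset.univ fun l _ => StripDecay.gamma_sub (a := a) (h l)

theorem StripDecay.prod_gamma_add {m : ℕ} {a b : ℝ} {β : Fin m → ℂ} (h : ∀ l, -(β l).re ≤ a) :
    StripDecay a b (m * (Real.pi / 2)) (fun s => ∏ l, Gamma (β l + s)) := by
  simpa using StripDecay.prod Finset.univ fun l _ => StripDecay.gamma_add (b := b) (h l)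

theorem differentiableOn_prod_gamma_sub {m : ℕ} {a b : ℝ} {α : Fin m → ℂ}
    (h : ∀ l, b ≤ (α l).re) :
    DifferentiableOn ℂ (fun s => ∏ l, Gamma (α l - s)) (vstrip a b) :=
  DifferentiableOn.fun_finsetProd fun l _ => differentiableOn_gamma_sub (h l)

theorem differentiableOn_prod_gamma_add {m : ℕ} {a b : ℝ} {β : Fin m → ℂ}
    (h : ∀ l, -(β l).re ≤ a) :
    DifferentiableOn ℂ (fun s => ∏ l, Gamma (β l + s)) (vstrip a b) :=
  DifferentiableOn.fun_finsetProd fun l _ => differentiableOn_gamma_add (h l)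

theorem prod_C_sub_X {m : ℕ} (α : Fin m → ℂ) :
    ∏ l, (Polynomial.C (α l) - Polynomial.X) =
      Polynomial.C ((-1) ^ m) * ∏ l, (Polynomial.X - Polynomial.C (α l)) := by
  have : ∀ l, Polynomial.C (α l) - Polynomial.X =
      Polynomial.C (-1) * (Polynomial.X - Polynomial.C (α l)) := by
    intro l; simp
  simp_rw [this, Finset.prod_mul_distrib]
  simp

theorem prod_C_add_X {m : ℕ} (β : Fin m → ℂ) :
    ∏ l, (Polynomial.C (β l) + Polynomial.X) = ∏ l, (Polynomial.X - Polynomial.C (-β l)) := by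
  refine Finset.prod_congr rfl fun l _ => ?_
  simp [add_comm]

theorem natDegree_prod_X_sub_C_sub_le {m : ℕ} (α β : Fin (m + 1) → ℂ) :
    (∏ l, (Polynomial.X - Polynomial.C (α l)) -
      ∏ l, (Polynomial.X - Polynomial.C (β l))).natDegree ≤ m := by
  have hm : ∀ γ : Fin (m + 1) → ℂ, (∏ l, (Polynomial.X - Polynomial.C (γ l))).Monic := fun γ =>
    Polynomial.monic_prod_of_monic _ _ fun l _ => Polynomial.monic_X_sub_C _
  have hd : ∀ γ : Fin (m + 1) → ℂ,
      (∏ l, (Polynomial.X - Polynomial.C (γ l))).degree = ((m + 1 : ℕ) : WithBot ℕ) := by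
    intro γ
    rw [Polynomial.degree_eq_natDegree (hm γ).ne_zero]
    simp
  have h := Polynomial.degree_sub_lt_left ((hd α).trans (hd β).symm) (hm α).ne_zero
    ((hm α).leadingCoeff.trans (hm β).leadingCoeff.symm)
  rw [hd] at h
  by_cases h0 : (∏ l, (Polynomial.X - Polynomial.C (α l)) -
      ∏ l, (Polynomial.X - Polynomial.C (β l))) = 0
  · rw [h0]; simp
  · rw [Polynomial.degree_eq_natDegree h0] at h
    exact Nat.lt_succ_iff.1 (WithBot.coe_lt_coe.1 h)

theorem coeff_prod_X_sub_C {m : ℕ} (α : Fin (m + 1) → ℂ) :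
    (∏ l, (Polynomial.X - Polynomial.C (α l))).coeff m = -∑ l, α l := by
  have := Polynomial.prod_X_sub_C_coeff_card_pred (Finset.univ : Finset (Fin (m + 1))) α (by simp)
  simpa using this

/-- The contiguous relation of the Gustafson integral in one of its parameters. -/
theorem gustafson_contiguous {m : ℕ} {a : ℂ} {α : Fin m → ℂ} {β : Fin (m + 1) → ℂ} {r : ℝ}
    (hr : 0 < r) (ha : r ≤ a.re) (hα : ∀ l, r ≤ (α l).re) (hβ : ∀ k, 0 < (β k).re) :
    (a + ∑ l, α l + ∑ k, β k) * gustafson m (fun s => Gamma (a + 1 - s) *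
        (∏ l, Gamma (α l - s)) * ∏ k, Gamma (β k + s)) =
      (∏ k, (a + β k)) * gustafson m (fun s => Gamma (a - s) *
        (∏ l, Gamma (α l - s)) * ∏ k, Gamma (β k + s)) := by
  obtain ⟨ε, hε, hεβ⟩ := exists_pos_le_forall hβ
  set ω : ℂ → ℂ := fun s => Gamma (a - s) * (∏ l, Gamma (α l - s)) * ∏ k, Gamma (β k + s) with hω
  set Ω : ℂ → ℂ := fun s => Gamma (a + 1 - s) * (∏ l, Gamma (α l + 1 - s)) *
    ∏ k, Gamma (β k + s) with hΩ
  have hβε : ∀ k, -(β k).re ≤ -ε := fun k => by linarith [hεβ k]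
  have hαr : ∀ l, r + 1 ≤ (α l + 1).re := fun l => by simpa using hα l
  have har : r + 1 ≤ (a + 1).re := by simpa using ha
  have hdecω : StripDecay (-ε) r (Real.pi / 2 + m * (Real.pi / 2) +
      ((m + 1 : ℕ) : ℝ) * (Real.pi / 2)) ω :=
    ((StripDecay.gamma_sub ha).mul (StripDecay.prod_gamma_sub hα)).mul
      (StripDecay.prod_gamma_add hβε)
  have hdω : DifferentiableOn ℂ ω (vstrip (-ε) r) :=
    ((differentiableOn_gamma_sub ha).mul (differentiableOn_prod_gamma_sub hα)).mul
      (differentiableOn_prod_gamma_add hβε)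
  have hdecΩ : StripDecay (-ε) (r + 1) (Real.pi / 2 + m * (Real.pi / 2) +
      ((m + 1 : ℕ) : ℝ) * (Real.pi / 2)) Ω :=
    ((StripDecay.gamma_sub har).mul (StripDecay.prod_gamma_sub hαr)).mul
      (StripDecay.prod_gamma_add hβε)
  have hdΩ : DifferentiableOn ℂ Ω (vstrip (-ε) (r + 1)) :=
    ((differentiableOn_gamma_sub har).mul (differentiableOn_prod_gamma_sub hαr)).mul
      (differentiableOn_prod_gamma_add hβε)
  have hq : 0 < Real.pi / 2 + m * (Real.pi / 2) + ((m + 1 : ℕ) : ℝ) * (Real.pi / 2) -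
      Real.pi * ((m : ℝ) - 1) := by
    push_cast; nlinarith [Real.pi_pos]
  have hintg := integrable_moment (m := m) (by linarith) hr hdecω hdω hq
  have hsub : ∀ (z : ℂ) (u : ℝ), r ≤ z.re →
      Gamma (z + 1 - I * u) = (z - I * u) * Gamma (z - I * u) := by
    intro z u hz
    rw [← Gamma_add_one (z - I * u) (fun h => by have := congrArg re h; simp at this; linarith)]
    congr 1; ring
  set α' : Fin (m + 1) → ℂ := Fin.cons a α with hα'
  have hP : ∀ u : ℝ, Ω (I * u) =
      (∏ l, (Polynomial.C (α' l) - Polynomial.X)).eval (I * u) * ω (I * u) := by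
    intro u
    rw [Polynomial.eval_prod, Fin.prod_univ_succ]
    simp only [hΩ, hω, Polynomial.eval_sub, Polynomial.eval_C,
      Polynomial.eval_X, hα', Fin.cons_zero, Fin.cons_succ]
    rw [hsub a u ha, Finset.prod_congr rfl fun l _ => hsub (α l) u (hα l),
      Finset.prod_mul_distrib]
    ring
  have hQ : ∀ u : ℝ, Ω (1 + I * u) =
      (∏ k, (Polynomial.C (β k) + Polynomial.X)).eval (I * u) * ω (I * u) := by
    intro u
    have e1 : ∀ z : ℂ, z + 1 - (1 + I * u) = z - I * u := fun z => by ring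
    have e2 : ∀ k, Gamma (β k + (1 + I * u)) = (β k + I * u) * Gamma (β k + I * u) := by
      intro k
      rw [← Gamma_add_one (β k + I * u)
        (fun h => by have := congrArg re h; simp at this; linarith [hβ k])]
      congr 1; ring
    simp only [hΩ, hω, Polynomial.eval_prod, Polynomial.eval_add, Polynomial.eval_C,
      Polynomial.eval_X, e1, e2, Finset.prod_mul_distrib]
    ring
  have hann := integral_trigMode_annihilated (by linarith) (by linarith) hdecΩ hdΩ hq _ _ hP hQ hintg
  have hfac : ∏ l, (Polynomial.C (α' l) - Polynomial.X) - Polynomial.C ((-1) ^ (m + 1)) *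
      ∏ k, (Polynomial.C (β k) + Polynomial.X) = Polynomial.C ((-1) ^ (m + 1)) *
      (∏ l, (Polynomial.X - Polynomial.C (α' l)) - ∏ k, (Polynomial.X - Polynomial.C (-β k))) := by
    rw [prod_C_sub_X, prod_C_add_X]; ring
  have hdeg : (∏ l, (Polynomial.C (α' l) - Polynomial.X) - Polynomial.C ((-1) ^ (m + 1)) *
      ∏ k, (Polynomial.C (β k) + Polynomial.X)).natDegree ≤ m := by
    rw [hfac]
    exact (Polynomial.natDegree_C_mul_le _ _).trans (natDegree_prod_X_sub_C_sub_le _ _)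
  have hmain := gustafson_mul_linear hintg _ hdeg hann a
  have hcoeff : (∏ l, (Polynomial.C (α' l) - Polynomial.X) - Polynomial.C ((-1) ^ (m + 1)) *
      ∏ k, (Polynomial.C (β k) + Polynomial.X)).coeff m =
      (-1) ^ m * (a + ∑ l, α l + ∑ k, β k) := by
    rw [hfac, Polynomial.coeff_C_mul, Polynomial.coeff_sub, coeff_prod_X_sub_C, coeff_prod_X_sub_C,
      Finset.sum_neg_distrib, Fin.sum_univ_succ]
    simp only [hα', Fin.cons_zero, Fin.cons_succ]
    ring
  have heval : (∏ l, (Polynomial.C (α' l) - Polynomial.X) - Polynomial.C ((-1) ^ (m + 1)) *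
      ∏ k, (Polynomial.C (β k) + Polynomial.X)).eval a = (-1) ^ m * ∏ k, (a + β k) := by
    rw [Polynomial.eval_sub, Polynomial.eval_prod, Fin.prod_univ_succ]
    simp only [hα', Fin.cons_zero, Polynomial.eval_mul, Polynomial.eval_sub, Polynomial.eval_C,
      Polynomial.eval_X, Polynomial.eval_prod, Polynomial.eval_add, sub_self, zero_mul, zero_sub,
      add_comm (β _) a]
    ring
  have hne : ((-1 : ℂ)) ^ m ≠ 0 := pow_ne_zero _ (by norm_num)
  rw [hcoeff, heval, mul_assoc, mul_assoc] at hmain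
  rw [← mul_left_cancel₀ hne hmain]
  congr 1
  refine gustafson_congr fun u => ?_
  simp only [hω]
  rw [hsub a u ha]; ring

/-- Ratio asymptotics of the Gamma function along the integers. -/
theorem tendsto_Gamma_add_nat {x : ℂ} (hx : -1 < x.re) :
    Tendsto (fun n : ℕ => Gamma (x + (n + 2 : ℕ)) / ((n : ℂ) ^ (x + 1) * n.factorial)) atTop
      (𝓝 1) := by
  have hre : 0 < (x + 1).re := by simp; linarith
  have hΓ : Gamma (x + 1) ≠ 0 := Gamma_ne_zero_of_re_pos hre
  have hprod : ∀ n : ℕ, Gamma (x + 1 + (n : ℂ)) =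
      (∏ j ∈ Finset.range n, (x + 1 + j)) * Gamma (x + 1) := by
    intro n
    induction n with
    | zero => simp
    | succ n ih =>
      have : x + 1 + (n : ℂ) ≠ 0 := fun h => by
        have := congrArg re h
        simp at this
        linarith [(Nat.cast_nonneg n : (0 : ℝ) ≤ n)]
      rw [Finset.prod_range_succ, Nat.cast_succ, ← add_assoc, Gamma_add_one _ this, ih]
      ring
  have h := ((GammaSeq_tendsto_Gamma (x + 1)).div_const (Gamma (x + 1))).inv₀
    (by rw [div_self hΓ]; exact one_ne_zero)
  rw [div_self hΓ, inv_one] at h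
  refine h.congr fun n => ?_
  have e : x + ((n + 2 : ℕ) : ℂ) = x + 1 + ((n + 1 : ℕ) : ℂ) := by push_cast; ring
  rw [e, hprod, GammaSeq]
  field_simp

theorem norm_Gamma_le_Gamma_re {z : ℂ} (hz : 0 < z.re) : ‖Gamma z‖ ≤ ‖Gamma (z.re : ℂ)‖ := by
  have hΓ : Gamma (z.re : ℂ) = ((∫ p : ℝ, Real.exp (p * z.re) * Real.exp (-Real.exp p) : ℝ) : ℂ) := by
    rw [Gamma_eq_integral_exp (by simpa using hz), ← integral_complex_ofReal]
    congr 1; ext p; push_cast; rfl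
  rw [hΓ, norm_real, Gamma_eq_integral_exp hz]
  refine (norm_integral_le_integral_norm _).trans ((le_of_eq ?_).trans (le_abs_self _))
  congr 1; ext p
  rw [norm_mul, Complex.norm_exp, Complex.norm_exp]
  simp [exp_ofReal_re]

/-- Gustafson's multiple Mellin–Barnes integral (the multidimensional first Barnes lemma). -/
theorem gustafson_first {m : ℕ} {a : ℂ} {α : Fin m → ℂ} (hinj : Function.Injective α)
    {β : Fin (m + 1) → ℂ} {r : ℝ} (hr : 0 < r) (ha : r ≤ a.re)
    (hα : ∀ l, r ≤ (α l).re) (hα' : ∀ l, (α l).re < r + 1 / 2) (hβ : ∀ k, 0 < (β k).re) :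
    gustafson m (fun s => Gamma (a - s) * (∏ l, Gamma (α l - s)) * ∏ k, Gamma (β k + s)) *
        Gamma (a + ∑ l, α l + ∑ k, β k) =
      m.factorial * (2 * Real.pi) ^ m * (∏ k, Gamma (a + β k)) *
        ∏ l, ∏ k, Gamma (β k + α l) := by
  set A : ℂ := a + ∑ l, α l + ∑ k, β k with hA
  have hAre : 0 < A.re := by
    simp only [hA, add_re, re_sum]
    have h1 : 0 ≤ ∑ l, (α l).re := Finset.sum_nonneg fun l _ => hr.le.trans (hα l)
    have h2 : 0 ≤ ∑ k, (β k).re := Finset.sum_nonneg fun k _ => (hβ k).le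
    linarith
  set J : ℂ → ℂ := fun a => gustafson m (fun s => Gamma (a - s) * (∏ l, Gamma (α l - s)) *
    ∏ k, Gamma (β k + s)) with hJ
  have hne : ∀ (z : ℂ) (N : ℕ), 0 < z.re → z + N ≠ 0 := fun z N hz h => by
    have := congrArg re h
    simp at this
    linarith [(Nat.cast_nonneg N : (0 : ℝ) ≤ N)]
  have hΓ0 : ∀ (z : ℂ) (N : ℕ), 0 < z.re → Gamma (z + N) ≠ 0 := fun z N hz =>
    Gamma_ne_zero_of_re_pos (by simp; linarith [(Nat.cast_nonneg N : (0 : ℝ) ≤ N)])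
  have hiter : ∀ N : ℕ, J (a + N) * Gamma (A + N) * ∏ k, Gamma (a + β k) =
      J a * Gamma A * ∏ k, Gamma (a + β k + N) := by
    intro N
    induction N with
    | zero => simp
    | succ N ih =>
      have hc := gustafson_contiguous (m := m) (a := a + N) hr
        (by simp; linarith [(Nat.cast_nonneg N : (0 : ℝ) ≤ N)]) hα hβ
      have e1 : a + N + ∑ l, α l + ∑ k, β k = A + N := by rw [hA]; ring
      rw [e1] at hc
      have hc' : (A + N) * J (a + N + 1) = (∏ k, (a + N + β k)) * J (a + N) := hc
      rw [Nat.cast_succ, ← add_assoc, ← add_assoc, Gamma_add_one _ (hne A N hAre)]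
      have e2 : ∀ k, Gamma (a + β k + (N + 1)) = (a + N + β k) * Gamma (a + β k + N) := by
        intro k
        rw [← add_assoc, Gamma_add_one _ (hne _ N (by simp; linarith [hβ k]))]
        congr 1; ring
      simp_rw [e2, Finset.prod_mul_distrib]
      calc J (a + N + 1) * ((A + N) * Gamma (A + N)) * ∏ k, Gamma (a + β k)
          = ((A + N) * J (a + N + 1)) * (Gamma (A + N) * ∏ k, Gamma (a + β k)) := by ring
        _ = (∏ k, (a + N + β k)) * (J (a + N) * Gamma (A + N) * ∏ k, Gamma (a + β k)) := by
          rw [hc']; ring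
        _ = _ := by rw [ih]; ring
  obtain ⟨ε, hε, hεβ⟩ := exists_pos_le_forall hβ
  have hβε : ∀ k, -(β k).re ≤ -ε := fun k => by linarith [hεβ k]
  set B : Fin m → ℂ := fun l => ∏ k, Gamma (β k + α l) with hB
  have hB0 : ∀ l, B l ≠ 0 := fun l => Finset.prod_ne_zero_iff.2 fun k _ =>
    Gamma_ne_zero_of_re_pos (by simp; linarith [hβ k, hα l])
  have haN : ∀ n : ℕ, r + 1 ≤ (a + (n + 2 : ℕ)).re := fun n => by
    simp; linarith [(Nat.cast_nonneg n : (0 : ℝ) ≤ n)]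
  -- asymptotics of the Gamma factors
  set E : ℕ → ℂ → ℂ := fun n x => (n : ℂ) ^ (x + 1) * n.factorial with hE
  have hE0 : ∀ n : ℕ, 0 < n → ∀ x, E n x ≠ 0 := fun n hn x =>
    mul_ne_zero (by simp [cpow_eq_zero_iff, hn.ne']) (by exact_mod_cast n.factorial_ne_zero)
  set h : ℂ → ℕ → ℂ := fun x n => Gamma (x + (n + 2 : ℕ)) / E n x with hh
  have hlim : ∀ x : ℂ, -1 < x.re → Tendsto (h x) atTop (𝓝 1) := fun x hx =>
    tendsto_Gamma_add_nat hx
  have hasy : Tendsto (fun n : ℕ => J (a + (n + 2 : ℕ)) /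
      (m.factorial * ∏ l, (2 * Real.pi * (Gamma (a - α l + (n + 2 : ℕ)) * B l)))) atTop (𝓝 1) := by
    have key := tendsto_gustafson hinj (a := -ε) (b := r + 1) (c := r + 2 / 3)
      (q := ((m + 1 : ℕ) : ℝ) * (Real.pi / 2)) (by linarith) (by linarith) (by linarith)
      (fun l => hr.trans_le (hα l)) (fun l => by linarith [hα' l]) (fun l => by linarith [hα l])
      (by push_cast; nlinarith [Real.pi_pos]) (L := (atTop : Filter ℕ))
      (G := fun n s => Gamma (a + (n + 2 : ℕ) - s) * ∏ k, Gamma (β k + s))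
      (fun n => (differentiableOn_gamma_sub (haN n)).mul (differentiableOn_prod_gamma_add hβε))
      (fun n => ((StripDecay.gamma_sub (haN n)).mul (StripDecay.prod_gamma_add hβε)).mono
        (by linarith [Real.pi_pos]))
      (fun n l => mul_ne_zero (Gamma_ne_zero_of_re_pos (by
        have := haN n; rw [sub_re]; linarith [hα' l])) (hB0 l))
      (g := fun n => ‖Gamma (((a.re - (r + 2 / 3) : ℝ) : ℂ) + (n + 2 : ℕ))‖)
      (fun n => norm_nonneg _) (G₀ := fun s => ∏ k, Gamma (β k + s))
      (StripDecay.prod_gamma_add hβε) (differentiableOn_prod_gamma_add hβε)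
      (fun n u => by
        rw [norm_mul]
        gcongr
        refine (norm_Gamma_le_Gamma_re ?_).trans (le_of_eq ?_)
        · have := haN n
          simp only [sub_re, add_re] at this ⊢
          simp at this ⊢
          linarith
        · congr 2
          apply Complex.ext
          · simp; ring
          · simp)
      (fun l => by
        have h1 := hlim ((a.re - (r + 2 / 3) : ℝ) : ℂ) (by rw [ofReal_re]; linarith)
        have h2 := hlim (a - α l) (by rw [sub_re]; linarith [hα' l])
        have h3 := (h1.norm.div h2.norm (by simp)).div_const ‖B l‖
        have h4 : Tendsto (fun n : ℕ => (n : ℝ) ^ (-(r + 2 / 3 - (α l).re))) atTop (𝓝 0) :=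
          (tendsto_rpow_neg_atTop (by linarith [hα' l])).comp tendsto_natCast_atTop_atTop
        have h5 := h3.mul h4
        rw [mul_zero] at h5
        refine h5.congr' ?_
        filter_upwards [eventually_gt_atTop 0] with n hn
        have hn' : (0 : ℝ) < n := by exact_mod_cast hn
        have e1 : a + ((n + 2 : ℕ) : ℂ) - α l = a - α l + ((n + 2 : ℕ) : ℂ) := by ring
        have e2 : ‖E n ((a.re - (r + 2 / 3) : ℝ) : ℂ)‖ =
            ‖E n (a - α l)‖ * (n : ℝ) ^ (-(r + 2 / 3 - (α l).re)) := by
          simp only [hE, norm_mul, norm_natCast_cpow_of_pos hn]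
          rw [mul_right_comm, ← Real.rpow_add hn']
          congr 2
          simp; ring
        have hF : ‖E n (a - α l)‖ ≠ 0 := norm_ne_zero_iff.2 (hE0 n hn _)
        have hp : (n : ℝ) ^ (-(r + 2 / 3 - (α l).re)) ≠ 0 := (Real.rpow_pos_of_pos hn' _).ne'
        have hb : ‖B l‖ ≠ 0 := norm_ne_zero_iff.2 (hB0 l)
        have hg : ‖Gamma (a - α l + ((n + 2 : ℕ) : ℂ))‖ ≠ 0 := norm_ne_zero_iff.2
          (Gamma_ne_zero_of_re_pos (by
            have := haN n; rw [add_re, sub_re]; rw [add_re] at this; linarith [hα' l]))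
        simp only [hh, Pi.div_apply, norm_div, e1, norm_mul]
        rw [e2]
        change _ = _ / (_ * ‖B l‖)
        field_simp)
    refine key.congr fun n => ?_
    have e : ∀ l, Gamma (a + (n + 2 : ℕ) - α l) = Gamma (a - α l + (n + 2 : ℕ)) := fun l => by
      congr 1; ring
    simp only [e]
    congr 1
    refine gustafson_congr fun u => ?_
    ring
  have hD : Tendsto (fun n => h A n * (∏ l, h (a - α l) n) / ∏ k, h (a + β k) n) atTop (𝓝 1) := by
    have h1 : Tendsto (fun n => ∏ l, h (a - α l) n) atTop (𝓝 (∏ _l : Fin m, 1)) :=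
      tendsto_finsetProd _ fun l _ => hlim _ (by rw [sub_re]; linarith [hα' l])
    have h2 : Tendsto (fun n => ∏ k, h (a + β k) n) atTop (𝓝 (∏ _k : Fin (m + 1), 1)) :=
      tendsto_finsetProd _ fun k _ => hlim _ (by rw [add_re]; linarith [hβ k])
    have := ((hlim A (by linarith)).mul h1).div h2 (by simp)
    simp only [Finset.prod_const_one, mul_one, div_one] at this
    exact this
  have hfin := (hasy.mul hD).mul_const
    ((m.factorial : ℂ) * (2 * Real.pi) ^ m * (∏ k, Gamma (a + β k)) * ∏ l, B l)
  rw [one_mul, one_mul] at hfin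
  refine tendsto_nhds_unique (Tendsto.congr' ?_ tendsto_const_nhds) hfin
  filter_upwards [eventually_gt_atTop 0] with n hn
  have hEE : E n A * ∏ l, E n (a - α l) = ∏ k, E n (a + β k) := by
    have hn' : (n : ℂ) ≠ 0 := by exact_mod_cast hn.ne'
    simp only [hE, Finset.prod_mul_distrib, cpow_def_of_ne_zero hn', ← Complex.exp_sum,
      Finset.prod_const, Finset.card_univ, Fintype.card_fin]
    rw [mul_mul_mul_comm, ← Complex.exp_add, ← pow_succ']
    congr 2
    simp only [← Finset.mul_sum, ← mul_add]
    congr 1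
    simp only [Finset.sum_add_distrib, Finset.sum_sub_distrib, Finset.sum_const, Finset.card_univ,
      Fintype.card_fin, nsmul_eq_mul, hA]
    push_cast; ring
  have hΓE : ∀ x, Gamma (x + (n + 2 : ℕ)) = h x n * E n x := fun x => by
    simp only [hh]; rw [div_mul_cancel₀ _ (hE0 n hn x)]
  have hit := hiter (n + 2)
  have hk0 : ∏ k, Gamma (a + β k + (n + 2 : ℕ)) ≠ 0 := Finset.prod_ne_zero_iff.2 fun k _ =>
    hΓ0 _ _ (by simp; linarith [hβ k])
  have hD' : h A n * (∏ l, h (a - α l) n) / ∏ k, h (a + β k) n =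
      Gamma (A + (n + 2 : ℕ)) * (∏ l, Gamma (a - α l + (n + 2 : ℕ))) /
        ∏ k, Gamma (a + β k + (n + 2 : ℕ)) := by
    have hEk : ∏ k, E n (a + β k) ≠ 0 := Finset.prod_ne_zero_iff.2 fun k _ => hE0 n hn _
    simp only [hΓE, Finset.prod_mul_distrib]
    rw [mul_mul_mul_comm, hEE, mul_div_mul_right _ _ hEk]
  have hprod : ∏ l, (2 * Real.pi * (Gamma (a - α l + (n + 2 : ℕ)) * B l)) =
      (2 * Real.pi : ℂ) ^ m * ((∏ l, Gamma (a - α l + (n + 2 : ℕ))) * ∏ l, B l) := by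
    simp only [Finset.prod_mul_distrib, Finset.prod_const, Finset.card_univ, Fintype.card_fin,
      mul_pow]
  rw [hD', hprod]
  have hl0 : ∏ l, Gamma (a - α l + (n + 2 : ℕ)) ≠ 0 := Finset.prod_ne_zero_iff.2 fun l _ =>
    Gamma_ne_zero_of_re_pos (by
      have := haN n; rw [add_re, sub_re]; rw [add_re] at this; linarith [hα' l])
  have hBl : ∏ l, B l ≠ 0 := Finset.prod_ne_zero_iff.2 fun l _ => hB0 l
  have hfac : (m.factorial : ℂ) ≠ 0 := by exact_mod_cast m.factorial_ne_zero
  have hpi : ((2 : ℂ) * Real.pi) ^ m ≠ 0 := pow_ne_zero _ (by simp [Real.pi_ne_zero])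
  change J a * Gamma A = _
  rw [← div_eq_iff hk0] at hit
  rw [← hit]
  generalize ∏ l, Gamma (a - α l + (n + 2 : ℕ)) = p at hl0 ⊢
  generalize ∏ k, Gamma (a + β k + (n + 2 : ℕ)) = p' at hk0 ⊢
  generalize (2 * Real.pi : ℂ) ^ m = c at hpi ⊢
  field_simp

theorem hasDerivAt_det {n : ℕ} {M M' : ℝ → Matrix (Fin n) (Fin n) ℂ} {z : ℝ}
    (h : ∀ i j, HasDerivAt (fun z => M z i j) (M' z i j) z) :
    HasDerivAt (fun z => (M z).det)
      (∑ i, ((M z).updateCol i fun j => M' z j i).det) z := by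
  have h1 : HasDerivAt (fun z => ∑ σ : Equiv.Perm (Fin n), (Equiv.Perm.sign σ : ℂ) *
      ∏ i, M z (σ i) i) (∑ σ : Equiv.Perm (Fin n), (Equiv.Perm.sign σ : ℂ) *
        ∑ i, (∏ j ∈ Finset.univ.erase i, M z (σ j) j) • M' z (σ i) i) z := by
    refine HasDerivAt.fun_sum fun σ _ => HasDerivAt.const_mul _ ?_
    exact HasDerivAt.fun_finsetProd fun i _ => h (σ i) i
  have e : (fun z => (M z).det) = fun z => ∑ σ : Equiv.Perm (Fin n), (Equiv.Perm.sign σ : ℂ) *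
      ∏ i, M z (σ i) i := by
    ext z; rw [Matrix.det_apply']
  rw [e]
  convert h1 using 1
  simp_rw [Finset.mul_sum]
  rw [Finset.sum_comm]
  refine Finset.sum_congr rfl fun i _ => ?_
  rw [Matrix.det_apply']
  refine Finset.sum_congr rfl fun σ _ => ?_
  congr 1
  rw [← Finset.prod_erase_mul _ _ (Finset.mem_univ i), Matrix.updateCol_self, smul_eq_mul]
  congr 1
  refine Finset.prod_congr rfl fun j hj => ?_
  rw [Matrix.updateCol_ne (Finset.ne_of_mem_erase hj)]

/-- The determinant of a family of shifted rows subject to a linear recurrence satisfies a scalar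
differential equation. -/
theorem hasDerivAt_det_of_recurrence {k : ℕ} {f : ℝ → ℕ → Fin (k + 1) → ℂ} {z : ℝ}
    (hf : ∀ j i, HasDerivAt (fun z => f z j i) (-f z (j + 1) i) z) {t : ℕ → ℂ}
    (ht : ∀ i, ∑ j ∈ Finset.range (k + 2), t j * f z j i = 0) (htk : t (k + 1) ≠ 0) :
    HasDerivAt (fun z => (Matrix.of fun j i : Fin (k + 1) => f z j i).det)
      (t k / t (k + 1) * (Matrix.of fun j i : Fin (k + 1) => f z j i).det) z := by
  have h := hasDerivAt_det (M := fun z => Matrix.of fun i j : Fin (k + 1) => f z j i)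
    (M' := fun z => Matrix.of fun i j : Fin (k + 1) => -f z (j + 1) i) (z := z)
    fun i j => hf j i
  have e : (fun z => (Matrix.of fun j i : Fin (k + 1) => f z j i).det) =
      fun z => (Matrix.of fun i j : Fin (k + 1) => f z j i).det := by
    ext z; rw [← Matrix.det_transpose]; rfl
  have e' := congrFun e z
  rw [e]
  rw [e']
  convert h using 1
  set N : Matrix (Fin (k + 1)) (Fin (k + 1)) ℂ := Matrix.of fun i j => f z j i with hN
  have hlast : (fun j => (Matrix.of fun i j : Fin (k + 1) => -f z (j + 1) i) j (Fin.last k)) =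
      fun i => ∑ j : Fin (k + 1), (t j / t (k + 1)) • N i j := by
    ext i
    have := ht i
    rw [Finset.sum_range_succ, Finset.sum_range] at this
    simp only [Matrix.of_apply, Fin.val_last, hN, smul_eq_mul, div_mul_eq_mul_div,
      ← Finset.sum_div]
    rw [eq_div_iff htk, ← sub_eq_zero, ← neg_eq_zero, ← this]
    ring
  rw [Fin.sum_univ_castSucc, Finset.sum_eq_zero, zero_add, hlast]
  · rw [Matrix.det_updateCol_sum N (Fin.last k) fun j => t j / t (k + 1)]
    simp
  · intro i _
    have : (N.updateCol i.castSucc fun j =>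
        (Matrix.of fun i j : Fin (k + 1) => -f z (j + 1) i) j i.castSucc) =
        N.updateCol i.castSucc ((-1 : ℂ) • fun j => N j i.succ) := by
      congr 1; ext j; simp [hN]
    rw [this, Matrix.det_updateCol_smul, Matrix.det_updateCol_eq_zero, mul_zero]
    exact (Fin.castSucc_lt_succ).ne'

theorem hasDerivAt_moment {m : ℕ} {h : ℂ → ℂ} {k : Fin m}
    (hω : ∀ j : ℕ, Integrable fun u : ℝ => (I * u : ℂ) ^ j * (trigMode m k (I * u) * h (I * u)))
    (z : ℝ) (j : ℕ) :
    HasDerivAt (fun z : ℝ => moment m (fun s => cexp (-(z * s)) * h s) j k)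
      (-moment m (fun s => cexp (-(z * s)) * h s) (j + 1) k) z := by
  have hexp : ∀ z u : ℝ, ‖cexp (-(z * (I * u)))‖ = 1 := fun z u => by
    rw [show -((z : ℂ) * (I * u)) = ((-(z * u) : ℝ) : ℂ) * I by push_cast; ring,
      norm_exp_ofReal_mul_I]
  have hcont : ∀ z : ℝ, AEStronglyMeasurable (fun u : ℝ => cexp (-(z * (I * u)))) := fun z =>
    (by fun_prop : Continuous fun u : ℝ => cexp (-(z * (I * u)))).aestronglyMeasurable
  have hintg : ∀ (z : ℝ) (j : ℕ), Integrable fun u : ℝ =>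
      (I * u : ℂ) ^ j * (trigMode m k (I * u) * (cexp (-(z * (I * u))) * h (I * u))) := by
    intro z j
    refine ((hω j).bdd_mul (hcont z) (c := 1)
      (Eventually.of_forall fun u => (hexp z u).le)).congr (Eventually.of_forall fun u => ?_)
    beta_reduce; ring
  have := hasDerivAt_integral_of_dominated_loc_of_deriv_le (μ := volume) (𝕜 := ℝ)
    (F := fun (z : ℝ) (u : ℝ) =>
      (I * u : ℂ) ^ j * (trigMode m k (I * u) * (cexp (-(z * (I * u))) * h (I * u))))
    (F' := fun (z : ℝ) (u : ℝ) =>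
      -((I * u : ℂ) ^ (j + 1) * (trigMode m k (I * u) * (cexp (-(z * (I * u))) * h (I * u)))))
    (x₀ := z) (s := Set.univ)
    (bound := fun u : ℝ => ‖(I * u : ℂ) ^ (j + 1) * (trigMode m k (I * u) * h (I * u))‖)
    univ_mem (Eventually.of_forall fun z => (hintg z j).aestronglyMeasurable) (hintg z j)
    (hintg z (j + 1)).neg.aestronglyMeasurable
    (Eventually.of_forall fun u z _ => by
      rw [norm_neg, norm_mul, norm_mul, norm_mul, norm_mul, norm_mul, hexp, one_mul])
    (hω (j + 1)).norm
    (Eventually.of_forall fun u z _ => by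
      have h1 : HasDerivAt (fun z : ℝ => cexp (-(z * (I * u))))
          (cexp (-(z * (I * u))) * -(1 * (I * u))) z :=
        (((hasDerivAt_id z).ofReal_comp.mul_const (I * u : ℂ)).fun_neg).cexp
      refine (((h1.mul_const (h (I * u))).const_mul (trigMode m k (I * u))).const_mul
        ((I * u : ℂ) ^ j)).congr_deriv ?_
      rw [pow_succ]; ring)
  have := this.2
  rw [integral_neg] at this
  exact this

theorem gustafson_second_ode {k : ℕ} {α : Fin (k + 1) → ℂ} {τ : Fin k → ℂ} {r : ℝ} (hr : 0 < r)
    (hα : ∀ l, r ≤ (α l).re) (hτ : ∀ c, 0 < (τ c).re) (z : ℝ) :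
    HasDerivAt (fun z : ℝ => gustafson (k + 1) (fun s => cexp (-(z * s)) *
        ((∏ l, Gamma (α l - s)) * ∏ c, Gamma (τ c + s))))
      ((-∑ l, α l + cexp (-z)) * gustafson (k + 1) (fun s => cexp (-(z * s)) *
        ((∏ l, Gamma (α l - s)) * ∏ c, Gamma (τ c + s)))) z := by
  obtain ⟨ε, hε, hετ⟩ := exists_pos_le_forall hτ
  have hτε : ∀ c, -(τ c).re ≤ -ε := fun c => by linarith [hετ c]
  have hαr : ∀ l, r + 1 ≤ (α l + 1).re := fun l => by simpa using hα l
  set h : ℂ → ℂ := fun s => (∏ l, Gamma (α l - s)) * ∏ c, Gamma (τ c + s) with hh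
  set H : ℂ → ℂ := fun s => cexp (-(z * s)) *
    ((∏ l, Gamma (α l + 1 - s)) * ∏ c, Gamma (τ c + s)) with hH
  have hdech : StripDecay (-ε) r (((k + 1 : ℕ) : ℝ) * (Real.pi / 2) + k * (Real.pi / 2)) h :=
    (StripDecay.prod_gamma_sub hα).mul (StripDecay.prod_gamma_add hτε)
  have hdh : DifferentiableOn ℂ h (vstrip (-ε) r) :=
    (differentiableOn_prod_gamma_sub hα).mul (differentiableOn_prod_gamma_add hτε)
  have hdecH : StripDecay (-ε) (r + 1)
      (0 + (((k + 1 : ℕ) : ℝ) * (Real.pi / 2) + k * (Real.pi / 2))) H :=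
    (StripDecay.exp_real_mul _ _ z).mul
      ((StripDecay.prod_gamma_sub hαr).mul (StripDecay.prod_gamma_add hτε))
  have hdH : DifferentiableOn ℂ H (vstrip (-ε) (r + 1)) :=
    DifferentiableOn.mul (by fun_prop)
      ((differentiableOn_prod_gamma_sub hαr).mul (differentiableOn_prod_gamma_add hτε))
  have hq : 0 < ((k + 1 : ℕ) : ℝ) * (Real.pi / 2) + k * (Real.pi / 2) -
      Real.pi * (((k + 1 : ℕ) : ℝ) - 1) := by
    push_cast; nlinarith [Real.pi_pos]
  have hintg := integrable_moment (m := k + 1) (by linarith) hr hdech hdh hq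
  have hintz : ∀ z : ℝ, ∀ (j : ℕ) (i : Fin (k + 1)), Integrable fun u : ℝ =>
      (I * u : ℂ) ^ j * (trigMode (k + 1) i (I * u) * (cexp (-(z * (I * u))) * h (I * u))) :=
    fun z => integrable_moment (m := k + 1) (ω := fun s => cexp (-(z * s)) * h s)
      (by linarith) hr ((StripDecay.exp_real_mul _ _ z).mul hdech)
      (DifferentiableOn.mul (by fun_prop) hdh) (by rw [zero_add]; exact hq)
  have hP : ∀ u : ℝ, H (I * u) = (∏ l, (Polynomial.C (α l) - Polynomial.X)).eval (I * u) *
      (cexp (-(z * (I * u))) * h (I * u)) := by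
    intro u
    have e : ∀ l, Gamma (α l + 1 - I * u) = (α l - I * u) * Gamma (α l - I * u) := by
      intro l
      rw [← Gamma_add_one (α l - I * u)
        (fun h => by have := congrArg re h; simp at this; linarith [hα l])]
      congr 1; ring
    simp only [hH, hh, e, Finset.prod_mul_distrib, Polynomial.eval_prod, Polynomial.eval_sub,
      Polynomial.eval_C, Polynomial.eval_X]
    ring
  have hQ : ∀ u : ℝ, H (1 + I * u) = (Polynomial.C (cexp (-z)) *
      ∏ c, (Polynomial.C (τ c) + Polynomial.X)).eval (I * u) *
      (cexp (-(z * (I * u))) * h (I * u)) := by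
    intro u
    have e1 : ∀ z : ℂ, z + 1 - (1 + I * u) = z - I * u := fun z => by ring
    have e2 : ∀ c, Gamma (τ c + (1 + I * u)) = (τ c + I * u) * Gamma (τ c + I * u) := by
      intro c
      rw [← Gamma_add_one (τ c + I * u)
        (fun h => by have := congrArg re h; simp at this; linarith [hτ c])]
      congr 1; ring
    have e3 : cexp (-(z * (1 + I * u))) = cexp (-z) * cexp (-(z * (I * u))) := by
      rw [← Complex.exp_add]; congr 1; ring
    simp only [hH, hh, e1, e2, e3, Finset.prod_mul_distrib, Polynomial.eval_prod,
      Polynomial.eval_mul, Polynomial.eval_add, Polynomial.eval_C, Polynomial.eval_X]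
    ring
  have hann := integral_trigMode_annihilated (m := k + 1) (ω := fun s => cexp (-(z * s)) * h s)
    (by linarith) (by linarith) hdecH hdH (by rw [zero_add]; exact hq) _ _ hP hQ (hintz z)
  set R : Polynomial ℂ := ∏ l, (Polynomial.C (α l) - Polynomial.X) -
    Polynomial.C ((-1) ^ (k + 1 + 1)) *
      (Polynomial.C (cexp (-z)) * ∏ c, (Polynomial.C (τ c) + Polynomial.X)) with hR
  have hdegα : (∏ l, (Polynomial.X - Polynomial.C (α l))).natDegree = k + 1 := by simp
  have hdegτ : (∏ c, (Polynomial.X - Polynomial.C (-τ c))).natDegree = k := by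
    rw [Polynomial.natDegree_finsetProd_X_sub_C_eq_card]; simp
  have hmα : (∏ l, (Polynomial.X - Polynomial.C (α l))).Monic :=
    Polynomial.monic_prod_of_monic _ _ fun l _ => Polynomial.monic_X_sub_C _
  have hmτ : (∏ c, (Polynomial.X - Polynomial.C (-τ c))).Monic :=
    Polynomial.monic_prod_of_monic _ _ fun l _ => Polynomial.monic_X_sub_C _
  have hR' : R = Polynomial.C ((-1) ^ (k + 1)) * (∏ l, (Polynomial.X - Polynomial.C (α l)) +
      Polynomial.C (cexp (-z)) * ∏ c, (Polynomial.X - Polynomial.C (-τ c))) := by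
    rw [hR, prod_C_sub_X, prod_C_add_X, pow_succ _ (k + 1)]
    simp only [map_mul, Polynomial.C_neg, Polynomial.C_1]
    ring
  have hRdeg : R.natDegree ≤ k + 1 := by
    rw [hR']
    refine (Polynomial.natDegree_C_mul_le _ _).trans
      ((Polynomial.natDegree_add_le _ _).trans (max_le hdegα.le ?_))
    refine (Polynomial.natDegree_C_mul_le _ _).trans ?_
    omega
  have hRtop : R.coeff (k + 1) = (-1) ^ (k + 1) := by
    rw [hR', Polynomial.coeff_C_mul, Polynomial.coeff_add, Polynomial.coeff_C_mul,
      Polynomial.coeff_eq_zero_of_natDegree_lt (p := ∏ c, (Polynomial.X - Polynomial.C (-τ c)))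
        (by omega)]
    have := hmα.coeff_natDegree
    rw [hdegα] at this
    rw [this]; ring
  have hRk : R.coeff k = (-1) ^ (k + 1) * (-∑ l, α l + cexp (-z)) := by
    rw [hR', Polynomial.coeff_C_mul, Polynomial.coeff_add, Polynomial.coeff_C_mul,
      coeff_prod_X_sub_C]
    have := hmτ.coeff_natDegree
    rw [hdegτ] at this
    rw [this]; ring
  have hne : ((-1 : ℂ)) ^ (k + 1) ≠ 0 := pow_ne_zero _ (by norm_num)
  have hode := hasDerivAt_det_of_recurrence (k := k)
    (f := fun (z : ℝ) j i => moment (k + 1) (fun s => cexp (-(z * s)) * h s) j i) (z := z)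
    (fun j i => hasDerivAt_moment (fun j => hintg j i) z j) (t := fun j => R.coeff j)
    (fun i => by
      have := hann i
      simp_rw [Polynomial.eval_eq_sum_range' (Nat.lt_succ_of_le hRdeg), Finset.sum_mul,
        mul_assoc] at this
      have hj : ∀ j : ℕ, Integrable fun u : ℝ => R.coeff j * ((I * u : ℂ) ^ j *
          (trigMode (k + 1) i (I * u) * (cexp (-(z * (I * u))) * h (I * u)))) := fun j =>
        (hintz z j i).const_mul (R.coeff j)
      rw [integral_finsetSum _ fun j _ => hj j] at this
      simp_rw [integral_const_mul] at this
      exact this)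
    (by rw [hRtop]; exact hne)
  have hI : ∀ z : ℝ, gustafson (k + 1) (fun s => cexp (-(z * s)) * h s) =
      (pairConst (k + 1))⁻¹ * (k + 1).factorial * (Matrix.of fun j i : Fin (k + 1) =>
        moment (k + 1) (fun s => cexp (-(z * s)) * h s) j i).det := by
    intro z
    have := pairConst_mul_gustafson (m := k + 1) (ω := fun s => cexp (-(z * s)) * h s)
      (fun j i => hintz z j i)
    rw [mul_assoc, ← this, inv_mul_cancel_left₀ (pairConst_ne_zero _)]
  refine ((hode.const_mul ((pairConst (k + 1))⁻¹ * ((k + 1).factorial : ℂ))).congr_deriv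
    ?_).congr_of_eventuallyEq (Eventually.of_forall hI)
  rw [hI, hRtop, hRk, mul_div_cancel_left₀ _ hne]
  ring

/-- A multiple Mellin–Barnes integral with an exponential weight. -/
theorem gustafson_second {k : ℕ} {α : Fin (k + 1) → ℂ} (hinj : Function.Injective α)
    {τ : Fin k → ℂ} {r : ℝ} (hr : 0 < r) (hα : ∀ l, r ≤ (α l).re)
    (hα' : ∀ l, (α l).re < r + 1 / 2) (hτ : ∀ c, 0 < (τ c).re) (z : ℝ) :
    gustafson (k + 1) (fun s => cexp (-(z * s)) *
        ((∏ l, Gamma (α l - s)) * ∏ c, Gamma (τ c + s))) =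
      (k + 1).factorial * (2 * Real.pi) ^ (k + 1) * (∏ l, ∏ c, Gamma (τ c + α l)) *
        (cexp (-(z * ∑ l, α l)) * cexp (-Real.exp (-z))) := by
  obtain ⟨ε, hε, hετ⟩ := exists_pos_le_forall hτ
  have hτε : ∀ c, -(τ c).re ≤ -ε := fun c => by linarith [hετ c]
  set J : ℝ → ℂ := fun z => gustafson (k + 1) (fun s => cexp (-(z * s)) *
        ((∏ l, Gamma (α l - s)) * ∏ c, Gamma (τ c + s))) with hJ
  set B : Fin (k + 1) → ℂ := fun l => ∏ c, Gamma (τ c + α l) with hB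
  have hB0 : ∀ l, B l ≠ 0 := fun l => Finset.prod_ne_zero_iff.2 fun c _ =>
    Gamma_ne_zero_of_re_pos (by simp; linarith [hτ c, hα l])
  set F : ℝ → ℂ := fun z => J z * (cexp (z * ∑ l, α l) * cexp (Real.exp (-z))) with hF
  have hderiv : ∀ z, HasDerivAt F 0 z := by
    intro z
    have h1 : HasDerivAt (fun z : ℝ => cexp (z * ∑ l, α l))
        (cexp (z * ∑ l, α l) * (1 * ∑ l, α l)) z :=
      ((hasDerivAt_id z).ofReal_comp.mul_const (∑ l, α l)).cexp
    have h2 : HasDerivAt (fun z : ℝ => cexp (Real.exp (-z)))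
        (cexp (Real.exp (-z)) * ((Real.exp (-z) * -1 : ℝ) : ℂ)) z :=
      ((hasDerivAt_id z).fun_neg.exp).ofReal_comp.cexp
    refine ((gustafson_second_ode hr hα hτ z).mul (h1.mul h2)).congr_deriv ?_
    simp only [Pi.mul_apply]
    push_cast
    ring
  have hconst : ∀ z w, F z = F w := is_const_of_deriv_eq_zero
    (fun z => (hderiv z).differentiableAt) fun z => (hderiv z).deriv
  have hasy : Tendsto (fun z : ℝ => J z / ((k + 1).factorial *
      ∏ l, (2 * Real.pi * (cexp (-(z * α l)) * B l)))) atTop (𝓝 1) := by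
    have key := tendsto_gustafson hinj (a := -ε) (b := r + 1) (c := r + 2 / 3)
      (q := 0 + k * (Real.pi / 2)) (by linarith) (by linarith) (by linarith)
      (fun l => hr.trans_le (hα l)) (fun l => by linarith [hα' l]) (fun l => by linarith [hα l])
      (by push_cast; nlinarith [Real.pi_pos]) (L := (atTop : Filter ℝ))
      (G := fun z s => cexp (-(z * s)) * ∏ c, Gamma (τ c + s))
      (fun z => DifferentiableOn.mul (by fun_prop) (differentiableOn_prod_gamma_add hτε))
      (fun z => (StripDecay.exp_real_mul _ _ z).mul (StripDecay.prod_gamma_add hτε))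
      (fun z l => mul_ne_zero (exp_ne_zero _) (hB0 l))
      (g := fun z => Real.exp (-(z * (r + 2 / 3))))
      (fun z => (Real.exp_pos _).le) (G₀ := fun s => ∏ c, Gamma (τ c + s))
      ((StripDecay.prod_gamma_add hτε).mono (by linarith)) (differentiableOn_prod_gamma_add hτε)
      (fun z u => by
        rw [norm_mul, Complex.norm_exp]
        refine le_of_eq ?_
        congr 2
        simp)
      (fun l => by
        have h1 : Tendsto (fun z : ℝ => Real.exp (-((r + 2 / 3 - (α l).re) * z)) / ‖B l‖) atTop
            (𝓝 (0 / ‖B l‖)) :=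
          ((Real.tendsto_exp_neg_atTop_nhds_zero.comp
            (tendsto_id.const_mul_atTop (by linarith [hα' l])))).div_const _
        rw [zero_div] at h1
        refine h1.congr fun z => ?_
        have : Real.exp (-(z * (r + 2 / 3))) =
            Real.exp (-((r + 2 / 3 - (α l).re) * z)) * ‖cexp (-(z * α l))‖ := by
          rw [Complex.norm_exp, ← Real.exp_add]; congr 1; simp; ring
        rw [norm_mul, this]
        change _ = _ / (_ * ‖B l‖)
        have h2 : ‖cexp (-(z * α l))‖ ≠ 0 := norm_ne_zero_iff.2 (exp_ne_zero _)
        have h3 : ‖B l‖ ≠ 0 := norm_ne_zero_iff.2 (hB0 l)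
        field_simp)
    refine key.congr fun z => ?_
    congr 1
    refine gustafson_congr fun u => ?_
    ring
  have hBl : ∏ l, B l ≠ 0 := Finset.prod_ne_zero_iff.2 fun l _ => hB0 l
  have hfac : ((k + 1).factorial : ℂ) ≠ 0 := by exact_mod_cast (k + 1).factorial_ne_zero
  have hpi : ((2 : ℂ) * Real.pi) ^ (k + 1) ≠ 0 := pow_ne_zero _ (by simp [Real.pi_ne_zero])
  have hlim1 : Tendsto (fun z : ℝ => cexp (Real.exp (-z))) atTop (𝓝 1) := by
    have h1 : Tendsto (fun z : ℝ => ((Real.exp (-z) : ℝ) : ℂ)) atTop (𝓝 ((0 : ℝ) : ℂ)) :=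
      (continuous_ofReal.tendsto 0).comp Real.tendsto_exp_neg_atTop_nhds_zero
    have := (Complex.continuous_exp.tendsto _).comp h1
    rw [ofReal_zero, Complex.exp_zero] at this
    exact this
  have hfin := (hasy.mul hlim1).mul_const
    (((k + 1).factorial : ℂ) * (2 * Real.pi) ^ (k + 1) * ∏ l, B l)
  rw [one_mul, one_mul] at hfin
  have hFz : F z = ((k + 1).factorial : ℂ) * (2 * Real.pi) ^ (k + 1) * ∏ l, B l := by
    refine tendsto_nhds_unique (Tendsto.congr (fun w => ?_) tendsto_const_nhds) hfin
    rw [hconst z w]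
    have hprod : ∏ l, (2 * Real.pi * (cexp (-(w * α l)) * B l)) =
        (2 * Real.pi : ℂ) ^ (k + 1) * (cexp (-(w * ∑ l, α l)) * ∏ l, B l) := by
      simp only [Finset.prod_mul_distrib, Finset.prod_const, Finset.card_univ, Fintype.card_fin,
        mul_pow, ← Complex.exp_sum, Finset.mul_sum, Finset.sum_neg_distrib]
    rw [hprod, hF, Complex.exp_neg]
    have := exp_ne_zero (w * ∑ l, α l)
    generalize (2 * Real.pi : ℂ) ^ (k + 1) = c at hpi ⊢
    beta_reduce
    field_simp
  have h1 := exp_ne_zero (z * ∑ l, α l)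
  have h2 := exp_ne_zero (Real.exp (-z) : ℂ)
  change J z = _ * (∏ l, B l) * _
  rw [← hFz, hF, Complex.exp_neg, Complex.exp_neg]
  beta_reduce
  field_simp

/-- The Mellin–Barnes kernel `∏_{a,b} Γ(i u_a - θ_b) ∏_{a ≠ b} Γ(i (u_a - u_b))⁻¹`. -/
def mbKernel {n k : ℕ} (θ : Fin k → ℂ) (u : Fin n → ℝ) : ℂ :=
  (∏ a, ∏ b, Gamma (I * u a - θ b)) * sklyanin (fun a => I * u a)

def mbIntegrand {n : ℕ} (F : (Fin n → ℝ) → (Fin n → ℝ) → ℂ) (θ : Fin (n + 1) → ℂ)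
    (x : Fin (n + 1) → ℝ) (u : Fin n → ℝ) : ℂ :=
  cexp ((∑ b, θ b - ∑ a, I * u a) * x (Fin.last n)) * F u (Fin.init x) * mbKernel θ u

def mbCoeff (n : ℕ) : ℂ := ((n.factorial : ℂ) * (2 * Real.pi) ^ n)⁻¹

/-- The Mellin–Barnes step on the imaginary contour, for parameters in the left half plane. -/
def mb {n : ℕ} (F : (Fin n → ℝ) → (Fin n → ℝ) → ℂ) (θ : Fin (n + 1) → ℂ)
    (x : Fin (n + 1) → ℝ) : ℂ :=
  mbCoeff n * ∫ u, mbIntegrand F θ x u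

/-- The Whittaker function for `ħ = 1`, with all contour heights differing by one. -/
def phi : (n : ℕ) → (Fin n → ℝ) → (Fin n → ℝ) → ℂ
  | 0, _, _ => 1
  | n + 1, y, x => cexp (∑ a, x a) * mb (phi n) (fun b => I * y b - 1) x

theorem norm_sklyanin_le {n : ℕ} (u : Fin n → ℝ) :
    ‖sklyanin (fun a => I * u a)‖ ≤
      (2 * (1 + ‖u‖)) ^ (n * n) * Real.exp (Real.pi / 2 * pairDist u u) := by
  have h1 : ∀ a b, ‖(Gamma (I * u a - I * u b))⁻¹‖ ≤
      2 * (1 + ‖u‖) * Real.exp (Real.pi / 2 * |u a - u b|) := by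
    intro a b
    have := norm_Gamma_I_mul_inv_le (u a - u b)
    rw [show (I * ((u a - u b : ℝ) : ℂ)) = I * u a - I * u b by push_cast; ring] at this
    refine this.trans ?_
    gcongr
    have h2 : |u a - u b| ≤ |u a| + |u b| := abs_sub _ _
    have h3 := norm_le_pi_norm u a
    have h4 := norm_le_pi_norm u b
    rw [Real.norm_eq_abs] at h3 h4
    linarith
  have h0 : ∀ a b, 1 ≤ 2 * (1 + ‖u‖) * Real.exp (Real.pi / 2 * |u a - u b|) := by
    intro a b
    have h2 : 1 ≤ Real.exp (Real.pi / 2 * |u a - u b|) := Real.one_le_exp (by positivity)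
    nlinarith [norm_nonneg u]
  have e : (2 * (1 + ‖u‖)) ^ (n * n) * Real.exp (Real.pi / 2 * pairDist u u) =
      ∏ a, ∏ b, (2 * (1 + ‖u‖) * Real.exp (Real.pi / 2 * |u a - u b|)) := by
    simp only [Finset.prod_mul_distrib, Finset.prod_const, Finset.card_univ, Fintype.card_fin,
      ← Real.exp_sum, pairDist, Finset.mul_sum, ← pow_mul, mul_pow]
  rw [e, sklyanin, norm_prod]
  refine Finset.prod_le_prod (fun _ _ => norm_nonneg _) fun a _ => ?_
  rw [norm_prod, Finset.prod_filter]
  refine Finset.prod_le_prod (fun b _ => ?_) fun b _ => ?_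
  · split_ifs <;> simp
  · split_ifs
    · exact h1 a b
    · exact h0 a b

/-- The fundamental estimate of the Mellin–Barnes kernel. -/
theorem exists_mbKernel_bound {n k d : ℕ} (hd : d ≤ 1) (hk : k = n + d) {r : ℝ} (hr : 0 < r)
    (A : ℝ) (M : ℕ) :
    ∃ C > 0, ∃ p : ℕ, ∀ (θ : Fin k → ℂ) (u : Fin n → ℝ), (∀ b, r ≤ -(θ b).re) →
      (∀ b, -(θ b).re ≤ A) →
      ‖mbKernel θ u‖ * Real.exp (-(Real.pi / 4 * pairDist u u)) ≤
        C * (1 + ‖fun b => (θ b).im‖) ^ p *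
          Real.exp (-(Real.pi / 4 * pairDist (fun b => (θ b).im) fun b => (θ b).im)) *
          ((1 + ‖u‖) ^ M)⁻¹ := by
  obtain ⟨A', hA'⟩ := exists_nat_ge A
  obtain ⟨C₁, hC₁, hΓ⟩ := exists_norm_Gamma_le hr A'
  set q := A' * (n * k) + n * n + M with hq
  obtain ⟨C₂, hC₂, hexp⟩ := exists_one_add_pow_mul_exp_le q
    (δ := Real.pi / 2) (by positivity)
  refine ⟨C₁ ^ (n * k) * 2 ^ (n * n) * C₂, by positivity, A' * (n * k) + q,
    fun θ u h1 h2 => ?_⟩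
  set w : Fin k → ℝ := fun b => (θ b).im with hw
  have hprod : ‖∏ a, ∏ b, Gamma (I * u a - θ b)‖ ≤
      C₁ ^ (n * k) * ((1 + ‖u‖) * (1 + ‖w‖)) ^ (A' * (n * k)) *
        Real.exp (-(Real.pi / 2 * pairDist u w)) := by
    have e : C₁ ^ (n * k) * ((1 + ‖u‖) * (1 + ‖w‖)) ^ (A' * (n * k)) *
        Real.exp (-(Real.pi / 2 * pairDist u w)) =
        ∏ a, ∏ b, (C₁ * ((1 + ‖u‖) * (1 + ‖w‖)) ^ A' *
          Real.exp (-(Real.pi / 2 * |u a - w b|))) := by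
      simp only [Finset.prod_mul_distrib, Finset.prod_const, Finset.card_univ, Fintype.card_fin,
        ← Real.exp_sum, pairDist, Finset.mul_sum, ← pow_mul, Finset.sum_neg_distrib, mul_comm k n,
        mul_assoc]
    rw [e, norm_prod]
    refine Finset.prod_le_prod (fun _ _ => norm_nonneg _) fun a _ => ?_
    rw [norm_prod]
    refine Finset.prod_le_prod (fun _ _ => norm_nonneg _) fun b _ => ?_
    have him : (I * u a - θ b).im = u a - w b := by simp [hw]
    have hre : (I * u a - θ b).re = -(θ b).re := by simp
    refine (hΓ (I * u a - θ b) (by rw [hre]; exact h1 b)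
      (by rw [hre]; exact (h2 b).trans hA')).trans ?_
    rw [him]
    gcongr
    have h2 : |u a - w b| ≤ |u a| + |w b| := abs_sub _ _
    have h3 := norm_le_pi_norm u a
    have h4 := norm_le_pi_norm w b
    rw [Real.norm_eq_abs] at h3 h4
    nlinarith [norm_nonneg u, norm_nonneg w]
  have hen := pairDist_energy hd hk u w
  set t := max (‖u‖ - ‖w‖) 0 with ht
  have ht0 : 0 ≤ t := le_max_right _ _
  have hut : 1 + ‖u‖ ≤ (1 + ‖w‖) * (1 + t) := by
    have : ‖u‖ - ‖w‖ ≤ t := le_max_left _ _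
    nlinarith [norm_nonneg w]
  have hmain : ‖mbKernel θ u‖ * Real.exp (-(Real.pi / 4 * pairDist u u)) * (1 + ‖u‖) ^ M ≤
      C₁ ^ (n * k) * 2 ^ (n * n) * C₂ * (1 + ‖w‖) ^ (A' * (n * k) + q) *
        Real.exp (-(Real.pi / 4 * pairDist w w)) := by
    calc ‖mbKernel θ u‖ * Real.exp (-(Real.pi / 4 * pairDist u u)) * (1 + ‖u‖) ^ M
        ≤ (C₁ ^ (n * k) * ((1 + ‖u‖) * (1 + ‖w‖)) ^ (A' * (n * k)) *
            Real.exp (-(Real.pi / 2 * pairDist u w))) *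
          ((2 * (1 + ‖u‖)) ^ (n * n) * Real.exp (Real.pi / 2 * pairDist u u)) *
          Real.exp (-(Real.pi / 4 * pairDist u u)) * (1 + ‖u‖) ^ M := by
          rw [mbKernel, norm_mul]
          gcongr
          exact norm_sklyanin_le u
      _ = C₁ ^ (n * k) * 2 ^ (n * n) * (1 + ‖w‖) ^ (A' * (n * k)) * (1 + ‖u‖) ^ q *
          Real.exp (-(Real.pi / 2 * pairDist u w) + Real.pi / 2 * pairDist u u +
            -(Real.pi / 4 * pairDist u u)) := by
          rw [Real.exp_add, Real.exp_add, hq, pow_add, pow_add, mul_pow, mul_pow]; ring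
      _ ≤ C₁ ^ (n * k) * 2 ^ (n * n) * (1 + ‖w‖) ^ (A' * (n * k)) * ((1 + ‖w‖) * (1 + t)) ^ q *
          Real.exp (-(Real.pi / 2 * t) + -(Real.pi / 4 * pairDist w w)) := by
          have : -(Real.pi / 2 * pairDist u w) + Real.pi / 2 * pairDist u u +
              -(Real.pi / 4 * pairDist u u) ≤
              -(Real.pi / 2 * t) + -(Real.pi / 4 * pairDist w w) := by
            nlinarith [Real.pi_pos]
          have := Real.exp_le_exp.2 this
          have := pow_le_pow_left₀ (by positivity) hut q
          gcongr
      _ = C₁ ^ (n * k) * 2 ^ (n * n) * ((1 + t) ^ q * Real.exp (-(Real.pi / 2 * t))) *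
          (1 + ‖w‖) ^ (A' * (n * k) + q) * Real.exp (-(Real.pi / 4 * pairDist w w)) := by
          rw [Real.exp_add, mul_pow, pow_add]; ring
      _ ≤ _ := by
          gcongr
          exact hexp t ht0
  rw [← div_eq_mul_inv, le_div_iff₀ (by positivity)]
  exact hmain

theorem integrable_one_add_norm_pow_inv (n : ℕ) :
    Integrable fun u : Fin n → ℝ => ((1 + ‖u‖) ^ (n + 1))⁻¹ := by
  have := integrable_one_add_norm (E := Fin n → ℝ) (μ := volume) (r := ((n + 1 : ℕ) : ℝ))
    (by simp)
  refine this.congr (Eventually.of_forall fun u => ?_)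
  beta_reduce
  rw [Real.rpow_neg (by positivity), Real.rpow_natCast]

theorem measurable_Gamma : Measurable Gamma := by
  have h := Complex.differentiable_one_div_Gamma.continuous.measurable.inv
  convert h using 1
  ext s; simp

theorem measurable_sklyanin {n : ℕ} : Measurable (sklyanin : (Fin n → ℂ) → ℂ) := by
  refine Finset.measurable_fun_prod _ fun a _ => Finset.measurable_fun_prod _ fun b _ => ?_
  exact (measurable_Gamma.comp (by fun_prop)).inv

theorem measurable_mbKernel {n k : ℕ} :
    Measurable fun p : (Fin k → ℂ) × (Fin n → ℝ) => mbKernel p.1 p.2 := by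
  refine Measurable.mul (Finset.measurable_fun_prod _ fun a _ =>
    Finset.measurable_fun_prod _ fun b _ => measurable_Gamma.comp (by fun_prop))
    (measurable_sklyanin.comp (by fun_prop))

theorem measurable_mbIntegrand {n : ℕ} {F : (Fin n → ℝ) → (Fin n → ℝ) → ℂ}
    (hF : Measurable fun p : (Fin n → ℝ) × (Fin n → ℝ) => F p.1 p.2) :
    Measurable fun p : ((Fin (n + 1) → ℂ) × (Fin (n + 1) → ℝ)) × (Fin n → ℝ) =>
      mbIntegrand F p.1.1 p.1.2 p.2 := by
  refine Measurable.mul (Measurable.mul (by fun_prop) ?_) ?_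
  · exact hF.comp (g := fun p : (Fin n → ℝ) × (Fin n → ℝ) => F p.1 p.2)
      (f := fun p : ((Fin (n + 1) → ℂ) × (Fin (n + 1) → ℝ)) × (Fin n → ℝ) =>
        (p.2, Fin.init p.1.2)) (by unfold Fin.init; fun_prop)
  · exact measurable_mbKernel.comp (f := fun p : ((Fin (n + 1) → ℂ) × (Fin (n + 1) → ℝ)) ×
      (Fin n → ℝ) => (p.1.1, p.2)) (by fun_prop)

theorem measurable_mb {n : ℕ} {F : (Fin n → ℝ) → (Fin n → ℝ) → ℂ}
    (hF : Measurable fun p : (Fin n → ℝ) × (Fin n → ℝ) => F p.1 p.2) :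
    Measurable fun p : (Fin (n + 1) → ℂ) × (Fin (n + 1) → ℝ) => mb F p.1 p.2 :=
  ((measurable_mbIntegrand hF).stronglyMeasurable.integral_prod_right).measurable.const_mul _

theorem measurable_phi (n : ℕ) :
    Measurable fun p : (Fin n → ℝ) × (Fin n → ℝ) => phi n p.1 p.2 := by
  induction n with
  | zero => exact measurable_const
  | succ n ih =>
    refine Measurable.mul (by fun_prop) ?_
    exact (measurable_mb ih).comp (f := fun p : (Fin (n + 1) → ℝ) × (Fin (n + 1) → ℝ) =>
      ((fun b => I * (p.1 b : ℂ) - 1 : Fin (n + 1) → ℂ), p.2)) (by fun_prop)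

/-- Rapid decay off the diagonal of a family of functions, with exponential growth in `x`. -/
def HasMbBound {n : ℕ} (F : (Fin n → ℝ) → (Fin n → ℝ) → ℂ) : Prop :=
  ∃ C > 0, ∃ K ≥ 0, ∃ p : ℕ, ∀ y x, ‖F y x‖ ≤
    C * Real.exp (K * ‖x‖) * (1 + ‖y‖) ^ p * Real.exp (-(Real.pi / 4 * pairDist y y))

theorem norm_init_le {n : ℕ} (x : Fin (n + 1) → ℝ) : ‖(Fin.init x : Fin n → ℝ)‖ ≤ ‖x‖ :=
  (pi_norm_le_iff_of_nonneg (norm_nonneg _)).2 fun i => norm_le_pi_norm x i.castSucc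

theorem HasMbBound.mbIntegrand {n : ℕ} {F : (Fin n → ℝ) → (Fin n → ℝ) → ℂ} (hF : HasMbBound F)
    {r : ℝ} (hr : 0 < r) (A : ℝ) :
    ∃ C > 0, ∃ K ≥ 0, ∃ p : ℕ, ∀ (θ : Fin (n + 1) → ℂ) x u, (∀ b, r ≤ -(θ b).re) →
      (∀ b, -(θ b).re ≤ A) → ‖mbIntegrand F θ x u‖ ≤
        C * Real.exp (K * ‖x‖) * (1 + ‖fun b => (θ b).im‖) ^ p *
          Real.exp (-(Real.pi / 4 * pairDist (fun b => (θ b).im) fun b => (θ b).im)) *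
          ((1 + ‖u‖) ^ (n + 1))⁻¹ := by
  obtain ⟨C₁, hC₁, K, hK, p, hb⟩ := hF
  obtain ⟨C₂, hC₂, q, hk⟩ := exists_mbKernel_bound (n := n) (k := n + 1) le_rfl rfl hr A
    (p + (n + 1))
  refine ⟨C₁ * C₂, by positivity, (n + 1) * |A| + K, by positivity, q, fun θ x u h1 h2 => ?_⟩
  have hexp : ‖cexp ((∑ b, θ b - ∑ a, I * u a) * x (Fin.last n))‖ ≤
      Real.exp ((n + 1) * |A| * ‖x‖) := by
    rw [Complex.norm_exp]
    refine Real.exp_le_exp.2 ?_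
    have e : ((∑ b, θ b - ∑ a, I * u a) * x (Fin.last n) : ℂ).re =
        (∑ b, (θ b).re) * x (Fin.last n) := by simp
    rw [e]
    refine (le_abs_self _).trans ?_
    rw [abs_mul]
    gcongr
    · refine (Finset.abs_sum_le_sum_abs _ _).trans ((Finset.sum_le_card_nsmul _ _ |A| fun b _ => ?_).trans
        (by simp))
      rw [abs_of_nonpos (by linarith [h1 b])]
      exact (h2 b).trans (le_abs_self A)
    · exact norm_le_pi_norm x (Fin.last n)
  have hb' := hb u (Fin.init x)
  have hx : Real.exp (K * ‖(Fin.init x : Fin n → ℝ)‖) ≤ Real.exp (K * ‖x‖) := by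
    gcongr; exact norm_init_le x
  set w : Fin (n + 1) → ℝ := fun b => (θ b).im with hw
  calc ‖Toda.mbIntegrand F θ x u‖
      = ‖cexp ((∑ b, θ b - ∑ a, I * u a) * x (Fin.last n))‖ * ‖F u (Fin.init x)‖ *
        ‖mbKernel θ u‖ := by rw [Toda.mbIntegrand, norm_mul, norm_mul]
    _ ≤ Real.exp ((n + 1) * |A| * ‖x‖) * (C₁ * Real.exp (K * ‖x‖) * (1 + ‖u‖) ^ p *
        Real.exp (-(Real.pi / 4 * pairDist u u))) * ‖mbKernel θ u‖ := by
        gcongr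
        exact hb'.trans (by gcongr)
    _ = C₁ * Real.exp (((n + 1) * |A| + K) * ‖x‖) * (1 + ‖u‖) ^ p *
        (‖mbKernel θ u‖ * Real.exp (-(Real.pi / 4 * pairDist u u))) := by
        rw [add_mul _ K, Real.exp_add]; ring
    _ ≤ C₁ * Real.exp (((n + 1) * |A| + K) * ‖x‖) * (1 + ‖u‖) ^ p *
        (C₂ * (1 + ‖w‖) ^ q * Real.exp (-(Real.pi / 4 * pairDist w w)) *
          ((1 + ‖u‖) ^ (p + (n + 1)))⁻¹) :=
        mul_le_mul_of_nonneg_left (hk θ u h1 h2) (by positivity)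
    _ = _ := by
        rw [pow_add, mul_inv]
        have : (1 + ‖u‖) ^ p ≠ 0 := by positivity
        field_simp

theorem HasMbBound.mb {n : ℕ} {F : (Fin n → ℝ) → (Fin n → ℝ) → ℂ} (hF : HasMbBound F)
    {r : ℝ} (hr : 0 < r) (A : ℝ) :
    ∃ C > 0, ∃ K ≥ 0, ∃ p : ℕ, ∀ (θ : Fin (n + 1) → ℂ) x, (∀ b, r ≤ -(θ b).re) →
      (∀ b, -(θ b).re ≤ A) → ‖mb F θ x‖ ≤
        C * Real.exp (K * ‖x‖) * (1 + ‖fun b => (θ b).im‖) ^ p *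
          Real.exp (-(Real.pi / 4 * pairDist (fun b => (θ b).im) fun b => (θ b).im)) := by
  obtain ⟨C, hC, K, hK, p, hb⟩ := hF.mbIntegrand hr A
  set J : ℝ := ∫ u : Fin n → ℝ, ((1 + ‖u‖) ^ (n + 1))⁻¹ with hJ
  have hJ0 : 0 ≤ J := integral_nonneg fun u => by positivity
  refine ⟨(‖mbCoeff n‖ + 1) * (C * (J + 1)), by positivity, K, hK, p, fun θ x h1 h2 => ?_⟩
  rw [Toda.mb, norm_mul]
  have h3 := norm_integral_le_of_norm_le ((integrable_one_add_norm_pow_inv n).const_mul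
    (C * Real.exp (K * ‖x‖) * (1 + ‖fun b => (θ b).im‖) ^ p *
      Real.exp (-(Real.pi / 4 * pairDist (fun b => (θ b).im) fun b => (θ b).im))))
    (Eventually.of_forall fun u => hb θ x u h1 h2)
  rw [integral_const_mul] at h3
  calc ‖mbCoeff n‖ * ‖∫ u, Toda.mbIntegrand F θ x u‖
      ≤ (‖mbCoeff n‖ + 1) * ((C * Real.exp (K * ‖x‖) * (1 + ‖fun b => (θ b).im‖) ^ p *
      Real.exp (-(Real.pi / 4 * pairDist (fun b => (θ b).im) fun b => (θ b).im))) * (J + 1)) := by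
        gcongr
        · linarith
        · exact h3.trans (by gcongr; linarith)
    _ = _ := by ring

theorem hasMbBound_phi (n : ℕ) : HasMbBound (phi n) := by
  induction n with
  | zero =>
    refine ⟨1, one_pos, 0, le_rfl, 0, fun y x => ?_⟩
    simp [phi, pairDist]
  | succ n ih =>
    obtain ⟨C, hC, K, hK, p, hb⟩ := ih.mb one_pos 1
    refine ⟨C, hC, (n + 1) + K, by positivity, p, fun y x => ?_⟩
    have h1 := hb (fun b => I * y b - 1) x (fun b => by simp) (fun b => by simp)
    have him : (fun b => (I * (y b : ℂ) - 1).im) = y := by ext b; simp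
    rw [him] at h1
    rw [phi, norm_mul]
    have h2 : ‖cexp (∑ a, x a)‖ ≤ Real.exp ((n + 1) * ‖x‖) := by
      rw [Complex.norm_exp]
      refine Real.exp_le_exp.2 ?_
      rw [re_sum]
      refine (Finset.sum_le_card_nsmul _ _ ‖x‖ fun b _ => ?_).trans (by simp)
      rw [ofReal_re]
      exact (le_abs_self _).trans (norm_le_pi_norm x b)
    calc ‖cexp (∑ a, x a)‖ * ‖mb (phi n) (fun b => I * y b - 1) x‖
        ≤ Real.exp ((n + 1) * ‖x‖) * (C * Real.exp (K * ‖x‖) * (1 + ‖y‖) ^ p *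
          Real.exp (-(Real.pi / 4 * pairDist y y))) := by gcongr
      _ = _ := by rw [add_mul _ K, Real.exp_add]; ring

theorem integrable_mbIntegrand_phi {n : ℕ} {θ : Fin (n + 1) → ℂ} (hθ : ∀ b, (θ b).re < 0)
    (x : Fin (n + 1) → ℝ) : Integrable (mbIntegrand (phi n) θ x) := by
  obtain ⟨r, hr, hrb⟩ := exists_pos_le_forall (f := fun b => -(θ b).re)
    (fun b => by linarith [hθ b])
  obtain ⟨C, hC, K, hK, p, hb⟩ := (hasMbBound_phi n).mbIntegrand hr (∑ b, -(θ b).re)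
  refine ((integrable_one_add_norm_pow_inv n).const_mul _).mono'
    (((measurable_mbIntegrand (measurable_phi n)).comp
      (measurable_prodMk_left (x := (θ, x)))).aestronglyMeasurable)
    (Eventually.of_forall fun u => hb θ x u hrb fun b => ?_)
  exact Finset.single_le_sum (f := fun b => -(θ b).re) (fun b _ => by linarith [hθ b])
    (Finset.mem_univ b)

theorem mbKernel_add {n k : ℕ} (θ : Fin k → ℂ) (u : Fin n → ℝ) (r : ℝ) :
    mbKernel (fun b => θ b + I * r) (fun a => u a + r) = mbKernel θ u := by
  simp only [mbKernel, sklyanin]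
  congr 1
  · refine Finset.prod_congr rfl fun a _ => Finset.prod_congr rfl fun b _ => ?_
    congr 1; push_cast; ring
  · refine Finset.prod_congr rfl fun a _ => Finset.prod_congr rfl fun b _ => ?_
    congr 2; push_cast; ring

theorem sum_eq_sum_init_add_last {n : ℕ} (x : Fin (n + 1) → ℝ) :
    (∑ a, (x a : ℂ)) = ∑ a, (Fin.init x a : ℂ) + x (Fin.last n) := by
  rw [Fin.sum_univ_castSucc]; rfl

theorem mb_add_I_mul {n : ℕ} {F : (Fin n → ℝ) → (Fin n → ℝ) → ℂ}
    (hF : ∀ y (r : ℝ) x, F (fun a => y a + r) x = cexp (I * r * ∑ a, (x a : ℂ)) * F y x)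
    (θ : Fin (n + 1) → ℂ) (r : ℝ) (x : Fin (n + 1) → ℝ) :
    mb F (fun b => θ b + I * r) x = cexp (I * r * ∑ a, (x a : ℂ)) * mb F θ x := by
  rw [mb, mb, mul_left_comm]
  congr 1
  rw [← integral_const_mul, ← integral_add_right_eq_self
    (mbIntegrand F (fun b => θ b + I * r) x) (fun _ => r : Fin n → ℝ)]
  refine integral_congr_ae (Eventually.of_forall fun u => ?_)
  have h := hF u r (Fin.init x)
  have hk := mbKernel_add θ u r
  simp only [mbIntegrand]
  change cexp ((∑ b, (θ b + I * r) - ∑ a, I * ((u a + r : ℝ) : ℂ)) * x (Fin.last n)) *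
    F (fun a => u a + r) (Fin.init x) * mbKernel (fun b => θ b + I * r) (fun a => u a + r) = _
  rw [h, hk, sum_eq_sum_init_add_last]
  have e : (∑ b, (θ b + I * r) - ∑ a, I * ((u a + r : ℝ) : ℂ)) * x (Fin.last n) =
      (∑ b, θ b - ∑ a, I * u a) * x (Fin.last n) + I * r * x (Fin.last n) := by
    push_cast
    simp only [mul_add, Finset.sum_add_distrib, Finset.sum_const, Finset.card_univ,
      Fintype.card_fin, nsmul_eq_mul]
    push_cast; ring
  rw [e, mul_add, Complex.exp_add, Complex.exp_add]
  ring

theorem phi_add_const {n : ℕ} (y : Fin n → ℝ) (r : ℝ) (x : Fin n → ℝ) :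
    phi n (fun a => y a + r) x = cexp (I * r * ∑ a, (x a : ℂ)) * phi n y x := by
  induction n generalizing r with
  | zero => simp [phi]
  | succ n ih =>
    have h := mb_add_I_mul (fun y r x => ih y r x) (fun b => I * y b - 1) r x
    have e : (fun b => I * ((y b + r : ℝ) : ℂ) - 1) = fun b => I * y b - 1 + I * r := by
      ext b; push_cast; ring
    rw [phi, phi, e, h]
    ring

theorem mb_comp_perm {n : ℕ} (F : (Fin n → ℝ) → (Fin n → ℝ) → ℂ) (θ : Fin (n + 1) → ℂ)
    (x : Fin (n + 1) → ℝ) (σ : Equiv.Perm (Fin (n + 1))) :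
    mb F (fun b => θ (σ b)) x = mb F θ x := by
  simp only [mb, mbIntegrand, mbKernel]
  have h1 : ∑ b, θ (σ b) = ∑ b, θ b := Equiv.sum_comp σ θ
  have h2 : ∀ s : ℂ, ∏ b, Gamma (s - θ (σ b)) = ∏ b, Gamma (s - θ b) := fun s =>
    Equiv.prod_comp σ fun b => Gamma (s - θ b)
  simp_rw [h1, h2]

theorem phi_comp_perm {n : ℕ} (y x : Fin n → ℝ) (σ : Equiv.Perm (Fin n)) :
    phi n (fun a => y (σ a)) x = phi n y x := by
  cases n with
  | zero => rfl
  | succ n => rw [phi, phi, mb_comp_perm _ (fun b => I * y b - 1) x σ]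

theorem phi_add_const_right {n : ℕ} (y x : Fin n → ℝ) (t : ℝ) :
    phi n y (fun a => x a + t) = cexp (I * t * ∑ a, (y a : ℂ)) * phi n y x := by
  induction n with
  | zero => simp [phi]
  | succ n ih =>
    rw [phi, phi, mb, mb]
    have e : ∀ u, mbIntegrand (phi n) (fun b => I * y b - 1) (fun a => x a + t) u =
        cexp ((∑ b, (I * y b - 1)) * t) * mbIntegrand (phi n) (fun b => I * y b - 1) x u := by
      intro u
      have h := ih u (Fin.init x)
      simp only [mbIntegrand]
      change cexp (_ * ((x (Fin.last n) + t : ℝ) : ℂ)) * phi n u (fun a => Fin.init x a + t) * _ = _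
      rw [h]
      have e' : (∑ b, (I * y b - 1) - ∑ a, I * u a) * ((x (Fin.last n) + t : ℝ) : ℂ) =
          (∑ b, (I * y b - 1) - ∑ a, I * u a) * x (Fin.last n) + (∑ b, (I * y b - 1)) * t -
            I * t * ∑ a, (u a : ℂ) := by
        push_cast
        rw [← Finset.mul_sum]
        ring
      rw [e', Complex.exp_sub, Complex.exp_add]
      have := exp_ne_zero (I * t * ∑ a, (u a : ℂ))
      field_simp
    simp_rw [e]
    rw [integral_const_mul]
    have e2 : cexp (∑ a, ((x a + t : ℝ) : ℂ)) * cexp ((∑ b, (I * y b - 1)) * t) =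
        cexp (I * t * ∑ a, (y a : ℂ)) * cexp (∑ a, (x a : ℂ)) := by
      rw [← Complex.exp_add, ← Complex.exp_add]
      congr 1
      push_cast
      simp only [Finset.sum_sub_distrib, Finset.sum_add_distrib, Finset.sum_const, Finset.card_univ,
        Fintype.card_fin, nsmul_eq_mul, ← Finset.mul_sum]
      ring
    calc _ = (cexp (∑ a, ((x a + t : ℝ) : ℂ)) * cexp ((∑ b, (I * y b - 1)) * t)) *
          (mbCoeff n * ∫ u, mbIntegrand (phi n) (fun b => I * y b - 1) x u) := by ring
      _ = _ := by rw [e2]; ring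

/-- Independence of the Mellin–Barnes step from the position of the contour. -/
theorem mb_contour_independent {n : ℕ} (η : Fin (n + 1) → ℂ) (x : Fin (n + 1) → ℝ) {c₁ c₂ : ℂ}
    (h₁ : ∀ b, (η b).re < c₁.re) (h₂ : ∀ b, (η b).re < c₂.re) :
    cexp (c₁ * ∑ a, (x a : ℂ)) * mb (phi n) (fun b => η b - c₁) x =
      cexp (c₂ * ∑ a, (x a : ℂ)) * mb (phi n) (fun b => η b - c₂) x := by
  set U : Set ℂ := {c | ∀ b, (η b).re < c.re} with hU
  have hUo : IsOpen U := by
    have : U = ⋂ b, {c : ℂ | (η b).re < c.re} := by ext c; simp [hU]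
    rw [this]
    exact isOpen_iInter_of_finite fun b => isOpen_lt continuous_const continuous_re
  have hUc : IsPreconnected U := by
    refine Convex.isPreconnected fun c hc c' hc' a b ha hb hab i => ?_
    have h1 := hc i
    have h2 := hc' i
    simp only [add_re, real_smul, re_ofReal_mul]
    rcases eq_or_lt_of_le ha with rfl | ha
    · have : b = 1 := by linarith
      subst this; linarith
    · have e : (η i).re = a * (η i).re + b * (η i).re := by rw [← add_mul, hab, one_mul]
      nlinarith
  set g : ℂ → (Fin n → ℝ) → ℂ := fun c u =>
    cexp (c * ∑ a, (x a : ℂ)) * mbIntegrand (phi n) (fun b => η b - c) x u with hg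
  have key : ∫ u, g c₁ u = ∫ u, g c₂ u := by
    refine integral_eq_of_translation_invariant hUo hUc (fun c hc => ?_) (fun u => ?_)
      (fun c₀ hc₀ => ?_) I_ne_zero (fun c hc r hcr => ?_) h₁ h₂
    · exact ((integrable_mbIntegrand_phi (fun b => by simpa using hc b) x).const_mul
        _).aestronglyMeasurable
    · have hΓ : ∀ a b, DifferentiableOn ℂ (fun c => Gamma (I * u a - (η b - c))) U := by
        intro a b c hc
        have h1 : DifferentiableAt ℂ Gamma (I * u a - (η b - c)) := by
          refine differentiableAt_Gamma _ fun m hm => ?_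
          have := congrArg re hm
          simp at this
          linarith [hc b, (Nat.cast_nonneg m : (0 : ℝ) ≤ m)]
        exact (h1.comp c (by fun_prop :
          DifferentiableAt ℂ (fun c => I * u a - (η b - c)) c)).differentiableWithinAt
      have h2 : DifferentiableOn ℂ (fun c => ∏ a, ∏ b, Gamma (I * u a - (η b - c))) U :=
        DifferentiableOn.fun_finsetProd fun a _ => DifferentiableOn.fun_finsetProd fun b _ => hΓ a b
      simp only [hg, mbIntegrand, mbKernel]
      exact DifferentiableOn.mul (by fun_prop) (DifferentiableOn.mul (by fun_prop)
        (DifferentiableOn.mul h2 (by fun_prop)))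
    · obtain ⟨ρ, hρ, hρb⟩ := exists_pos_le_forall (f := fun b => c₀.re - (η b).re)
        (fun b => by linarith [hc₀ b])
      set S : ℝ := ∑ b, (c₀.re - (η b).re) with hS
      have hSb : ∀ b, c₀.re - (η b).re ≤ S := fun b =>
        Finset.single_le_sum (f := fun b => c₀.re - (η b).re) (fun b _ => hρ.le.trans (hρb b))
          (Finset.mem_univ b)
      obtain ⟨C, hC, K, hK, p, hb⟩ := (hasMbBound_phi n).mbIntegrand (half_pos hρ) (S + ρ)
      set Y : ℝ := ‖fun b => (η b).im‖ + ‖c₀‖ + ρ with hY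
      refine ⟨ρ / 2, half_pos hρ, fun u => Real.exp ((‖c₀‖ + ρ) * ‖(∑ a, (x a : ℂ))‖) *
        (C * Real.exp (K * ‖x‖) * (1 + Y) ^ p * ((1 + ‖u‖) ^ (n + 1))⁻¹),
        ((integrable_one_add_norm_pow_inv n).const_mul _).const_mul _, fun c hc => ?_⟩
      rw [mem_closedBall_iff_norm] at hc
      have hre : |c.re - c₀.re| ≤ ρ / 2 := by
        rw [← sub_re]; exact (abs_re_le_norm _).trans hc
      have hre' := abs_le.1 hre
      have hcn : ‖c‖ ≤ ‖c₀‖ + ρ := by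
        have := norm_sub_norm_le c c₀
        linarith
      refine ⟨fun b => by linarith [hρb b], fun u => ?_⟩
      have h1 := hb (fun b => η b - c) x u (fun b => by simp; linarith [hρb b])
        (fun b => by simp; linarith [hSb b])
      have hYb : ‖fun b => (η b - c).im‖ ≤ Y := by
        refine (pi_norm_le_iff_of_nonneg (by positivity)).2 fun b => ?_
        have h3 := norm_le_pi_norm (fun b => (η b).im) b
        have h4 := abs_im_le_norm c
        rw [Real.norm_eq_abs] at h3 ⊢
        rw [sub_im]
        have h5 : |(η b).im - c.im| ≤ |(η b).im| + |c.im| := abs_sub _ _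
        linarith
      have hpd : 0 ≤ pairDist (fun b => (η b - c).im) (fun b => (η b - c).im) :=
        Finset.sum_nonneg fun _ _ => Finset.sum_nonneg fun _ _ => abs_nonneg _
      have he1 : Real.exp (-(Real.pi / 4 *
          pairDist (fun b => (η b - c).im) (fun b => (η b - c).im))) ≤ 1 :=
        Real.exp_le_one_iff.2 (by have := Real.pi_pos; nlinarith)
      have he2 : ‖cexp (c * ∑ a, (x a : ℂ))‖ ≤ Real.exp ((‖c₀‖ + ρ) * ‖(∑ a, (x a : ℂ))‖) := by
        refine (Complex.norm_exp_le_exp_norm _).trans (Real.exp_le_exp.2 ?_)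
        rw [norm_mul]; gcongr
      rw [hg]
      beta_reduce
      rw [norm_mul]
      refine mul_le_mul he2 (h1.trans ?_) (norm_nonneg _) (Real.exp_pos _).le
      have : C * Real.exp (K * ‖x‖) * (1 + ‖fun b => (η b - c).im‖) ^ p *
          Real.exp (-(Real.pi / 4 * pairDist (fun b => (η b - c).im) fun b => (η b - c).im)) ≤
          C * Real.exp (K * ‖x‖) * (1 + Y) ^ p * 1 := by gcongr
      rw [mul_one] at this
      exact mul_le_mul_of_nonneg_right this (by positivity)
    · have hm := mb_add_I_mul (fun y r x => phi_add_const y r x) (fun b => η b - (c + r * I)) r x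
      have e : (fun b => η b - (c + r * I) + I * r) = fun b => η b - c := by ext b; ring
      rw [e, mb, mb, mul_left_comm] at hm
      have hmc : mbCoeff n ≠ 0 := inv_ne_zero (mul_ne_zero
        (by exact_mod_cast n.factorial_ne_zero) (pow_ne_zero _ (by simp [Real.pi_ne_zero])))
      have hm' := mul_left_cancel₀ hmc hm
      simp only [hg, integral_const_mul]
      rw [hm', add_mul, Complex.exp_add, mul_comm (r : ℂ) I]
      ring
  simp only [hg, integral_const_mul] at key
  rw [mb, mb, mul_left_comm, key, mul_left_comm]

theorem sklyanin_neg {m : ℕ} (s : Fin m → ℂ) : sklyanin (fun a => -s a) = sklyanin s := by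
  simp only [sklyanin, Finset.prod_filter]
  rw [Finset.prod_comm]
  refine Finset.prod_congr rfl fun a _ => Finset.prod_congr rfl fun b _ => ?_
  simp only [ne_comm (a := b)]
  congr 3; ring

theorem mbCoeff_mul_integral_exp {k : ℕ} {θ : Fin (k + 1) → ℂ} (hinj : Function.Injective θ)
    {t : Fin k → ℂ} {r : ℝ} (hr : 0 < r) (h1 : ∀ l, r ≤ -(θ l).re)
    (h2 : ∀ l, -(θ l).re < r + 1 / 2) (ht : ∀ c, 0 < (t c).re) (z : ℝ) :
    mbCoeff (k + 1) * ∫ u : Fin (k + 1) → ℝ, cexp ((∑ a, I * u a) * z) *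
        (∏ a, ∏ c, Gamma (t c - I * u a)) * mbKernel θ u =
      (∏ l, ∏ c, Gamma (t c - θ l)) * (cexp (z * ∑ l, θ l) * cexp (-Real.exp (-z))) := by
  have h := gustafson_second (α := fun l => -θ l) (neg_injective.comp hinj) (τ := t) hr
    (fun l => by simpa using h1 l) (fun l => by simpa using h2 l) ht z
  rw [gustafson, ← integral_neg_eq_self] at h
  have e : ∀ u : Fin (k + 1) → ℝ, (∏ a, (cexp (-(z * (I * ((-u) a : ℝ)))) *
      ((∏ l, Gamma (-θ l - I * ((-u) a : ℝ))) * ∏ c, Gamma (t c + I * ((-u) a : ℝ))))) *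
      sklyanin (fun a => I * ((-u) a : ℝ)) = cexp ((∑ a, I * u a) * z) *
        (∏ a, ∏ c, Gamma (t c - I * u a)) * mbKernel θ u := by
    intro u
    have e1 : ∀ a, cexp (-(z * (I * ((-u) a : ℝ)))) = cexp (I * u a * z) := fun a => by
      congr 1; simp only [Pi.neg_apply]; push_cast; ring
    have e2 : ∀ a l, -θ l - I * ((-u) a : ℝ) = I * u a - θ l := fun a l => by
      simp only [Pi.neg_apply]; push_cast; ring
    have e3 : ∀ a c, t c + I * ((-u) a : ℝ) = t c - I * u a := fun a c => by
      simp only [Pi.neg_apply]; push_cast; ring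
    have e4 : (fun a => I * ((-u) a : ℝ)) = fun a => -(I * (u a : ℂ)) := by
      ext a; simp
    rw [e4, sklyanin_neg, mbKernel]
    simp only [e1, e2, e3, Finset.prod_mul_distrib]
    rw [← Complex.exp_sum, Finset.sum_mul]
    ring
  simp_rw [e] at h
  rw [h, mbCoeff]
  have hfac : ((k + 1).factorial : ℂ) ≠ 0 := by exact_mod_cast (k + 1).factorial_ne_zero
  have hpi : ((2 : ℂ) * Real.pi) ^ (k + 1) ≠ 0 := pow_ne_zero _ (by simp [Real.pi_ne_zero])
  simp only [Finset.sum_neg_distrib, mul_neg, neg_neg, ← sub_eq_add_neg]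
  field_simp

theorem mbCoeff_mul_integral_prod {k : ℕ} {γ : Fin (k + 1) → ℂ} (hinj : Function.Injective γ)
    {θ : Fin (k + 1) → ℂ} {r : ℝ} (hr : 0 < r) (h1 : ∀ a, r ≤ (γ a).re)
    (h2 : ∀ a, (γ a).re < r + 1 / 2) (hθ : ∀ b, (θ b).re < 0) :
    (mbCoeff k * ∫ v : Fin k → ℝ, (∏ a, ∏ c, Gamma (γ a - I * v c)) * mbKernel θ v) *
        Gamma (∑ a, γ a - ∑ b, θ b) = ∏ a, ∏ b, Gamma (γ a - θ b) := by
  have h := gustafson_first (a := γ 0) (α := fun l => γ l.succ)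
    (hinj.comp (Fin.succ_injective _)) (β := fun b => -θ b) hr (h1 0) (fun l => h1 l.succ)
    (fun l => h2 l.succ) (fun b => by simpa using hθ b)
  rw [← Fin.sum_univ_succ] at h
  rw [gustafson] at h
  have e : ∀ v : Fin k → ℝ, (∏ c, (Gamma (γ 0 - I * v c) * (∏ l : Fin k, Gamma (γ l.succ - I * v c)) *
      ∏ b, Gamma (-θ b + I * v c))) * sklyanin (fun c => I * v c) =
      (∏ a, ∏ c, Gamma (γ a - I * v c)) * mbKernel θ v := by
    intro v
    rw [mbKernel, Finset.prod_comm (f := fun a c => Gamma (γ a - I * v c)), ← mul_assoc,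
      ← Finset.prod_mul_distrib]
    congr 1
    refine Finset.prod_congr rfl fun c _ => ?_
    rw [Fin.prod_univ_succ (fun a => Gamma (γ a - I * v c))]
    congr 1
    refine Finset.prod_congr rfl fun b _ => ?_
    congr 1; ring
  simp_rw [e] at h
  simp only [Finset.sum_neg_distrib, ← sub_eq_add_neg] at h
  rw [mul_assoc, h, mbCoeff, Fin.prod_univ_succ (fun a => ∏ b, Gamma (γ a - θ b))]
  have hfac : (k.factorial : ℂ) ≠ 0 := by exact_mod_cast k.factorial_ne_zero
  have hpi : ((2 : ℂ) * Real.pi) ^ k ≠ 0 := pow_ne_zero _ (by simp [Real.pi_ne_zero])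
  simp only [neg_add_eq_sub]
  field_simp

theorem integrable_mbKernel_mul_mbIntegrand {k : ℕ} {θ : Fin (k + 1) → ℂ} {r : ℝ} (hr : 0 < r)
    (h1 : ∀ l, r ≤ -(θ l).re) (ζ : ℝ) (x : Fin (k + 1) → ℝ) :
    Integrable fun p : (Fin (k + 1) → ℝ) × (Fin k → ℝ) =>
      cexp ((∑ b, θ b - ∑ a, I * p.1 a) * ζ) * mbKernel θ p.1 *
        mbIntegrand (phi k) (fun b => I * p.1 b - 1) x p.2 := by
  obtain ⟨C₁, hC₁, K, hK, p, hb⟩ := (hasMbBound_phi k).mbIntegrand one_pos 1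
  obtain ⟨C₂, hC₂, q, hk⟩ := exists_mbKernel_bound (n := k + 1) (k := k + 1) (d := 0)
    zero_le_one rfl hr (∑ b, -(θ b).re) (p + (k + 1 + 1))
  set D : ℝ := C₂ * (1 + ‖fun b => (θ b).im‖) ^ q * Real.exp (-(Real.pi / 4 *
    pairDist (fun b => (θ b).im) fun b => (θ b).im)) with hD
  have hD0 : 0 ≤ D := by positivity
  refine (((integrable_one_add_norm_pow_inv (k + 1)).const_mul
    (Real.exp ((∑ b, (θ b).re) * ζ) * D * (C₁ * Real.exp (K * ‖x‖)))).mul_prod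
    (integrable_one_add_norm_pow_inv k)).mono' ?_ (Eventually.of_forall fun ⟨u, v⟩ => ?_)
  · refine Measurable.aestronglyMeasurable (Measurable.mul (Measurable.mul (by fun_prop) ?_) ?_)
    · exact measurable_mbKernel.comp (f := fun p : (Fin (k + 1) → ℝ) × (Fin k → ℝ) => (θ, p.1))
        (by fun_prop)
    · exact (measurable_mbIntegrand (measurable_phi k)).comp
        (f := fun p : (Fin (k + 1) → ℝ) × (Fin k → ℝ) =>
          (((fun b => I * (p.1 b : ℂ) - 1 : Fin (k + 1) → ℂ), x), p.2)) (by fun_prop)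
  · have hbu := hb (fun b => I * u b - 1) x v (fun b => by simp) (fun b => by simp)
    have him : (fun b => (I * (u b : ℂ) - 1).im) = u := by ext b; simp
    rw [him] at hbu
    have hku := hk θ u h1 fun b => Finset.single_le_sum (f := fun b => -(θ b).re)
      (fun b _ => hr.le.trans (h1 b)) (Finset.mem_univ b)
    have hexp : ‖cexp ((∑ b, θ b - ∑ a, I * u a) * ζ)‖ = Real.exp ((∑ b, (θ b).re) * ζ) := by
      rw [Complex.norm_exp]; simp
    dsimp only
    rw [norm_mul, norm_mul, hexp]
    calc Real.exp ((∑ b, (θ b).re) * ζ) * ‖mbKernel θ u‖ *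
          ‖mbIntegrand (phi k) (fun b => I * u b - 1) x v‖
        ≤ Real.exp ((∑ b, (θ b).re) * ζ) * ‖mbKernel θ u‖ *
          (C₁ * Real.exp (K * ‖x‖) * (1 + ‖u‖) ^ p * Real.exp (-(Real.pi / 4 * pairDist u u)) *
          ((1 + ‖v‖) ^ (k + 1))⁻¹) := by gcongr
      _ = Real.exp ((∑ b, (θ b).re) * ζ) * (C₁ * Real.exp (K * ‖x‖)) * ((1 + ‖v‖) ^ (k + 1))⁻¹ *
          (1 + ‖u‖) ^ p * (‖mbKernel θ u‖ * Real.exp (-(Real.pi / 4 * pairDist u u))) := by ring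
      _ ≤ Real.exp ((∑ b, (θ b).re) * ζ) * (C₁ * Real.exp (K * ‖x‖)) * ((1 + ‖v‖) ^ (k + 1))⁻¹ *
          (1 + ‖u‖) ^ p * (D * ((1 + ‖u‖) ^ (p + (k + 1 + 1)))⁻¹) :=
          mul_le_mul_of_nonneg_left hku (by positivity)
      _ = _ := by
          rw [pow_add _ p (k + 1 + 1), mul_inv]
          have : (1 + ‖u‖) ^ p ≠ 0 := by positivity
          field_simp

/-- The dual Baxter-type identity: integrating the Whittaker function against the Mellin–Barnes
kernel with as many parameters as variables. -/
theorem mbCoeff_mul_integral_phi_mul_mbKernel {k : ℕ} {θ : Fin (k + 1) → ℂ}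
    (hinj : Function.Injective θ) {r : ℝ} (hr : 0 < r) (h1 : ∀ l, r ≤ -(θ l).re)
    (h2 : ∀ l, -(θ l).re < r + 1 / 2) (ζ : ℝ) (x : Fin (k + 1) → ℝ) :
    mbCoeff (k + 1) * ∫ u : Fin (k + 1) → ℝ,
        cexp ((∑ b, θ b - ∑ a, I * u a) * ζ) * phi (k + 1) u x * mbKernel θ u =
      cexp (-Real.exp (ζ - x (Fin.last k))) * mb (phi k) θ x := by
  set X := x (Fin.last k) with hX
  set f : (Fin (k + 1) → ℝ) → (Fin k → ℝ) → ℂ := fun u v =>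
    cexp ((∑ b, θ b - ∑ a, I * u a) * ζ) * mbKernel θ u *
        mbIntegrand (phi k) (fun b => I * u b - 1) x v with hf
  have hfi : Integrable (Function.uncurry f) := integrable_mbKernel_mul_mbIntegrand hr h1 ζ x
  have hexpand : ∀ u : Fin (k + 1) → ℝ,
      cexp ((∑ b, θ b - ∑ a, I * u a) * ζ) * phi (k + 1) u x * mbKernel θ u =
      (cexp (∑ a, x a) * mbCoeff k) * ∫ v, f u v := by
    intro u
    simp only [hf]
    rw [integral_const_mul, phi, mb]
    ring
  simp_rw [hexpand]
  rw [integral_const_mul, integral_integral_swap hfi]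
  have hinner : ∀ v : Fin k → ℝ, mbCoeff (k + 1) * ∫ u, f u v =
      cexp (-Real.exp (ζ - X)) * mbIntegrand (phi k) (fun b => θ b - 1) x v := by
    intro v
    have hG := mbCoeff_mul_integral_exp hinj (t := fun c => I * v c + 1) hr h1 h2
      (fun c => by simp) (X - ζ)
    have e : ∀ u, f u v = (cexp ((∑ b, θ b) * ζ) * cexp ((-(k + 1) - ∑ a, I * v a) * X) *
        phi k v (Fin.init x) * sklyanin (fun c => I * v c)) *
        (cexp ((∑ a, I * u a) * ((X - ζ : ℝ) : ℂ)) *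
        (∏ a, ∏ c, Gamma (I * v c + 1 - I * u a)) * mbKernel θ u) := by
      intro u
      have e1 : cexp ((∑ b, θ b - ∑ a, I * u a) * ζ) *
          cexp ((∑ b, (I * u b - 1) - ∑ a, I * v a) * X) =
          cexp ((∑ b, θ b) * ζ) * cexp ((-(k + 1) - ∑ a, I * v a) * X) *
          cexp ((∑ a, I * u a) * ((X - ζ : ℝ) : ℂ)) := by
        rw [← Complex.exp_add, ← Complex.exp_add, ← Complex.exp_add]
        congr 1
        simp only [Finset.sum_sub_distrib, Finset.sum_const, Finset.card_univ,
          Fintype.card_fin, nsmul_eq_mul]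
        push_cast; ring
      have e2 : ∏ c, ∏ a, Gamma (I * v c - (I * u a - 1)) =
          ∏ a, ∏ c, Gamma (I * v c + 1 - I * u a) := by
        rw [Finset.prod_comm]
        refine Finset.prod_congr rfl fun a _ => Finset.prod_congr rfl fun c _ => ?_
        congr 1; ring
      simp only [hf, mbIntegrand]
      have e0 : mbKernel (fun b => I * (u b : ℂ) - 1) v = (∏ c, ∏ a,
        Gamma (I * v c - (I * u a - 1))) * sklyanin (fun c => I * v c) := rfl
      rw [e0, e2]
      calc _ = (cexp ((∑ b, θ b - ∑ a, I * u a) * ζ) *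
          cexp ((∑ b, (I * u b - 1) - ∑ a, I * v a) * X)) * (mbKernel θ u *
          phi k v (Fin.init x) * ((∏ a, ∏ c, Gamma (I * v c + 1 - I * u a)) *
            sklyanin (fun c => I * v c))) := by ring
        _ = _ := by rw [e1]; ring
    simp_rw [e]
    rw [integral_const_mul, mul_left_comm, hG, mbIntegrand, mbKernel]
    have e3 : ∏ l, ∏ c, Gamma (I * v c + 1 - θ l) = ∏ c, ∏ l, Gamma (I * v c - (θ l - 1)) := by
      rw [Finset.prod_comm]
      refine Finset.prod_congr rfl fun a _ => Finset.prod_congr rfl fun c _ => ?_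
      congr 1; ring
    have e4 : cexp ((∑ b, θ b) * ζ) * cexp ((-(k + 1) - ∑ a, I * v a) * X) *
        cexp (((X - ζ : ℝ) : ℂ) * ∑ l, θ l) = cexp ((∑ b, (θ b - 1) - ∑ a, I * v a) * X) := by
      rw [← Complex.exp_add, ← Complex.exp_add]
      congr 1
      simp only [Finset.sum_sub_distrib, Finset.sum_const, Finset.card_univ,
        Fintype.card_fin, nsmul_eq_mul]
      push_cast; ring
    rw [e3, ← e4, neg_sub]
    ring
  rw [mul_left_comm, ← integral_const_mul]
  simp_rw [hinner]
  rw [integral_const_mul]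
  have hC := mb_contour_independent θ x (c₁ := 1) (c₂ := 0)
    (fun b => by rw [one_re]; linarith [h1 b]) (fun b => by rw [zero_re]; linarith [h1 b])
  simp only [one_mul, zero_mul, Complex.exp_zero, sub_zero] at hC
  rw [← hC, mb]
  ring

theorem ae_injective (n : ℕ) : ∀ᵐ u : Fin n → ℝ, Function.Injective u := by
  have h : ∀ a b : Fin n, a ≠ b → ∀ᵐ u : Fin n → ℝ, u a ≠ u b := by
    intro a b hab
    set s : Submodule ℝ (Fin n → ℝ) := LinearMap.ker
      (LinearMap.proj (R := ℝ) (φ := fun _ : Fin n => ℝ) a - LinearMap.proj b) with hs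
    have hst : s ≠ ⊤ := by
      intro h
      have : (Pi.single a 1 : Fin n → ℝ) ∈ s := by rw [h]; trivial
      simp [hs, hab.symm] at this
    have h0 := Measure.addHaar_submodule volume s hst
    rw [ae_iff]
    convert h0 using 2
    ext u
    simp [hs, sub_eq_zero]
  have h' : ∀ᵐ u : Fin n → ℝ, ∀ a b : Fin n, a ≠ b → u a ≠ u b := by
    rw [ae_all_iff]; intro a
    rw [ae_all_iff]; intro b
    by_cases hab : a = b
    · exact Eventually.of_forall fun _ h => absurd hab h
    · filter_upwards [h a b hab] with u hu _ using hu
  filter_upwards [h'] with u hu a b hab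
  by_contra hne
  exact hu a b hne hab

theorem pairDist_le_pairDist_snoc {k : ℕ} (v : Fin k → ℝ) (l : ℝ) :
    pairDist v v ≤ pairDist (Fin.snoc v l : Fin (k + 1) → ℝ) (Fin.snoc v l : Fin (k + 1) → ℝ) := by
  simp only [pairDist, Fin.sum_univ_castSucc, Fin.snoc_castSucc, Fin.snoc_last]
  have h1 : ∀ a, ∑ b, |v a - v b| ≤ ∑ b, |v a - v b| + |v a - l| := fun a => by
    linarith [abs_nonneg (v a - l)]
  have h2 : 0 ≤ ∑ b, |l - v b| + |l - l| :=
    add_nonneg (Finset.sum_nonneg fun _ _ => abs_nonneg _) (abs_nonneg _)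
  linarith [Finset.sum_le_sum fun a (_ : a ∈ Finset.univ) => h1 a]

theorem norm_snoc_le {k : ℕ} (v : Fin k → ℝ) (l : ℝ) :
    ‖(Fin.snoc v l : Fin (k + 1) → ℝ)‖ ≤ ‖v‖ + |l| := by
  refine (pi_norm_le_iff_of_nonneg (by positivity)).2 fun i => ?_
  refine Fin.lastCases ?_ (fun j => ?_) i
  · rw [Fin.snoc_last, Real.norm_eq_abs]; linarith [norm_nonneg v]
  · rw [Fin.snoc_castSucc]; linarith [norm_le_pi_norm v j, abs_nonneg l]

/-- The Mellin–Barnes integral with complex spectral parameters of real part less than one. -/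
def wh {n : ℕ} (η : Fin (n + 1) → ℂ) (x : Fin (n + 1) → ℝ) : ℂ :=
  cexp (∑ a, (x a : ℂ)) * mb (phi n) (fun b => η b - 1) x

theorem wh_eq {n : ℕ} {η : Fin (n + 1) → ℂ} (hη : ∀ b, (η b).re < 1) {c : ℂ}
    (hc : ∀ b, (η b).re < c.re) (x : Fin (n + 1) → ℝ) :
    wh η x = cexp (c * ∑ a, (x a : ℂ)) * mb (phi n) (fun b => η b - c) x := by
  have := mb_contour_independent η x (c₁ := 1) (c₂ := c) (by simpa using hη) hc
  rw [one_mul] at this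
  exact this

/-- The family of parameters obtained from points of a vertical line and one more point. -/
def snocParam {k : ℕ} (v : Fin k → ℝ) (e l : ℂ) : Fin (k + 1) → ℂ :=
  Fin.snoc (fun c => I * v c + e) l

theorem snocParam_castSucc {k : ℕ} (v : Fin k → ℝ) (e l : ℂ) (c : Fin k) :
    snocParam v e l c.castSucc = I * v c + e := by simp [snocParam]

theorem snocParam_last {k : ℕ} (v : Fin k → ℝ) (e l : ℂ) :
    snocParam v e l (Fin.last k) = l := by simp [snocParam]

theorem snocParam_sub {k : ℕ} (v : Fin k → ℝ) (e l c : ℂ) :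
    (fun b => snocParam v e l b - c) = snocParam v (e - c) (l - c) := by
  ext b
  refine Fin.lastCases ?_ (fun j => ?_) b
  · simp only [snocParam_last]
  · simp only [snocParam_castSucc]; ring

theorem sum_snocParam {k : ℕ} (v : Fin k → ℝ) (e l : ℂ) :
    ∑ b, snocParam v e l b = ∑ c, I * (v c : ℂ) + k * e + l := by
  rw [Fin.sum_univ_castSucc]
  simp only [snocParam_last, snocParam_castSucc, Finset.sum_add_distrib, Finset.sum_const,
    Finset.card_univ, Fintype.card_fin, nsmul_eq_mul]

theorem measurable_snocParam {k : ℕ} (e l : ℂ) :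
    Measurable fun v : Fin k → ℝ => snocParam v e l := by
  refine measurable_pi_lambda _ fun b => ?_
  refine Fin.lastCases ?_ (fun j => ?_) b
  · simp only [snocParam_last]; fun_prop
  · simp only [snocParam_castSucc]; fun_prop

theorem forall_snocParam {k : ℕ} {v : Fin k → ℝ} {e l : ℂ} {p : ℝ → Prop} (he : p e.re)
    (hl : p l.re) (b : Fin (k + 1)) : p (snocParam v e l b).re := by
  refine Fin.lastCases ?_ (fun j => ?_) b
  · rwa [snocParam_last]
  · rw [snocParam_castSucc]; simpa using he

theorem im_snocParam {k : ℕ} (v : Fin k → ℝ) {e : ℂ} (he : e.im = 0) (l : ℂ) :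
    (fun b => (snocParam v e l b).im) = (Fin.snoc v l.im : Fin (k + 1) → ℝ) := by
  ext b
  refine Fin.lastCases ?_ (fun j => ?_) b
  · simp [snocParam_last]
  · simp [snocParam_castSucc, he]

theorem snocParam_injective {k : ℕ} {v : Fin k → ℝ} (hv : Function.Injective v) {e l : ℂ}
    (hel : l.re ≠ e.re) : Function.Injective (snocParam v e l) := by
  rw [snocParam, Fin.snoc_injective_iff]
  refine ⟨fun a b h => hv ?_, ?_⟩
  · have := congrArg im h
    simpa using this
  · rintro ⟨c, hc⟩
    apply hel
    rw [← hc]; simp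

/-- Splitting of the kernel according to the last parameter. -/
theorem mbKernel_snocParam {n k : ℕ} (v : Fin k → ℝ) (e l : ℂ) (u : Fin n → ℝ) :
    mbKernel (snocParam v e l) u = (∏ a, ∏ c, Gamma (I * u a - (I * v c + e))) *
      ((∏ a, Gamma (I * u a - l)) * sklyanin (fun a => I * u a)) := by
  simp only [mbKernel, Fin.prod_univ_castSucc (n := k), snocParam_last, snocParam_castSucc,
    Finset.prod_mul_distrib]
  ring

/-- The integrand behind the first half of the recursion for the Gauss–Givental kernel. -/
theorem integrable_givental_aux {k : ℕ} (y : Fin (k + 1) → ℝ) (x : Fin (k + 1) → ℝ) {l : ℂ}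
    (hl : l.re ≤ 0) {d : ℝ} (hd0 : 0 < d) (hd1 : d < 1) (Z : ℝ) (ℓ₀ : ℂ) :
    Integrable fun p : (Fin (k + 1) → ℝ) × (ℝ × (Fin k → ℝ)) =>
      cexp ((ℓ₀ - ∑ a, I * p.1 a) * Z) * phi (k + 1) p.1 x *
        mbKernel (snocParam p.2.2 (d - 1) (l - 1)) p.1 *
      (cexp ((Z - p.2.1) * (∑ a, I * (p.1 a : ℂ) + (k + 1) - ∑ b, I * (y b : ℂ))) *
        cexp (-Real.exp (Z - p.2.1)) * mbKernel (fun b => I * y b - d) p.2.2) := by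
  obtain ⟨C₁, hC₁, K, hK, p, hb⟩ := hasMbBound_phi (k + 1)
  obtain ⟨C₂, hC₂, q, hk⟩ := exists_mbKernel_bound (n := k + 1) (k := k + 1) (d := 0)
    zero_le_one rfl (r := 1 - d) (by linarith) (1 - l.re) (p + (k + 1 + 1))
  obtain ⟨C₃, hC₃, q', hk'⟩ := exists_mbKernel_bound (n := k) (k := k + 1) (d := 1)
    le_rfl rfl hd0 d (q + (k + 1))
  set D : ℝ := C₃ * (1 + ‖y‖) ^ q' * Real.exp (-(Real.pi / 4 * pairDist y y)) with hD
  have hD0 : 0 ≤ D := by positivity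
  have hint1 : Integrable fun t : ℝ =>
      Real.exp ((Z - t) * ((k + 1 : ℕ) : ℝ) - Real.exp (Z - t)) :=
    (integrable_exp_mul_sub_exp (σ := ((k + 1 : ℕ) : ℝ)) (by positivity)).comp_sub_left Z
  refine (((integrable_one_add_norm_pow_inv (k + 1)).const_mul
    (Real.exp (ℓ₀.re * Z) * (C₁ * Real.exp (K * ‖x‖)) * (C₂ * (1 + |l.im|) ^ q) * D)).mul_prod
    (hint1.mul_prod (integrable_one_add_norm_pow_inv k))).mono' ?_
    (Eventually.of_forall fun ⟨u, t, v⟩ => ?_)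
  · refine Measurable.aestronglyMeasurable (Measurable.mul (Measurable.mul (Measurable.mul
      (by fun_prop) ?_) ?_) (Measurable.mul (by fun_prop) ?_))
    · exact (measurable_phi (k + 1)).comp
        (f := fun p : (Fin (k + 1) → ℝ) × (ℝ × (Fin k → ℝ)) => (p.1, x)) (by fun_prop)
    · exact measurable_mbKernel.comp (f := fun p : (Fin (k + 1) → ℝ) × (ℝ × (Fin k → ℝ)) =>
        (snocParam p.2.2 (d - 1) (l - 1), p.1))
        (((measurable_snocParam _ _).comp (by fun_prop)).prodMk (by fun_prop))
    · exact measurable_mbKernel.comp (f := fun p : (Fin (k + 1) → ℝ) × (ℝ × (Fin k → ℝ)) =>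
        ((fun b => I * (y b : ℂ) - d : Fin (k + 1) → ℂ), p.2.2)) (by fun_prop)
  · have hbu := hb u x
    have hku := hk (snocParam v (d - 1) (l - 1)) u
      (forall_snocParam (p := fun z => 1 - d ≤ -z) (by simp) (by simp; linarith))
      (forall_snocParam (p := fun z => -z ≤ 1 - l.re) (by simp; linarith) (by simp))
    rw [im_snocParam v (by simp)] at hku
    simp only [sub_im, one_im, sub_zero] at hku
    have hkv := hk' (fun b => I * y b - d) v (fun b => by simp) (fun b => by simp)
    have him : (fun b => (I * (y b : ℂ) - d).im) = y := by ext b; simp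
    rw [him] at hkv
    have hexp : ‖cexp ((ℓ₀ - ∑ a, I * u a) * Z)‖ = Real.exp (ℓ₀.re * Z) := by
      rw [Complex.norm_exp]; simp
    have hexp2 : ‖cexp ((Z - t) * (∑ a, I * (u a : ℂ) + (k + 1) - ∑ b, I * (y b : ℂ))) *
        cexp (-Real.exp (Z - t))‖ = Real.exp ((Z - t) * ((k + 1 : ℕ) : ℝ) - Real.exp (Z - t)) := by
      rw [norm_mul, Complex.norm_exp, Complex.norm_exp, ← Real.exp_add]
      congr 1
      rw [← ofReal_sub, re_ofReal_mul, ← ofReal_neg, ofReal_re]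
      simp [sub_eq_add_neg]
    set w : Fin (k + 1) → ℝ := Fin.snoc v l.im with hw
    have hw1 : 1 + ‖w‖ ≤ (1 + |l.im|) * (1 + ‖v‖) := by
      have := norm_snoc_le v l.im
      nlinarith [norm_nonneg v, abs_nonneg l.im]
    have hw2 : Real.exp (-(Real.pi / 4 * pairDist w w)) ≤
        Real.exp (-(Real.pi / 4 * pairDist v v)) := by
      have := pairDist_le_pairDist_snoc v l.im
      have := Real.pi_pos
      gcongr
    have hw3 : (1 + ‖w‖) ^ q ≤ ((1 + |l.im|) * (1 + ‖v‖)) ^ q :=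
      pow_le_pow_left₀ (by positivity) hw1 q
    dsimp only
    rw [norm_mul, norm_mul, norm_mul, norm_mul _ (mbKernel (fun b => I * (y b : ℂ) - d) v), hexp,
      hexp2]
    set T := Real.exp ((Z - t) * ((k + 1 : ℕ) : ℝ) - Real.exp (Z - t)) with hT
    have hT0 : 0 < T := Real.exp_pos _
    set κ := ‖mbKernel (snocParam v (d - 1) (l - 1)) u‖ with hκ
    set κ' := ‖mbKernel (fun b => I * (y b : ℂ) - d) v‖ with hκ'
    have hκ0 : 0 ≤ κ := norm_nonneg _
    have hκ'0 : 0 ≤ κ' := norm_nonneg _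
    have hpu : (1 + ‖u‖) ^ p ≠ 0 := by positivity
    have hpv : (1 + ‖v‖) ^ q ≠ 0 := by positivity
    calc Real.exp (ℓ₀.re * Z) * ‖phi (k + 1) u x‖ * κ * (T * κ')
        ≤ Real.exp (ℓ₀.re * Z) * (C₁ * Real.exp (K * ‖x‖) * (1 + ‖u‖) ^ p *
          Real.exp (-(Real.pi / 4 * pairDist u u))) * κ * (T * κ') := by gcongr
      _ = Real.exp (ℓ₀.re * Z) * (C₁ * Real.exp (K * ‖x‖)) * (1 + ‖u‖) ^ p * T * κ' *
          (κ * Real.exp (-(Real.pi / 4 * pairDist u u))) := by ring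
      _ ≤ Real.exp (ℓ₀.re * Z) * (C₁ * Real.exp (K * ‖x‖)) * (1 + ‖u‖) ^ p * T * κ' *
          (C₂ * (1 + ‖w‖) ^ q * Real.exp (-(Real.pi / 4 * pairDist w w)) *
            ((1 + ‖u‖) ^ (p + (k + 1 + 1)))⁻¹) :=
          mul_le_mul_of_nonneg_left hku (by positivity)
      _ ≤ Real.exp (ℓ₀.re * Z) * (C₁ * Real.exp (K * ‖x‖)) * (1 + ‖u‖) ^ p * T * κ' *
          (C₂ * ((1 + |l.im|) * (1 + ‖v‖)) ^ q * Real.exp (-(Real.pi / 4 * pairDist v v)) *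
            ((1 + ‖u‖) ^ (p + (k + 1 + 1)))⁻¹) := by gcongr
      _ = Real.exp (ℓ₀.re * Z) * (C₁ * Real.exp (K * ‖x‖)) * T *
          (C₂ * (1 + |l.im|) ^ q) * ((1 + ‖u‖) ^ (k + 1 + 1))⁻¹ * (1 + ‖v‖) ^ q *
          (κ' * Real.exp (-(Real.pi / 4 * pairDist v v))) := by
          rw [pow_add _ p (k + 1 + 1), mul_inv, mul_pow]
          generalize (1 + ‖u‖) ^ (k + 1 + 1) = U
          field_simp
      _ ≤ Real.exp (ℓ₀.re * Z) * (C₁ * Real.exp (K * ‖x‖)) * T *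
          (C₂ * (1 + |l.im|) ^ q) * ((1 + ‖u‖) ^ (k + 1 + 1))⁻¹ * (1 + ‖v‖) ^ q *
          (D * ((1 + ‖v‖) ^ (q + (k + 1)))⁻¹) :=
          mul_le_mul_of_nonneg_left hkv (by positivity)
      _ = _ := by
          rw [pow_add _ q (k + 1), mul_inv]
          generalize ((1 + ‖u‖) ^ (k + 1 + 1))⁻¹ = U
          generalize ((1 + ‖v‖) ^ (k + 1))⁻¹ = V
          field_simp

/-- The double Mellin–Barnes form of the recursion, obtained from the Mellin–Barnes side. -/
theorem wh_snocParam_eq {k : ℕ} (y : Fin (k + 1) → ℝ) (x : Fin (k + 1 + 1) → ℝ) {l : ℂ}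
    (hl0 : l.re ≤ 0) {d : ℝ} (hd0 : 0 < d) (hdl : d - l.re < 1 / 2) :
    wh (snocParam y 0 l) x =
      cexp (l * x (Fin.last _)) * cexp (d * ∑ a, (Fin.init x a : ℂ)) *
      ∫ t : ℝ, cexp (-Real.exp (x (Fin.last _) - t)) *
        cexp (-Real.exp (t - Fin.init x (Fin.last k))) *
        (mbCoeff k * ∫ v : Fin k → ℝ, mbKernel (fun b => I * y b - d) v *
          cexp (t * (∑ b, I * (y b : ℂ) - ∑ c, I * (v c : ℂ) - k * d - l)) *
          wh (snocParam v 0 (l - d)) (Fin.init x)) := by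
  set Z := x (Fin.last _) with hZ
  set x' : Fin (k + 1) → ℝ := Fin.init x with hx'
  have hd1 : d < 1 := by linarith
  set ℓ₀ : ℂ := ∑ b, I * (y b : ℂ) + (k + 1) * (0 - 1) + (l - 1) with hℓ₀
  set S : (Fin (k + 1) → ℝ) → ℂ := fun u =>
    ∑ a, I * (u a : ℂ) + (k + 1) - ∑ b, I * (y b : ℂ) with hS
  set f : (Fin (k + 1) → ℝ) → ℝ × (Fin k → ℝ) → ℂ := fun u p =>
      cexp ((ℓ₀ - ∑ a, I * u a) * Z) * phi (k + 1) u x' *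
        mbKernel (snocParam p.2 (d - 1) (l - 1)) u *
      (cexp ((Z - p.1) * S u) *
        cexp (-Real.exp (Z - p.1)) * mbKernel (fun b => I * y b - d) p.2) with hf
  have hfi : Integrable (Function.uncurry f) :=
    integrable_givental_aux y x' hl0 hd0 hd1 Z ℓ₀
  -- expansion of the Mellin–Barnes integrand
  have hexp : ∀ᵐ u : Fin (k + 1) → ℝ,
      mbIntegrand (phi (k + 1)) (fun b => snocParam y 0 l b - 1) x u =
        mbCoeff k * ∫ p, f u p := by
    filter_upwards [ae_injective (k + 1)] with u hu
    have hA := mbCoeff_mul_integral_prod (γ := fun a => I * u a + (1 - d))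
      (fun a b h => hu (by simpa using congrArg im h)) (θ := fun b => I * y b - d)
      (r := 1 - d) (by linarith) (fun a => by simp) (fun a => by simp)
      (fun b => by simpa using hd0)
    have hSS : ∑ a, (I * (u a : ℂ) + (1 - d)) - ∑ b, (I * (y b : ℂ) - d) = S u := by
      simp only [hS, Finset.sum_add_distrib, Finset.sum_sub_distrib, Finset.sum_const,
        Finset.card_univ, Fintype.card_fin, nsmul_eq_mul]
      push_cast; ring
    have hSre : 0 < (S u).re := by simp [hS]; positivity
    have hΓ : Gamma (S u) = ∫ t : ℝ, cexp ((Z - t) * S u) * cexp (-Real.exp (Z - t)) := by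
      rw [Gamma_eq_integral_exp hSre, ← integral_sub_left_eq_self _ volume Z]
      congr 1; ext t; push_cast; rfl
    have hsplit : ∀ p : ℝ × (Fin k → ℝ), f u p =
        (cexp ((ℓ₀ - ∑ a, I * u a) * Z) * phi (k + 1) u x' *
          ((∏ a, Gamma (I * u a - (l - 1))) * sklyanin (fun a => I * u a))) *
        ((cexp ((Z - p.1) * S u) * cexp (-Real.exp (Z - p.1))) *
          ((∏ a, ∏ c, Gamma (I * u a + (1 - d) - I * p.2 c)) *
            mbKernel (fun b => I * y b - d) p.2)) := by
      intro p
      simp only [hf]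
      rw [mbKernel_snocParam]
      have : ∏ a, ∏ c, Gamma (I * u a - (I * p.2 c + (d - 1))) =
          ∏ a, ∏ c, Gamma (I * u a + (1 - d) - I * p.2 c) := by
        refine Finset.prod_congr rfl fun a _ => Finset.prod_congr rfl fun c _ => ?_
        congr 1; ring
      rw [this]; ring
    simp_rw [hsplit]
    rw [integral_const_mul, Measure.volume_eq_prod, integral_prod_mul
      (fun t : ℝ => cexp ((Z - t) * S u) * cexp (-Real.exp (Z - t)))
      (fun v : Fin k → ℝ => (∏ a, ∏ c, Gamma (I * u a + (1 - d) - I * v c)) *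
            mbKernel (fun b => I * y b - d) v), ← hΓ]
    rw [hSS] at hA
    rw [mbIntegrand, snocParam_sub, sum_snocParam, mbKernel_snocParam]
    have e : ∏ a, ∏ b, Gamma (I * u a - (I * y b + (0 - 1))) =
        ∏ a, ∏ b, Gamma (I * u a + (1 - d) - (I * y b - d)) := by
      refine Finset.prod_congr rfl fun a _ => Finset.prod_congr rfl fun c _ => ?_
      congr 1; ring
    rw [e, ← hA]
    simp only [hℓ₀]
    push_cast
    ring
  -- the inner integral
  have hinner : ∀ t : ℝ, ∀ᵐ v : Fin k → ℝ, mbCoeff (k + 1) * ∫ u, f u (t, v) =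
      cexp ((l - 1) * Z) * cexp (-((1 - d) * ∑ a, (x' a : ℂ))) *
        (cexp (-Real.exp (Z - t)) * cexp (-Real.exp (t - x' (Fin.last k))) *
        (mbKernel (fun b => I * y b - d) v *
          cexp (t * (∑ b, I * (y b : ℂ) - ∑ c, I * (v c : ℂ) - k * d - l)) *
          wh (snocParam v 0 (l - d)) x')) := by
    intro t
    filter_upwards [ae_injective k] with v hv
    have hB := mbCoeff_mul_integral_phi_mul_mbKernel
      (snocParam_injective hv (e := (d : ℂ) - 1) (l := l - 1) (by simp; linarith))
      (r := 1 - d) (by linarith)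
      (forall_snocParam (p := fun z => 1 - d ≤ -z) (by simp) (by simp; linarith))
      (forall_snocParam (p := fun z => -z < 1 - d + 1 / 2) (by simp)
        (by simp; linarith)) t x'
    have hW := wh_eq (η := snocParam v 0 (l - d)) (c := ((1 - d : ℝ) : ℂ))
      (forall_snocParam (p := fun z => z < 1) (by simp) (by simp; linarith))
      (forall_snocParam (p := fun z => z < ((1 - d : ℝ) : ℂ).re) (by simp; linarith)
        (by simp; linarith)) x'
    rw [snocParam_sub] at hW
    have e1 : (0 : ℂ) - ((1 - d : ℝ) : ℂ) = d - 1 := by push_cast; ring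
    have e2 : l - d - ((1 - d : ℝ) : ℂ) = l - 1 := by push_cast; ring
    rw [e1, e2] at hW
    set Θ : ℂ := ∑ b, snocParam v (d - 1) (l - 1) b with hΘ
    have hΘ' : Θ = ∑ c, I * (v c : ℂ) + k * (d - 1) + (l - 1) := sum_snocParam _ _ _
    have e3 : ∀ u, f u (t, v) = (cexp ((l - 1) * Z) *
        cexp (t * (∑ b, I * (y b : ℂ) - (k + 1) - Θ)) * cexp (-Real.exp (Z - t)) *
        mbKernel (fun b => I * y b - d) v) *
        (cexp ((Θ - ∑ a, I * u a) * t) * phi (k + 1) u x' *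
          mbKernel (snocParam v (d - 1) (l - 1)) u) := by
      intro u
      have : cexp ((ℓ₀ - ∑ a, I * u a) * Z) * cexp ((Z - t) * S u) =
          cexp ((l - 1) * Z) * cexp (t * (∑ b, I * (y b : ℂ) - (k + 1) - Θ)) *
            cexp ((Θ - ∑ a, I * u a) * t) := by
        rw [← Complex.exp_add, ← Complex.exp_add, ← Complex.exp_add]
        congr 1
        simp only [hℓ₀, hS]; ring
      simp only [hf]
      calc _ = (cexp ((ℓ₀ - ∑ a, I * u a) * Z) * cexp ((Z - t) * S u)) *
            (phi (k + 1) u x' * mbKernel (snocParam v (d - 1) (l - 1)) u *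
              (cexp (-Real.exp (Z - t)) * mbKernel (fun b => I * y b - d) v)) := by ring
        _ = _ := by rw [this]; ring
    simp_rw [e3]
    rw [integral_const_mul, mul_left_comm, hB, hW]
    have e4 : ∑ b, I * (y b : ℂ) - (k + 1) - Θ =
        ∑ b, I * (y b : ℂ) - ∑ c, I * (v c : ℂ) - k * d - l := by
      rw [hΘ']; ring
    rw [e4]
    have e5 : cexp (-((1 - d) * ∑ a, (x' a : ℂ))) * cexp (((1 - d : ℝ) : ℂ) * ∑ a, (x' a : ℂ)) =
        1 := by
      rw [← Complex.exp_add]; push_cast; simp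
    generalize mb (phi k) (snocParam v (d - 1) (l - 1)) x' = m
    linear_combination (-(cexp ((l - 1) * Z) * cexp (-Real.exp (Z - t)) *
      cexp (-Real.exp (t - x' (Fin.last k))) * mbKernel (fun b => I * y b - d) v *
      cexp (t * (∑ b, I * (y b : ℂ) - ∑ c, I * (v c : ℂ) - k * d - l)) * m)) * e5
  have hprod : ∫ p, ∫ u, f u p = ∫ t, ∫ v, ∫ u, f u (t, v) :=
    integral_prod (fun p => ∫ u, f u p) hfi.integral_prod_right
  rw [wh, mb, integral_congr_ae hexp, integral_const_mul, integral_integral_swap hfi, hprod]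
  have hre : ∀ t : ℝ, mbCoeff (k + 1) * ∫ v, ∫ u, f u (t, v) =
      cexp ((l - 1) * Z) * cexp (-((1 - d) * ∑ a, (x' a : ℂ))) *
        (cexp (-Real.exp (Z - t)) * cexp (-Real.exp (t - x' (Fin.last k))) *
        ∫ v, (mbKernel (fun b => I * y b - d) v *
          cexp (t * (∑ b, I * (y b : ℂ) - ∑ c, I * (v c : ℂ) - k * d - l)) *
          wh (snocParam v 0 (l - d)) x')) := by
    intro t
    rw [← integral_const_mul, integral_congr_ae (hinner t), integral_const_mul, integral_const_mul]
  rw [sum_eq_sum_init_add_last]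
  have e6 : cexp (∑ a, (Fin.init x a : ℂ) + x (Fin.last (k + 1))) *
      (cexp ((l - 1) * Z) * cexp (-((1 - d) * ∑ a, (x' a : ℂ)))) =
      cexp (l * Z) * cexp (d * ∑ a, (x' a : ℂ)) := by
    rw [← Complex.exp_add, ← Complex.exp_add, ← Complex.exp_add]
    congr 1
    simp only [hx', hZ]; ring
  have e7 : mbCoeff (k + 1) * (mbCoeff k * ∫ t, ∫ v, ∫ u, f u (t, v)) =
      (cexp ((l - 1) * Z) * cexp (-((1 - d) * ∑ a, (x' a : ℂ)))) *
      ∫ t : ℝ, cexp (-Real.exp (Z - t)) * cexp (-Real.exp (t - x' (Fin.last k))) *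
        (mbCoeff k * ∫ v : Fin k → ℝ, mbKernel (fun b => I * y b - d) v *
          cexp (t * (∑ b, I * (y b : ℂ) - ∑ c, I * (v c : ℂ) - k * d - l)) *
          wh (snocParam v 0 (l - d)) x') := by
    rw [mul_left_comm, ← integral_const_mul, ← integral_const_mul, ← integral_const_mul]
    refine integral_congr_ae (Eventually.of_forall fun t => ?_)
    beta_reduce
    rw [hre t]; ring
  rw [e7, ← mul_assoc, e6]

/-- The Gauss–Givental kernel for `ħ = 1` with a complex spectral parameter. -/
def giventalKernel {n : ℕ} (l : ℂ) (x : Fin (n + 1) → ℝ) (τ : Fin n → ℝ) : ℂ :=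
  cexp (l * (∑ a, (x a : ℂ) - ∑ a, (τ a : ℂ))) *
    ∏ a : Fin n, (cexp (-Real.exp (τ a - x a.castSucc)) * cexp (-Real.exp (x a.succ - τ a)))

theorem integrable_exp_abs_sub_exp_sub_exp (L a b : ℝ) :
    Integrable fun t : ℝ => Real.exp (L * |t|) * Real.exp (-Real.exp (t - a)) *
      Real.exp (-Real.exp (b - t)) := by
  set M := |L| + 1 with hM
  have hM0 : 0 < M := by positivity
  have h1 := ((integrable_exp_mul_sub_exp hM0).comp_sub_right a).const_mul (Real.exp (M * a))
  have h2 := ((integrable_exp_mul_sub_exp hM0).comp_sub_left b).const_mul (Real.exp (-(M * b)))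
  refine (h1.add h2).mono' (by fun_prop) (Eventually.of_forall fun t => ?_)
  rw [Real.norm_of_nonneg (by positivity)]
  simp only [Pi.add_apply]
  have hL : L * |t| ≤ M * |t| := by
    refine mul_le_mul_of_nonneg_right ?_ (abs_nonneg _)
    linarith [le_abs_self L]
  rw [← Real.exp_add, ← Real.exp_add, ← Real.exp_add, ← Real.exp_add]
  rcases le_total 0 t with ht | ht
  · rw [abs_of_nonneg ht] at hL ⊢
    refine (Real.exp_le_exp.2 ?_).trans (le_add_of_nonneg_right (Real.exp_pos _).le)
    nlinarith [Real.exp_pos (b - t)]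
  · rw [abs_of_nonpos ht] at hL ⊢
    refine (Real.exp_le_exp.2 ?_).trans (le_add_of_nonneg_left (Real.exp_pos _).le)
    nlinarith [Real.exp_pos (t - a)]

theorem continuous_giventalKernel {n : ℕ} (l : ℂ) (x : Fin (n + 1) → ℝ) :
    Continuous (giventalKernel l x) := by
  unfold giventalKernel
  fun_prop

theorem norm_giventalKernel_mul_exp_le {n : ℕ} (l : ℂ) (x : Fin (n + 1) → ℝ) {K : ℝ} (hK : 0 ≤ K)
    (τ : Fin n → ℝ) :
    ‖giventalKernel l x τ‖ * Real.exp (K * ‖τ‖) ≤ Real.exp (l.re * ∑ a, x a) *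
      ∏ a : Fin n, (Real.exp ((|l.re| + K) * |τ a|) * Real.exp (-Real.exp (τ a - x a.castSucc)) *
      Real.exp (-Real.exp (x a.succ - τ a))) := by
  have h1 : ‖giventalKernel l x τ‖ = Real.exp (l.re * (∑ a, x a - ∑ a, τ a)) *
      ∏ a : Fin n, (Real.exp (-Real.exp (τ a - x a.castSucc)) *
        Real.exp (-Real.exp (x a.succ - τ a))) := by
    rw [giventalKernel, norm_mul, norm_prod, Complex.norm_exp]
    congr 1
    · congr 1
      rw [← ofReal_sum, ← ofReal_sum, ← ofReal_sub, re_mul_ofReal]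
    · refine Finset.prod_congr rfl fun a _ => ?_
      rw [norm_mul, ← ofReal_neg, ← ofReal_neg, norm_exp_ofReal, norm_exp_ofReal]
  have h2 : ‖τ‖ ≤ ∑ a, |τ a| := (pi_norm_le_iff_of_nonneg
    (Finset.sum_nonneg fun _ _ => abs_nonneg _)).2 fun a =>
      Finset.single_le_sum (f := fun a => |τ a|) (fun _ _ => abs_nonneg _) (Finset.mem_univ a)
  have h3 : -(l.re * ∑ a, τ a) ≤ |l.re| * ∑ a, |τ a| := by
    refine (neg_le_abs _).trans ?_
    rw [abs_mul]
    gcongr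
    exact Finset.abs_sum_le_sum_abs _ _
  have h4 : ∏ a : Fin n, (Real.exp ((|l.re| + K) * |τ a|) *
      Real.exp (-Real.exp (τ a - x a.castSucc)) * Real.exp (-Real.exp (x a.succ - τ a))) =
      Real.exp ((|l.re| + K) * ∑ a, |τ a|) * ∏ a : Fin n, (Real.exp (-Real.exp (τ a - x a.castSucc)) *
        Real.exp (-Real.exp (x a.succ - τ a))) := by
    simp_rw [mul_assoc]
    rw [Finset.prod_mul_distrib, ← Real.exp_sum, Finset.mul_sum]
  rw [h1, h4, mul_right_comm, ← mul_assoc, ← Real.exp_add, ← Real.exp_add]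
  refine mul_le_mul_of_nonneg_right (Real.exp_le_exp.2 ?_)
    (Finset.prod_nonneg fun _ _ => by positivity)
  nlinarith

theorem integrable_giventalKernel_mul_exp {n : ℕ} (l : ℂ) (x : Fin (n + 1) → ℝ) {K : ℝ}
    (hK : 0 ≤ K) :
    Integrable fun τ : Fin n → ℝ => ‖giventalKernel l x τ‖ * Real.exp (K * ‖τ‖) := by
  set g : Fin n → ℝ → ℝ := fun a t => Real.exp ((|l.re| + K) * |t|) *
    Real.exp (-Real.exp (t - x a.castSucc)) * Real.exp (-Real.exp (x a.succ - t)) with hg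
  have hgi : ∀ a, Integrable (g a) := fun a => integrable_exp_abs_sub_exp_sub_exp _ _ _
  have h : Integrable fun τ : Fin n → ℝ => ∏ a, g a (τ a) := by
    rw [volume_pi]
    exact Integrable.fintype_prod hgi
  refine (h.const_mul (Real.exp (l.re * ∑ a, x a))).mono' ?_ (Eventually.of_forall fun τ => ?_)
  · exact ((continuous_giventalKernel l x).norm.mul (by fun_prop)).aestronglyMeasurable
  · rw [Real.norm_of_nonneg (by positivity)]
    exact norm_giventalKernel_mul_exp_le l x hK τ

theorem integrable_giventalKernel_mul_phi {n : ℕ} (l : ℂ) (x : Fin (n + 1) → ℝ) (y : Fin n → ℝ) :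
    Integrable fun τ : Fin n → ℝ => giventalKernel l x τ * phi n y τ := by
  obtain ⟨C, hC, K, hK, p, hb⟩ := hasMbBound_phi n
  refine ((integrable_giventalKernel_mul_exp l x hK).mul_const
    (C * (1 + ‖y‖) ^ p * Real.exp (-(Real.pi / 4 * pairDist y y)))).mono' ?_
    (Eventually.of_forall fun τ => ?_)
  · exact ((continuous_giventalKernel l x).measurable.mul ((measurable_phi n).comp
      (measurable_prodMk_left (x := y)))).aestronglyMeasurable
  · rw [norm_mul, mul_assoc]
    refine mul_le_mul_of_nonneg_left ((hb y τ).trans (le_of_eq (by ring))) (norm_nonneg _)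

theorem integrable_givental_mb {k : ℕ} (l : ℂ) (x : Fin (k + 1) → ℝ) (y : Fin (k + 1) → ℝ)
    {d : ℝ} (hd : 0 < d) (t : ℝ) (ℓ₀ : ℂ) :
    Integrable fun p : (Fin k → ℝ) × (Fin k → ℝ) =>
      giventalKernel l x p.1 * (cexp (t * (ℓ₀ - ∑ c, I * (p.2 c : ℂ))) * phi k p.2 p.1 *
        mbKernel (fun b => I * y b - d) p.2) := by
  obtain ⟨C, hC, K, hK, p, hb⟩ := hasMbBound_phi k
  obtain ⟨C₃, hC₃, q', hk'⟩ := exists_mbKernel_bound (n := k) (k := k + 1) (d := 1)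
    le_rfl rfl hd d (p + (k + 1))
  set D : ℝ := C₃ * (1 + ‖y‖) ^ q' * Real.exp (-(Real.pi / 4 * pairDist y y)) with hD
  have hD0 : 0 ≤ D := by positivity
  refine ((integrable_giventalKernel_mul_exp l x hK).mul_prod
    ((integrable_one_add_norm_pow_inv k).const_mul (Real.exp (t * ℓ₀.re) * C * D))).mono' ?_
    (Eventually.of_forall fun ⟨τ, v⟩ => ?_)
  · refine Measurable.aestronglyMeasurable (Measurable.mul
      ((continuous_giventalKernel l x).measurable.comp measurable_fst)
      (Measurable.mul (Measurable.mul (by fun_prop) ?_) ?_))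
    · exact (measurable_phi k).comp
        (f := fun p : (Fin k → ℝ) × (Fin k → ℝ) => (p.2, p.1)) (by fun_prop)
    · exact measurable_mbKernel.comp (f := fun p : (Fin k → ℝ) × (Fin k → ℝ) =>
        ((fun b => I * (y b : ℂ) - d : Fin (k + 1) → ℂ), p.2)) (by fun_prop)
  · have hkv := hk' (fun b => I * y b - d) v (fun b => by simp) (fun b => by simp)
    have him : (fun b => (I * (y b : ℂ) - d).im) = y := by ext b; simp
    rw [him] at hkv
    have hexp : ‖cexp (t * (ℓ₀ - ∑ c, I * (v c : ℂ)))‖ = Real.exp (t * ℓ₀.re) := by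
      rw [Complex.norm_exp, re_ofReal_mul]; simp
    dsimp only
    rw [norm_mul, norm_mul, norm_mul, hexp]
    set g := ‖giventalKernel l x τ‖ with hg
    have hg0 : 0 ≤ g := norm_nonneg _
    set κ := ‖mbKernel (fun b => I * (y b : ℂ) - d) v‖ with hκ
    have hκ0 : 0 ≤ κ := norm_nonneg _
    have hpv : (1 + ‖v‖) ^ p ≠ 0 := by positivity
    calc g * (Real.exp (t * ℓ₀.re) * ‖phi k v τ‖ * κ)
        ≤ g * (Real.exp (t * ℓ₀.re) * (C * Real.exp (K * ‖τ‖) * (1 + ‖v‖) ^ p *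
          Real.exp (-(Real.pi / 4 * pairDist v v))) * κ) := by
          gcongr
          exact hb v τ
      _ = g * Real.exp (t * ℓ₀.re) * C * Real.exp (K * ‖τ‖) * (1 + ‖v‖) ^ p *
          (κ * Real.exp (-(Real.pi / 4 * pairDist v v))) := by ring
      _ ≤ g * Real.exp (t * ℓ₀.re) * C * Real.exp (K * ‖τ‖) * (1 + ‖v‖) ^ p *
          (D * ((1 + ‖v‖) ^ (p + (k + 1)))⁻¹) := mul_le_mul_of_nonneg_left hkv (by positivity)
      _ = _ := by
          rw [pow_add _ p (k + 1), mul_inv]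
          generalize ((1 + ‖v‖) ^ (k + 1))⁻¹ = V
          field_simp

theorem giventalKernel_snoc {k : ℕ} (l : ℂ) (d : ℝ) (x : Fin (k + 1 + 1) → ℝ) (τ : Fin k → ℝ)
    (t : ℝ) :
    giventalKernel l x (Fin.snoc τ t : Fin (k + 1) → ℝ) =
      cexp (d * (∑ a, (Fin.init x a : ℂ) - ∑ a, (τ a : ℂ))) *
        cexp (l * (x (Fin.last _) - t)) *
        (cexp (-Real.exp (x (Fin.last _) - t)) * cexp (-Real.exp (t - Fin.init x (Fin.last k)))) *
        giventalKernel (l - d) (Fin.init x) τ := by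
  rw [giventalKernel, giventalKernel, Fin.prod_univ_castSucc, Fin.sum_univ_castSucc
    (f := fun a => ((Fin.snoc τ t : Fin (k + 1) → ℝ) a : ℂ)), sum_eq_sum_init_add_last]
  simp only [Fin.snoc_castSucc, Fin.snoc_last, Fin.succ_castSucc, Fin.succ_last]
  have e : cexp (l * (∑ a, (Fin.init x a : ℂ) + x (Fin.last (k + 1)) - (∑ a, (τ a : ℂ) + t))) =
      cexp (d * (∑ a, (Fin.init x a : ℂ) - ∑ a, (τ a : ℂ))) *
        cexp (l * (x (Fin.last _) - t)) *
        cexp ((l - d) * (∑ a, (Fin.init x a : ℂ) - ∑ a, (τ a : ℂ))) := by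
    rw [← Complex.exp_add, ← Complex.exp_add]
    congr 1; ring
  rw [e]
  simp only [Fin.init]
  ring

theorem integral_fin_succ_eq_snoc {k : ℕ} {f : (Fin (k + 1) → ℝ) → ℂ} (hf : Integrable f) :
    ∫ τ, f τ = ∫ t : ℝ, ∫ τ : Fin k → ℝ, f (Fin.snoc τ t : Fin (k + 1) → ℝ) := by
  have hmp := (volume_preserving_piFinSuccAbove (fun _ : Fin (k + 1) => ℝ) (Fin.last k)).symm
  have h1 := hmp.integral_comp' f
  rw [← h1]
  have h2 := (hmp.integrable_comp_emb (MeasurableEquiv.measurableEmbedding _)).2 hf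
  refine (integral_prod _ h2).trans ?_
  refine integral_congr_ae (Eventually.of_forall fun t => ?_)
  refine integral_congr_ae (Eventually.of_forall fun τ => ?_)
  exact congrArg f (Fin.insertNth_last' t τ)

theorem integral_fin_zero (f : (Fin 0 → ℝ) → ℂ) : ∫ u, f u = f 0 := by
  rw [Measure.volume_pi_eq_dirac (0 : Fin 0 → ℝ), integral_dirac]

/-- The Gauss–Givental form of the last integration, with a complex last spectral parameter. -/
theorem wh_snocParam_eq_integral {n : ℕ} (y : Fin n → ℝ) {l : ℂ} (hl : -(1 / 2) < l.re)
    (hl0 : l.re ≤ 0) (x : Fin (n + 1) → ℝ) :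
    wh (snocParam y 0 l) x = ∫ τ : Fin n → ℝ, giventalKernel l x τ * phi n y τ := by
  induction n generalizing l with
  | zero =>
    rw [wh, mb, integral_fin_zero, integral_fin_zero]
    have h0 : snocParam y 0 l 0 = l := snocParam_last y 0 l
    simp [giventalKernel, mbIntegrand, mbKernel, sklyanin, phi, mbCoeff, h0]
    rw [← Complex.exp_add]
    congr 1; ring
  | succ k ih =>
    obtain ⟨d, hd0, hdl⟩ : ∃ d : ℝ, 0 < d ∧ d - l.re < 1 / 2 :=
      ⟨(1 / 2 + l.re) / 2, by linarith, by linarith⟩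
    rw [wh_snocParam_eq y x hl0 hd0 hdl, integral_fin_succ_eq_snoc
      (integrable_giventalKernel_mul_phi l x y), ← integral_const_mul]
    refine integral_congr_ae (Eventually.of_forall fun t => ?_)
    beta_reduce
    set Z := x (Fin.last _) with hZ
    set x' : Fin (k + 1) → ℝ := Fin.init x with hx'
    set ℓ₀ : ℂ := ∑ b, I * (y b : ℂ) - k * d - l with hℓ₀
    set f : (Fin k → ℝ) → (Fin k → ℝ) → ℂ := fun τ v =>
      giventalKernel (l - d) x' τ * (cexp (t * (ℓ₀ - ∑ c, I * (v c : ℂ))) * phi k v τ *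
        mbKernel (fun b => I * y b - d) v) with hf
    have hfi : Integrable (Function.uncurry f) :=
      integrable_givental_mb (l - d) x' y hd0 t ℓ₀
    have hexp : ∀ τ : Fin k → ℝ, giventalKernel l x (Fin.snoc τ t : Fin (k + 1) → ℝ) *
        phi (k + 1) y (Fin.snoc τ t : Fin (k + 1) → ℝ) =
        (cexp (l * Z) * cexp (d * ∑ a, (x' a : ℂ)) *
          (cexp (-Real.exp (Z - t)) * cexp (-Real.exp (t - x' (Fin.last k)))) * mbCoeff k) *
          ∫ v, f τ v := by
      intro τ
      have hphi : phi (k + 1) y (Fin.snoc τ t : Fin (k + 1) → ℝ) =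
          wh (fun b => I * y b) (Fin.snoc τ t : Fin (k + 1) → ℝ) := rfl
      have hw := wh_eq (η := fun b => I * (y b : ℂ)) (c := (d : ℂ)) (fun b => by simp)
        (fun b => by simpa using hd0) (Fin.snoc τ t : Fin (k + 1) → ℝ)
      rw [hphi, hw, giventalKernel_snoc l d, mb,
        sum_eq_sum_init_add_last (Fin.snoc τ t : Fin (k + 1) → ℝ), Fin.init_snoc, Fin.snoc_last]
      have e : ∀ v, giventalKernel (l - d) x' τ * (cexp (-l * t) * (cexp (d * t) * mbIntegrand (phi k)
          (fun b => I * y b - d) (Fin.snoc τ t : Fin (k + 1) → ℝ) v)) = f τ v := by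
        intro v
        simp only [mbIntegrand, Fin.init_snoc, Fin.snoc_last, hf]
        have e1 : cexp (t * (ℓ₀ - ∑ c, I * (v c : ℂ))) = cexp (-l * t) * (cexp (d * t) *
            cexp ((∑ b, (I * (y b : ℂ) - d) - ∑ a, I * (v a : ℂ)) * t)) := by
          rw [← Complex.exp_add, ← Complex.exp_add]
          congr 1
          simp only [hℓ₀, Finset.sum_sub_distrib, Finset.sum_const, Finset.card_univ,
            Fintype.card_fin, nsmul_eq_mul]
          push_cast; ring
        rw [e1]; ring
      simp_rw [← e]
      rw [integral_const_mul, integral_const_mul, integral_const_mul]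
      have e2 : cexp (d * (∑ a, (x' a : ℂ) - ∑ a, (τ a : ℂ))) * cexp (l * (Z - t)) *
          cexp (d * (∑ a, (τ a : ℂ) + t)) = cexp (l * Z) * cexp (d * ∑ a, (x' a : ℂ)) *
          cexp (-l * t) * cexp (d * t) := by
        simp only [← Complex.exp_add]
        congr 1; ring
      generalize ∫ v, mbIntegrand (phi k) (fun b => I * y b - d)
        (Fin.snoc τ t : Fin (k + 1) → ℝ) v = J
      linear_combination ((cexp (-Real.exp (Z - t)) * cexp (-Real.exp (t - x' (Fin.last k)))) *
        giventalKernel (l - d) x' τ * mbCoeff k * J) * e2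
    simp_rw [hexp]
    rw [integral_const_mul, integral_integral_swap hfi]
    have hin : ∀ v, ∫ τ, f τ v = mbKernel (fun b => I * y b - d) v *
          cexp (t * (∑ b, I * (y b : ℂ) - ∑ c, I * (v c : ℂ) - k * d - l)) *
          wh (snocParam v 0 (l - d)) x' := by
      intro v
      rw [ih v (l := l - d) (by simp; linarith) (by simp; linarith) x', ← integral_const_mul]
      refine integral_congr_ae (Eventually.of_forall fun τ => ?_)
      simp only [hf]
      rw [show ∑ b, I * (y b : ℂ) - ∑ c, I * (v c : ℂ) - k * d - l = ℓ₀ - ∑ c, I * (v c : ℂ) by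
        rw [hℓ₀]; ring]
      ring
    simp_rw [hin]
    ring

theorem phi_succ_eq_integral {n : ℕ} (y : Fin (n + 1) → ℝ) (x : Fin (n + 1) → ℝ) :
    phi (n + 1) y x = ∫ τ : Fin n → ℝ,
      giventalKernel (I * y (Fin.last n)) x τ * phi n (Fin.init y) τ := by
  rw [← wh_snocParam_eq_integral (Fin.init y) (by simp) (by simp) x]
  have : snocParam (Fin.init y) 0 (I * y (Fin.last n)) = fun b => I * (y b : ℂ) := by
    ext b
    refine Fin.lastCases ?_ (fun j => ?_) b
    · rw [snocParam_last]
    · rw [snocParam_castSucc, add_zero]; rfl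
  rw [this]
  rfl

/-- The shift of the coordinates that reduces everything to `ħ = 1`. -/
def rescale (ħ : ℝ) {N : ℕ} (x : Fin N → ℝ) : Fin N → ℝ :=
  fun n => x n + ((N : ℝ) - 1 - 2 * (n : ℕ)) * Real.log ħ

theorem init_rescale (ħ : ℝ) {N : ℕ} (x : Fin (N + 1) → ℝ) :
    Fin.init (rescale ħ x) = fun a => rescale ħ (Fin.init x) a + Real.log ħ := by
  ext a
  simp only [Fin.init, rescale, Fin.val_castSucc]
  push_cast; ring

theorem rescale_last (ħ : ℝ) {N : ℕ} (x : Fin (N + 1) → ℝ) :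
    rescale ħ x (Fin.last N) = x (Fin.last N) - N * Real.log ħ := by
  simp only [rescale, Fin.val_last]
  push_cast; ring

theorem sum_rescale (ħ : ℝ) {N : ℕ} (x : Fin N → ℝ) :
    ∑ a, (rescale ħ x a : ℂ) = ∑ a, (x a : ℂ) := by
  have h : ∀ M : ℕ, ∑ i ∈ Finset.range M, (2 * (i : ℝ)) = M * ((M : ℝ) - 1) := by
    intro M
    induction M with
    | zero => simp
    | succ M ih => rw [Finset.sum_range_succ, ih]; push_cast; ring
  have h2 : ∑ a : Fin N, (2 * ((a : ℕ) : ℝ)) = N * ((N : ℝ) - 1) := by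
    rw [← h N, Finset.sum_range]
  have h3 : ∑ a, rescale ħ x a = ∑ a, x a := by
    simp only [rescale, Finset.sum_add_distrib, ← Finset.sum_mul, Finset.sum_sub_distrib,
      h2, Finset.sum_const, Finset.card_univ, Fintype.card_fin, nsmul_eq_mul]
    ring
  rw [← ofReal_sum, h3, ofReal_sum]

theorem sum_rescale_eq_init (ħ : ℝ) {N : ℕ} (x : Fin (N + 1) → ℝ) :
    ∑ a, (rescale ħ x a : ℂ) = ∑ a, (rescale ħ (Fin.init x) a : ℂ) + x (Fin.last N) := by
  rw [sum_rescale, sum_rescale, sum_eq_sum_init_add_last]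

theorem varpi_contour {ħ : ℝ} (hħ : 0 < ħ) {M : ℕ} (γ δ : ℝ) (y : Fin (M + 1) → ℝ)
    (u : Fin M → ℝ) :
    varpi ħ (contour δ u) (contour γ y) =
      cexp (Real.log ħ * (I / ħ) * ((M + 1) * (∑ a, (u a : ℂ) - M * (I * δ)) -
        M * (∑ b, (y b : ℂ) - (M + 1) * (I * γ)))) *
      mbKernel (fun b => I * ((y b / ħ : ℝ) : ℂ) - ((δ - γ) / ħ : ℝ)) (fun a => u a / ħ) := by
  have hħ' : (ħ : ℂ) ≠ 0 := by exact_mod_cast hħ.ne'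
  have e1 : ∀ a b, (contour γ y b - contour δ u a) / (I * ħ) =
      I * ((u a / ħ : ℝ) : ℂ) - (I * ((y b / ħ : ℝ) : ℂ) - ((δ - γ) / ħ : ℝ)) := by
    intro a b
    simp only [contour]
    push_cast
    field_simp
    linear_combination (y b - u a : ℂ) * I_sq
  have e2 : ∀ a b, (contour δ u b - contour δ u a) / (I * ħ) =
      I * ((u a / ħ : ℝ) : ℂ) - I * ((u b / ħ : ℝ) : ℂ) := by
    intro a b
    simp only [contour]
    push_cast
    field_simp
    linear_combination (u b - u a : ℂ) * I_sq
  have e3 : ∏ a, ∏ b, (ħ : ℂ) ^ (I / ħ * (contour δ u a - contour γ y b)) =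
      cexp (Real.log ħ * (I / ħ) * ((M + 1) * (∑ a, (u a : ℂ) - M * (I * δ)) -
        M * (∑ b, (y b : ℂ) - (M + 1) * (I * γ)))) := by
    simp only [cpow_def_of_ne_zero hħ', ← Complex.exp_sum, ← ofReal_log hħ.le]
    congr 1
    simp only [← Finset.mul_sum, ← mul_assoc]
    congr 1
    simp only [contour, Finset.sum_sub_distrib, Finset.sum_const, Finset.card_univ,
      Fintype.card_fin, nsmul_eq_mul, ← Finset.mul_sum]
    push_cast; ring
  rw [varpi, mbKernel, sklyanin]
  simp only [Finset.prod_mul_distrib, e1, e2, e3]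
  ring

theorem mellinBarnesIntegrand_eq {ħ : ℝ} (hħ : 0 < ħ) {M : ℕ} {γ δ : ℝ}
    {F : (Fin M → ℂ) → (Fin M → ℝ) → ℂ} (y x : Fin (M + 1) → ℝ) (u : Fin M → ℝ)
    (hF : F (contour δ u) (Fin.init x) =
      cexp ((δ / ħ : ℝ) * ∑ a, (rescale ħ (Fin.init x) a : ℂ)) *
        phi M (fun a => u a / ħ) (rescale ħ (Fin.init x))) :
    mellinBarnesIntegrand ħ F (contour γ y) x (contour δ u) =
      (cexp ((δ / ħ : ℝ) * ∑ a, (rescale ħ x a : ℂ)) * mbCoeff M * ((ħ : ℂ) ^ M)⁻¹) *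
      mbIntegrand (phi M) (fun b => I * ((y b / ħ : ℝ) : ℂ) - ((δ - γ) / ħ : ℝ)) (rescale ħ x)
        (ħ⁻¹ • u) := by
  have hħ' : (ħ : ℂ) ≠ 0 := by exact_mod_cast hħ.ne'
  have hu : ħ⁻¹ • u = fun a => u a / ħ := by
    ext a; simp [div_eq_inv_mul]
  rw [hu, mellinBarnesIntegrand, mbIntegrand, hF, varpi_contour hħ, init_rescale,
    phi_add_const_right, rescale_last, sum_rescale_eq_init]
  set R := ∑ a, (rescale ħ (Fin.init x) a : ℂ) with hR
  set κ := mbKernel (fun b => I * ((y b / ħ : ℝ) : ℂ) - ((δ - γ) / ħ : ℝ))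
    (fun a => u a / ħ) with hκ
  set P := phi M (fun a => u a / ħ) (rescale ħ (Fin.init x)) with hP
  set X := x (Fin.last M) with hX
  have hc : mbCoeff M * ((ħ : ℂ) ^ M)⁻¹ = ((M.factorial : ℂ) * (2 * Real.pi * ħ : ℂ) ^ M)⁻¹ := by
    rw [mbCoeff, mul_pow _ (ħ : ℂ), ← mul_inv]; ring
  have key : cexp (I / ħ * ((∑ b, contour γ y b - ∑ a, contour δ u a) * X)) *
      cexp ((δ / ħ : ℝ) * R) *
      cexp (Real.log ħ * (I / ħ) * ((M + 1) * (∑ a, (u a : ℂ) - M * (I * δ)) -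
        M * (∑ b, (y b : ℂ) - (M + 1) * (I * γ)))) =
      cexp ((δ / ħ : ℝ) * (R + X)) *
      cexp ((∑ b, (I * ((y b / ħ : ℝ) : ℂ) - ((δ - γ) / ħ : ℝ)) - ∑ a, I * ((u a / ħ : ℝ) : ℂ)) *
        ((X - M * Real.log ħ : ℝ) : ℂ)) *
      cexp (I * Real.log ħ * ∑ a, ((u a / ħ : ℝ) : ℂ)) := by
    rw [← Complex.exp_add, ← Complex.exp_add, ← Complex.exp_add, ← Complex.exp_add]
    congr 1
    simp only [contour, Finset.sum_sub_distrib, Finset.sum_const, Finset.card_univ,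
      Fintype.card_fin, nsmul_eq_mul, ← Finset.mul_sum]
    push_cast
    simp only [← Finset.sum_div]
    generalize ∑ a, (u a : ℂ) = U
    generalize ∑ b, (y b : ℂ) = Y
    field_simp
    ring_nf
    simp only [I_sq]
    ring
  rw [div_eq_mul_inv, ← hc]
  linear_combination (mbCoeff M * ((ħ : ℂ) ^ M)⁻¹ * P * κ) * key

theorem phi_one (y x : Fin 1 → ℝ) : phi 1 y x = cexp (I * y 0 * x 0) := by
  rw [phi_succ_eq_integral, integral_fin_zero]
  simp [giventalKernel, phi]

theorem whittaker_contour {ħ : ℝ} (hħ : 0 < ħ) (N : ℕ) {α : ℕ → ℝ} (hα : StrictMono α) {γ : ℝ}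
    (hγ : γ < α 0) (y x : Fin N → ℝ) :
    whittaker ħ N α (contour γ y) x =
      cexp ((γ / ħ : ℝ) * ∑ a, (rescale ħ x a : ℂ)) * phi N (fun a => y a / ħ) (rescale ħ x) := by
  have hħ' : (ħ : ℂ) ≠ 0 := by exact_mod_cast hħ.ne'
  induction N generalizing α γ with
  | zero => simp [whittaker, phi]
  | succ N ih =>
    cases N with
    | zero =>
      rw [whittaker, phi_one, ← Complex.exp_add, sum_rescale]
      congr 1
      simp only [contour, rescale]
      push_cast
      field_simp
      simp
      linear_combination (-(γ * x 0 : ℂ)) * I_sq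
    | succ N =>
      have hα' : StrictMono fun s => α (s + 1) := fun a b h => hα (by omega)
      have h01 : α 0 < α (0 + 1) := hα (by omega)
      rw [whittaker]
      simp_rw [mellinBarnesIntegrand_eq hħ (F := whittaker ħ (N + 1) fun s => α (s + 1)) y x _
        (ih hα' h01 _ _)]
      rw [integral_const_mul, Measure.integral_comp_inv_smul]
      have hw := wh_eq (η := fun b => I * ((y b / ħ : ℝ) : ℂ)) (c := (((α 0 - γ) / ħ : ℝ) : ℂ))
        (fun b => by simp) (fun b => by
          rw [ofReal_re]; simpa using div_pos (sub_pos.2 hγ) hħ) (rescale ħ x)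
      have hphi : phi (N + 1 + 1) (fun a => y a / ħ) (rescale ħ x) =
        wh (fun b => I * ((y b / ħ : ℝ) : ℂ)) (rescale ħ x) := rfl
      rw [hphi, hw, mb]
      have hexp : cexp ((α 0 / ħ : ℝ) * ∑ a, (rescale ħ x a : ℂ)) =
          cexp ((γ / ħ : ℝ) * ∑ a, (rescale ħ x a : ℂ)) *
          cexp (((α 0 - γ) / ħ : ℝ) * ∑ a, (rescale ħ x a : ℂ)) := by
        rw [← Complex.exp_add]
        congr 1
        push_cast; ring
      rw [hexp]
      simp only [Module.finrank_fintype_fun_eq_card, Fintype.card_fin, abs_pow, abs_of_pos hħ,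
        real_smul, ofReal_pow]
      have hp : (ħ : ℂ) ^ (N + 1) ≠ 0 := pow_ne_zero _ hħ'
      field_simp

theorem whittakerConverges_contour {ħ : ℝ} (hħ : 0 < ħ) (N : ℕ) {α : ℕ → ℝ} (hα : StrictMono α)
    {γ : ℝ} (hγ : γ < α 0) (y x : Fin N → ℝ) :
    WhittakerConverges ħ N α (contour γ y) x := by
  induction N generalizing α γ with
  | zero => trivial
  | succ N ih =>
    cases N with
    | zero => trivial
    | succ N =>
      have hα' : StrictMono fun s => α (s + 1) := fun a b h => hα (by omega)
      have h01 : α 0 < α (0 + 1) := hα (by omega)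
      refine ⟨?_, fun u => ih hα' h01 u (Fin.init x)⟩
      simp_rw [mellinBarnesIntegrand_eq hħ (F := whittaker ħ (N + 1) fun s => α (s + 1)) y x _
        (whittaker_contour hħ _ hα' h01 _ _)]
      refine ((integrable_mbIntegrand_phi (fun b => ?_) (rescale ħ x)).comp_smul
        (inv_ne_zero hħ.ne')).const_mul _
      have := div_pos (sub_pos.2 hγ) hħ
      rw [sub_re, ofReal_re]
      simpa using this

theorem Lambda_eq {ħ : ℝ} (hħ : 0 < ħ) (lam : ℝ) {N : ℕ} (x : Fin (N + 1) → ℝ) (τ : Fin N → ℝ) :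
    Lambda ħ lam x τ =
      giventalKernel (I * ((lam / ħ : ℝ) : ℂ)) (rescale ħ x) (rescale ħ τ) := by
  have hħ' : (ħ : ℂ) ≠ 0 := by exact_mod_cast hħ.ne'
  have e1 : ∀ a : Fin N, Real.exp (rescale ħ τ a - rescale ħ x a.castSucc) =
      1 / ħ * Real.exp (-(x a.castSucc - τ a)) := by
    intro a
    have : rescale ħ τ a - rescale ħ x a.castSucc = -(x a.castSucc - τ a) - Real.log ħ := by
      simp only [rescale, Fin.val_castSucc]; push_cast; ring
    rw [this, Real.exp_sub, Real.exp_log hħ]; ring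
  have e2 : ∀ a : Fin N, Real.exp (rescale ħ x a.succ - rescale ħ τ a) =
      1 / ħ * Real.exp (x a.succ - τ a) := by
    intro a
    have : rescale ħ x a.succ - rescale ħ τ a = (x a.succ - τ a) - Real.log ħ := by
      simp only [rescale, Fin.val_succ]; push_cast; ring
    rw [this, Real.exp_sub, Real.exp_log hħ]; ring
  rw [Lambda, giventalKernel, sum_rescale, sum_rescale]
  simp only [e1, e2, Vminus, Vplus, ← Complex.exp_add, ← Complex.exp_sum,
    Finset.sum_add_distrib]
  congr 1
  have hs1 := Fin.sum_univ_castSucc (fun a => (x a : ℂ))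
  have hs2 := Fin.sum_univ_succ (fun a => (x a : ℂ))
  have e3 : ∑ a : Fin N, I * (lam * ((x a.castSucc - τ a : ℝ) : ℂ) / (2 * ħ)) =
      I * lam / (2 * ħ) * (∑ a : Fin N, (x a.castSucc : ℂ) - ∑ a, (τ a : ℂ)) := by
    rw [← Finset.sum_sub_distrib, Finset.mul_sum]
    refine Finset.sum_congr rfl fun a _ => ?_
    push_cast; ring
  have e4 : ∑ a : Fin N, I * (lam * ((x a.succ - τ a : ℝ) : ℂ) / (2 * ħ)) =
      I * lam / (2 * ħ) * (∑ a : Fin N, (x a.succ : ℂ) - ∑ a, (τ a : ℂ)) := by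
    rw [← Finset.sum_sub_distrib, Finset.mul_sum]
    refine Finset.sum_congr rfl fun a _ => ?_
    push_cast; ring
  rw [e3, e4]
  have e5 : ∀ f : Fin N → ℝ, ∑ a, -(1 / (ħ : ℂ)) * (Real.exp (f a) : ℂ) =
      ∑ a, -((1 / ħ * Real.exp (f a) : ℝ) : ℂ) := by
    intro f
    refine Finset.sum_congr rfl fun a _ => ?_
    push_cast; ring
  rw [e5 fun a => -(x a.castSucc - τ a), e5 fun a => x a.succ - τ a]
  have hl : I * ((lam / ħ : ℝ) : ℂ) = 2 * (I * lam / (2 * ħ)) := by push_cast; field_simp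
  rw [hl]
  linear_combination (-(I * lam / (2 * ħ))) * (hs1 + hs2)

theorem rescale_eq_add (ħ : ℝ) {N : ℕ} (τ : Fin N → ℝ) : rescale ħ τ = τ + rescale ħ 0 := by
  ext a; simp [rescale]

theorem integrable_Lambda_mul_phi {ħ : ℝ} (hħ : 0 < ħ) (lam : ℝ) {N : ℕ} (x : Fin (N + 1) → ℝ)
    (y : Fin N → ℝ) :
    Integrable fun τ : Fin N → ℝ => Lambda ħ lam x τ * phi N y (rescale ħ τ) := by
  have h := (integrable_giventalKernel_mul_phi (I * ((lam / ħ : ℝ) : ℂ))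
    (rescale ħ x) y).comp_add_right (rescale ħ (0 : Fin N → ℝ))
  simpa only [Lambda_eq hħ, ← rescale_eq_add] using h

theorem integral_Lambda_mul_phi {ħ : ℝ} (hħ : 0 < ħ) (lam : ℝ) {N : ℕ} (x : Fin (N + 1) → ℝ)
    (y : Fin N → ℝ) :
    ∫ τ : Fin N → ℝ, Lambda ħ lam x τ * phi N y (rescale ħ τ) =
      ∫ τ : Fin N → ℝ, giventalKernel (I * ((lam / ħ : ℝ) : ℂ)) (rescale ħ x) τ * phi N y τ := by
  rw [← integral_add_right_eq_self (fun τ : Fin N → ℝ =>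
    giventalKernel (I * ((lam / ħ : ℝ) : ℂ)) (rescale ħ x) τ * phi N y τ)
    (rescale ħ (0 : Fin N → ℝ))]
  simp_rw [Lambda_eq hħ, ← rescale_eq_add]

theorem phi_succ_eq_integral_tail {n : ℕ} (y : Fin (n + 1) → ℝ) (x : Fin (n + 1) → ℝ) :
    phi (n + 1) y x = ∫ τ : Fin n → ℝ,
      giventalKernel (I * y 0) x τ * phi n (Fin.tail y) τ := by
  rw [← phi_comp_perm y x (finRotate (n + 1)), phi_succ_eq_integral]
  have h1 : y (finRotate (n + 1) (Fin.last n)) = y 0 := by rw [finRotate_last]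
  have h2 : Fin.init (fun a => y (finRotate (n + 1) a)) = Fin.tail y := by
    ext a
    simp only [Fin.init, Fin.tail]
    rw [finRotate_apply, Fin.coeSucc_eq_succ]
  rw [h1, h2]

theorem pyramid_eq_phi {ħ : ℝ} (hħ : 0 < ħ) (N : ℕ) (y x : Fin N → ℝ) :
    pyramid ħ N y x = phi N (fun a => y a / ħ) (rescale ħ x) := by
  induction N with
  | zero => rfl
  | succ N ih =>
    rw [pyramid, LambdaOp]
    simp_rw [ih]
    rw [integral_Lambda_mul_phi hħ, phi_succ_eq_integral_tail]
    rfl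

theorem pyramidConverges {ħ : ℝ} (hħ : 0 < ħ) (N : ℕ) (y x : Fin N → ℝ) :
    PyramidConverges ħ N y x := by
  induction N with
  | zero => trivial
  | succ N ih =>
    refine ⟨?_, fun τ => ih _ τ⟩
    simp_rw [pyramid_eq_phi hħ]
    exact integrable_Lambda_mul_phi hħ _ x _

theorem contour_zero {N : ℕ} (y : Fin N → ℝ) : contour 0 y = fun a => (y a : ℂ) := by
  ext a; simp [contour]

theorem whittaker_ofReal {ħ : ℝ} (hħ : 0 < ħ) (N : ℕ) {α : ℕ → ℝ} (hα : StrictMono α)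
    (hα0 : 0 < α 0) (y x : Fin N → ℝ) :
    whittaker ħ N α (fun a => (y a : ℂ)) x = phi N (fun a => y a / ħ) (rescale ħ x) := by
  have := whittaker_contour hħ N hα hα0 y x
  rw [contour_zero] at this
  simpa using this

end Toda

end


theorem mainTheorem6 (ħ : ℝ) (hħ : 0 < ħ) (N : ℕ)
    (α β : ℕ → ℝ) (hα0 : 0 < α 0) (hα : StrictMono α) (hβ0 : 0 < β 0) (hβ : StrictMono β)
    (y x : Fin (N + 1) → ℝ) :
    Toda.WhittakerConverges ħ (N + 1) α (fun a => (y a : ℂ)) x ∧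
    MeasureTheory.Integrable (fun τ : Fin N → ℝ =>
      Toda.Lambda ħ (y (Fin.last N)) x τ *
        Toda.whittaker ħ N β (fun a : Fin N => (y a.castSucc : ℂ)) τ) ∧
    (Toda.whittaker ħ (N + 1) α (fun a => (y a : ℂ)) x =
      ∫ τ : Fin N → ℝ, Toda.Lambda ħ (y (Fin.last N)) x τ *
        Toda.whittaker ħ N β (fun a : Fin N => (y a.castSucc : ℂ)) τ) ∧
    Toda.PyramidConverges ħ (N + 1) y x ∧
    Toda.whittaker ħ (N + 1) α (fun a => (y a : ℂ)) x = Toda.pyramid ħ (N + 1) y x := by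
  have hconv := Toda.whittakerConverges_contour hħ (N + 1) hα hα0 y x
  rw [Toda.contour_zero] at hconv
  have hw : ∀ τ : Fin N → ℝ, Toda.whittaker ħ N β (fun a : Fin N => (y a.castSucc : ℂ)) τ =
      Toda.phi N (fun a => y a.castSucc / ħ) (Toda.rescale ħ τ) := fun τ =>
    Toda.whittaker_ofReal hħ N hβ hβ0 (fun a => y a.castSucc) τ
  simp_rw [hw, Toda.whittaker_ofReal hħ (N + 1) hα hα0]
  refine ⟨hconv, Toda.integrable_Lambda_mul_phi hħ _ x _, ?_, Toda.pyramidConverges hħ _ y x,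
    (Toda.pyramid_eq_phi hħ _ y x).symm⟩
  rw [Toda.integral_Lambda_mul_phi hħ, Toda.phi_succ_eq_integral]
  rfl
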